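/- Let $\mathcal U=\mathcal U_q(\mathfrak{sl}_2)$ be the $\mathbb C(q)$-algebra generated by $K^{\pm1},E,F$ with $K^{\pm1}K^{\mp1}=1$, $KE=q^2EK$, $KF=q^{-2}FK$, $[E,F]=\frac{K-K^{-1}}{q-q^{-1}}$, with coproduct $\Delta(K)=K\otimes K$, $\Delta(E)=E\otimes K+1\otimes E$, $\Delta(F)=F\otimes 1+K^{-1}\otimes F$, and let $\Lambda=(q-q^{-1})^2FE+qK+q^{-1}K^{-1}$ be its quantum Casimir. Let $\mathcal I_L\subset\mathcal U$ be the subalgebra generated by $E,FK,K,\Lambda$, and let $\tau_L\colon\mathcal I_L\to\mathcal U\otimes\mathcal I_L$ be the algebra morphism with \[\tau_L(E)=K\otimes E,\qquad \tau_L(K)=1\otimes K-q^{-1}(q-q^{-1})^2FK\otimes E,\qquad \tau_L(\Lambda)=1\otimes\Lambda,\] \[\tau_L(FK)=K^{-1}\otimes FK-qF\otimes\Lambda+q(q+q^{-1})F\otimes K-q^{-1}(q-q^{-1})^2F^2K\otimes E .\] For a non-empty $A=\{i_1<\dots<i_k\}\subseteq\{1,\dots,n\}$ put \[\Lambda_A=\Big(\big(\mathrm{id}^{\otimes(i_k-2)}\otimes\alpha_{i_k-1}\big)\circ\cdots\circ(\mathrm{id}\otimes\alpha_2)\circ\alpha_1(\Lambda)\Big)\otimes1^{\otimes(n-i_k)}\in\mathcal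 U^{\otimes n},\] where $\alpha_i=\Delta$ if $i\in A$ and $\alpha_i=\tau_L$ otherwise; put $\Lambda_\emptyset=q+q^{-1}$ and $\Lambda_i=\Lambda_{\{i\}}$. Let $\mathrm{AW}(n)\subseteq\mathcal U^{\otimes n}$ be the subalgebra generated by the $\Lambda_A$ with $A\neq\emptyset$, and write $[X,Y]_q=qXY-q^{-1}YX$. For $m\ge0$ let $V_m$ be the irreducible type 1 $\mathcal U$-module of dimension $m+1$, and let $\widehat{\mathcal U}_n=\prod_{m_1,\dots,m_n\ge0}\mathrm{End}(V_{m_1}\otimes\cdots\otimes V_{m_n})$, the completion of $\mathcal U^{\otimes n}$ with respect to its finite-dimensional type 1 representations. Grade $\mathcal U$ by $|E|=1$, $|F|=-1$, $|K|=0$; let $\Psi(x\otimes y)=xK^{-|y|}\otimes K^{-|x|}y$ for homogeneous $x,y$, let $\sigma(x\otimes y)=y\otimes x$ and let \[\Theta=\sum_{r\ge0}q^{r(r-1)/2}\frac{(q-q^{-1})^r}{[r]!}E^r\otimes F^r,\qquad [r]!=\prod_{s=1}^r\frac{q^s-q^{-s}}{q-q^{-1}} .\] For $1\le i\le n-1$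 let $\beta_i$ be the map $x\mapsto\sigma(\Psi^{-1}(\Theta x\Theta^{-1}))$ in the tensor factors $i,i+1$, extended to $\widehat{\mathcal U}_n$. Then $\mathcal U^{\otimes n}\to\widehat{\mathcal U}_n$ is injective, the maps $\beta_1,\dots,\beta_{n-1}$ define an action of the braid group $B_n$ on $\widehat{\mathcal U}_n$ by algebra automorphisms, and this action restricts to $\mathrm{AW}(n)$: every element of $B_n$ maps $\mathrm{AW}(n)$ onto itself. Moreover, for all $1\le i\le n-1$ and $A\subseteq\{1,\dots,n\}$, \[\beta_i\cdot\Lambda_A=\begin{cases}\Lambda_A&\text{if } i,i+1\in A\text{ or }i,i+1\notin A,\\ \Lambda_{(A\setminus\{i\})\cup\{i+1\}}&\text{if }i\in A,\ i+1\notin A,\\ -\dfrac{[\Lambda_{\{i,i+1\}},\Lambda_A]_q-(q-q^{-1})\big(\Lambda_{i+1}\Lambda_{A\cup\{i\}}+\Lambda_i\Lambda_{A\setminus\{i+1\}}\big)}{q^2-q^{-2}}&\text{if }i\notin A,\ i+1\in A.\end{cases}\] -/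

import Mathlib

namespace AskeyWilson

noncomputable section

open scoped TensorProduct

set_option linter.unusedSimpArgs false

/-- The ground field `ℂ(q)`. -/
abbrev Kq : Type := RatFunc ℂ

/-- The indeterminate `q`. -/
def q : Kq := RatFunc.X

theorem q_ne_zero : q ≠ 0 := RatFunc.X_ne_zero

theorem q_sq_ne_one : q ^ 2 ≠ 1 := by
  intro h
  have h2 : (Polynomial.X ^ 2 : Polynomial ℂ) = 1 := by
    apply RatFunc.algebraMap_injective ℂ
    simpa [q, RatFunc.algebraMap_X] using h
  have := congrArg Polynomial.natDegree h2
  simp at this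

theorem q_sub_inv_ne_zero : q - q⁻¹ ≠ 0 := by
  intro h
  apply q_sq_ne_one
  have := q_ne_zero
  field_simp at h
  linear_combination h

/-- The defining relations of `U_q(sl₂)` for elements `e, f, k, k'` of an algebra,
in the roles of `E, F, K, K⁻¹`. -/
structure UqRelations {𝕜 R : Type*} [Field 𝕜] [Ring R] [Algebra 𝕜 R] (q : 𝕜)
    (e f k k' : R) : Prop where
  k_k' : k * k' = 1
  k'_k : k' * k = 1
  k_e : k * e = q ^ 2 • (e * k)
  k_f : k * f = (q ^ 2)⁻¹ • (f * k)
  e_f : e * f - f * e = (q - q⁻¹)⁻¹ • (k - k')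

/-- The generators of `U_q(sl₂)`. -/
inductive UqGen : Type
  | E | F | K | Kinv

open UqGen in
/-- The defining relations of `U_q(sl₂)`. -/
inductive UqRel : FreeAlgebra Kq UqGen → FreeAlgebra Kq UqGen → Prop
  | k_k' : UqRel (FreeAlgebra.ι Kq K * FreeAlgebra.ι Kq Kinv) 1
  | k'_k : UqRel (FreeAlgebra.ι Kq Kinv * FreeAlgebra.ι Kq K) 1
  | k_e : UqRel (FreeAlgebra.ι Kq K * FreeAlgebra.ι Kq E)
      (q ^ 2 • (FreeAlgebra.ι Kq E * FreeAlgebra.ι Kq K))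
  | k_f : UqRel (FreeAlgebra.ι Kq K * FreeAlgebra.ι Kq F)
      ((q ^ 2)⁻¹ • (FreeAlgebra.ι Kq F * FreeAlgebra.ι Kq K))
  | e_f : UqRel (FreeAlgebra.ι Kq E * FreeAlgebra.ι Kq F
        - FreeAlgebra.ι Kq F * FreeAlgebra.ι Kq E)
      ((q - q⁻¹)⁻¹ • (FreeAlgebra.ι Kq K - FreeAlgebra.ι Kq Kinv))

/-- `U_q(sl₂)` as a `ℂ(q)`-algebra given by generators and relations. -/
def Uq : Type := RingQuot UqRel

instance : Ring Uq := inferInstanceAs (Ring (RingQuot UqRel))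
instance : Algebra Kq Uq := inferInstanceAs (Algebra Kq (RingQuot UqRel))

namespace Uq

def mk : FreeAlgebra Kq UqGen →ₐ[Kq] Uq := RingQuot.mkAlgHom Kq UqRel

def E : Uq := mk (FreeAlgebra.ι Kq UqGen.E)
def F : Uq := mk (FreeAlgebra.ι Kq UqGen.F)
def K : Uq := mk (FreeAlgebra.ι Kq UqGen.K)
def Kinv : Uq := mk (FreeAlgebra.ι Kq UqGen.Kinv)

theorem mk_rel {x y : FreeAlgebra Kq UqGen} (h : UqRel x y) : mk x = mk y :=
  RingQuot.mkAlgHom_rel Kq h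

theorem relations : UqRelations q E F K Kinv where
  k_k' := by simpa [E, F, K, Kinv] using mk_rel UqRel.k_k'
  k'_k := by simpa [E, F, K, Kinv] using mk_rel UqRel.k'_k
  k_e := by simpa [E, F, K, Kinv] using mk_rel UqRel.k_e
  k_f := by simpa [E, F, K, Kinv] using mk_rel UqRel.k_f
  e_f := by simpa [E, F, K, Kinv] using mk_rel UqRel.e_f

/-- The images of the generators under a morphism out of `U_q(sl₂)`. -/
def genImage {R : Type*} (e f k k' : R) : UqGen → R
  | .E => e
  | .F => f
  | .K => k
  | .Kinv => k'

/-- The algebra morphism out of `U_q(sl₂)` determined by elements satisfying the relations. -/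
def lift {R : Type*} [Ring R] [Algebra Kq R] {e f k k' : R} (h : UqRelations q e f k k') :
    Uq →ₐ[Kq] R :=
  RingQuot.liftAlgHom Kq (s := UqRel) ⟨FreeAlgebra.lift Kq (genImage e f k k'), by
    intro x y hxy
    cases hxy
    · simpa [genImage] using h.k_k'
    · simpa [genImage] using h.k'_k
    · simpa [genImage] using h.k_e
    · simpa [genImage] using h.k_f
    · simpa [genImage] using h.e_f⟩

section lift
variable {R : Type*} [Ring R] [Algebra Kq R] {e f k k' : R} (h : UqRelations q e f k k')

theorem lift_mk (x : FreeAlgebra Kq UqGen) :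
    lift h (mk x) = FreeAlgebra.lift Kq (genImage e f k k') x :=
  RingQuot.liftAlgHom_mkAlgHom_apply ..

theorem lift_E : lift h E = e := by simp [E, lift_mk, genImage]
theorem lift_F : lift h F = f := by simp [F, lift_mk, genImage]
theorem lift_K : lift h K = k := by simp [K, lift_mk, genImage]
theorem lift_Kinv : lift h Kinv = k' := by simp [Kinv, lift_mk, genImage]
end lift

/-- The quantum Casimir element `Λ = (q - q⁻¹)² F E + q K + q⁻¹ K⁻¹`. -/
def casimir : Uq := (q - q⁻¹) ^ 2 • (F * E) + q • K + q⁻¹ • Kinv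

end Uq


theorem UqRelations.k'_e {𝕜 R : Type*} [Field 𝕜] [Ring R] [Algebra 𝕜 R] {q : 𝕜} {e f k k' : R}
    (h : UqRelations q e f k k') (hq : q ≠ 0) : k' * e = (q ^ 2)⁻¹ • (e * k') := by
  have h1 : k' * (k * e) * k' = e * k' := by rw [← mul_assoc, h.k'_k, one_mul]
  rw [h.k_e, mul_smul_comm, smul_mul_assoc, mul_assoc, mul_assoc, h.k_k', mul_one] at h1
  rw [← h1, smul_smul, inv_mul_cancel₀ (pow_ne_zero 2 hq), one_smul]

theorem UqRelations.k'_f {𝕜 R : Type*} [Field 𝕜] [Ring R] [Algebra 𝕜 R] {q : 𝕜} {e f k k' : R}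
    (h : UqRelations q e f k k') (hq : q ≠ 0) : k' * f = q ^ 2 • (f * k') := by
  have h1 : k' * (k * f) * k' = f * k' := by rw [← mul_assoc, h.k'_k, one_mul]
  rw [h.k_f, mul_smul_comm, smul_mul_assoc, mul_assoc, mul_assoc, h.k_k', mul_one] at h1
  rw [← h1, smul_smul, mul_inv_cancel₀ (pow_ne_zero 2 hq), one_smul]

theorem UqRelations.e_f' {𝕜 R : Type*} [Field 𝕜] [Ring R] [Algebra 𝕜 R] {q : 𝕜} {e f k k' : R}
    (h : UqRelations q e f k k') : e * f = f * e + (q - q⁻¹)⁻¹ • k - (q - q⁻¹)⁻¹ • k' := by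
  have h1 := h.e_f
  rw [smul_sub] at h1
  rw [eq_add_of_sub_eq h1]
  abel

theorem UqRelations.e_k {𝕜 R : Type*} [Field 𝕜] [Ring R] [Algebra 𝕜 R] {q : 𝕜} {e f k k' : R}
    (h : UqRelations q e f k k') (hq : q ≠ 0) : e * k = (q ^ 2)⁻¹ • (k * e) := by
  rw [h.k_e, smul_smul, inv_mul_cancel₀ (pow_ne_zero 2 hq), one_smul]

theorem UqRelations.e_k' {𝕜 R : Type*} [Field 𝕜] [Ring R] [Algebra 𝕜 R] {q : 𝕜} {e f k k' : R}
    (h : UqRelations q e f k k') (hq : q ≠ 0) : e * k' = q ^ 2 • (k' * e) := by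
  rw [h.k'_e hq, smul_smul, mul_inv_cancel₀ (pow_ne_zero 2 hq), one_smul]


/-- Two commuting copies of the generators of `U_q(sl₂)` in an algebra. -/
structure UqPair {𝕜 R : Type*} [Field 𝕜] [Ring R] [Algebra 𝕜 R] (q : 𝕜)
    (e f k k' e₂ f₂ k₂ k₂' : R) : Prop where
  fst : UqRelations q e f k k'
  snd : UqRelations q e₂ f₂ k₂ k₂'
  e_e : e₂ * e = e * e₂
  e_f : e₂ * f = f * e₂
  e_k : e₂ * k = k * e₂
  e_k' : e₂ * k' = k' * e₂
  f_e : f₂ * e = e * f₂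
  f_f : f₂ * f = f * f₂
  f_k : f₂ * k = k * f₂
  f_k' : f₂ * k' = k' * f₂
  k_e : k₂ * e = e * k₂
  k_f : k₂ * f = f * k₂
  k_k : k₂ * k = k * k₂
  k_k' : k₂ * k' = k' * k₂
  k'_e : k₂' * e = e * k₂'
  k'_f : k₂' * f = f * k₂'
  k'_k : k₂' * k = k * k₂'
  k'_k' : k₂' * k' = k' * k₂'

theorem assoc_rule {R : Type*} [Semigroup R] {a b c : R} (h : a * b = c) (x : R) :
    a * (b * x) = c * x := by rw [← mul_assoc, h]

theorem UqPair.coproduct {𝕜 R : Type*} [Field 𝕜] [Ring R] [Algebra 𝕜 R] {q : 𝕜} {e f k k' e₂ f₂ k₂ k₂' : R}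
    (hq : q ≠ 0) (hq3 : q ^ 2 - 1 ≠ 0)
    (h : UqPair q e f k k' e₂ f₂ k₂ k₂') :
    UqRelations q (e * k₂ + e₂) (f + k' * f₂) (k * k₂) (k' * k₂') := by
  obtain ⟨h1, h2, a1, a2, a3, a4, a5, a6, a7, a8, a9, a10, a11, a12, a13, a14, a15, a16⟩ := h
  constructor <;>
  · simp only [mul_add, add_mul, mul_assoc, smul_mul_assoc, mul_smul_comm, mul_one, one_mul,
      sub_mul, mul_sub, smul_add, smul_sub, smul_smul,
      a1, a2, a3, a4, a5, a6, a7, a8, a9, a10, a11, a12, a13, a14, a15, a16,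
      assoc_rule a1, assoc_rule a2, assoc_rule a3, assoc_rule a4, assoc_rule a5, assoc_rule a6,
      assoc_rule a7, assoc_rule a8, assoc_rule a9, assoc_rule a10, assoc_rule a11,
      assoc_rule a12, assoc_rule a13, assoc_rule a14, assoc_rule a15, assoc_rule a16,
      h1.k_k', h1.k'_k, h1.e_k hq, h1.e_k' hq, h1.k_f, h1.k'_f hq, h1.e_f',
      h2.k_k', h2.k'_k, h2.e_k hq, h2.e_k' hq, h2.k_f, h2.k'_f hq, h2.e_f',
      assoc_rule h1.k_k', assoc_rule h1.k'_k, assoc_rule (h1.e_k hq), assoc_rule (h1.e_k' hq),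
      assoc_rule h1.k_f, assoc_rule (h1.k'_f hq), assoc_rule h1.e_f',
      assoc_rule h2.k_k', assoc_rule h2.k'_k, assoc_rule (h2.e_k hq), assoc_rule (h2.e_k' hq),
      assoc_rule h2.k_f, assoc_rule (h2.k'_f hq), assoc_rule h2.e_f']
    try (match_scalars <;> (try field_simp) <;> (try ring))

/-- The value of `τ_L` at `K`, with a central parameter `t` counting the factors `F` on the left. -/
def tauK {𝕜 R : Type*} [Field 𝕜] [Ring R] [Algebra 𝕜 R] (q : 𝕜) (t f k e₂ k₂ : R) : R :=
  k₂ - (q⁻¹ * (q - q⁻¹) ^ 2) • (t * (f * (k * e₂)))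

/-- The value of `τ_L` at `F K`, with the central parameter `t`. -/
def tauFK {𝕜 R : Type*} [Field 𝕜] [Ring R] [Algebra 𝕜 R] (q : 𝕜) (t f k k' e₂ f₂ k₂ k₂' : R) : R :=
  k' * (f₂ * k₂) - q • (t * (f * ((q - q⁻¹) ^ 2 • (f₂ * e₂) + q • k₂ + q⁻¹ • k₂')))
    + (q * (q + q⁻¹)) • (t * (f * k₂))
    - (q⁻¹ * (q - q⁻¹) ^ 2) • (t * (t * (f * (f * (k * e₂)))))

theorem UqPair.tau {𝕜 R : Type*} [Field 𝕜] [Ring R] [Algebra 𝕜 R] {q : 𝕜} {e f k k' e₂ f₂ k₂ k₂' : R}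
    (hq : q ≠ 0) (hq3 : q ^ 2 - 1 ≠ 0)
    (h : UqPair q e f k k' e₂ f₂ k₂ k₂') (t : R) (ht : ∀ x, x * t = t * x) :
    let κ := tauK q t f k e₂ k₂
    let φ := tauFK q t f k k' e₂ f₂ k₂ k₂'
    κ * (k * e₂) = q ^ 2 • (k * e₂ * κ) ∧ κ * φ = (q ^ 2)⁻¹ • (φ * κ) ∧
    (k * e₂) * φ - (q ^ 2)⁻¹ • (φ * (k * e₂)) = (q - q⁻¹)⁻¹ • (κ * κ - 1) ∧
    ((q - q⁻¹) ^ 2 • (f₂ * e₂) + q • k₂ + q⁻¹ • k₂') * κ =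
      ((q ^ 2)⁻¹ * (q - q⁻¹) ^ 2) • (φ * (k * e₂)) + q • (κ * κ) + algebraMap 𝕜 R q⁻¹ := by
  obtain ⟨h1, h2, a1, a2, a3, a4, a5, a6, a7, a8, a9, a10, a11, a12, a13, a14, a15, a16⟩ := h
  have ht2 : ∀ x y, x * (t * y) = t * (x * y) := fun x y => by
    rw [← mul_assoc, ht, mul_assoc]
  refine ⟨?_, ?_, ?_, ?_⟩ <;>
  · simp only [tauK, tauFK, Algebra.algebraMap_eq_smul_one,
      mul_add, add_mul, mul_assoc, smul_mul_assoc, mul_smul_comm, mul_one, one_mul,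
      sub_mul, mul_sub, smul_add, smul_sub, smul_smul, 
      ht e, ht f, ht k, ht k', ht e₂, ht f₂, ht k₂, ht k₂',
      ht2 e, ht2 f, ht2 k, ht2 k', ht2 e₂, ht2 f₂, ht2 k₂, ht2 k₂',
      a1, a2, a3, a4, a5, a6, a7, a8, a9, a10, a11, a12, a13, a14, a15, a16,
      assoc_rule a1, assoc_rule a2, assoc_rule a3, assoc_rule a4, assoc_rule a5, assoc_rule a6,
      assoc_rule a7, assoc_rule a8, assoc_rule a9, assoc_rule a10, assoc_rule a11,
      assoc_rule a12, assoc_rule a13, assoc_rule a14, assoc_rule a15, assoc_rule a16,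
      h1.k_k', h1.k'_k, h1.e_k hq, h1.e_k' hq, h1.k_f, h1.k'_f hq, h1.e_f',
      h2.k_k', h2.k'_k, h2.e_k hq, h2.e_k' hq, h2.k_f, h2.k'_f hq, h2.e_f',
      assoc_rule h1.k_k', assoc_rule h1.k'_k, assoc_rule (h1.e_k hq), assoc_rule (h1.e_k' hq),
      assoc_rule h1.k_f, assoc_rule (h1.k'_f hq), assoc_rule h1.e_f',
      assoc_rule h2.k_k', assoc_rule h2.k'_k, assoc_rule (h2.e_k hq), assoc_rule (h2.e_k' hq),
      assoc_rule h2.k_f, assoc_rule (h2.k'_f hq), assoc_rule h2.e_f']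
    match_scalars <;> (try field_simp) <;> (try ring)

theorem UqPair.map {𝕜 R S : Type*} [Field 𝕜] [Ring R] [Algebra 𝕜 R] [Ring S] [Algebra 𝕜 S] {q : 𝕜}
    {e f k k' e₂ f₂ k₂ k₂' : R} (h : UqPair q e f k k' e₂ f₂ k₂ k₂') (φ : R →ₐ[𝕜] S) :
    UqPair q (φ e) (φ f) (φ k) (φ k') (φ e₂) (φ f₂) (φ k₂) (φ k₂') := by
  obtain ⟨⟨b1, b2, b3, b4, b5⟩, ⟨c1, c2, c3, c4, c5⟩, a1, a2, a3, a4, a5, a6, a7, a8, a9, a10, a11,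
    a12, a13, a14, a15, a16⟩ := h
  constructor <;> (try constructor) <;>
  simp only [← map_mul, ← map_sub, ← map_smul, *, map_one]

open Uq

theorem uqPair_tensor : UqPair q (E ⊗ₜ[Kq] (1 : Uq)) (F ⊗ₜ[Kq] (1 : Uq)) (K ⊗ₜ[Kq] (1 : Uq))
    (Kinv ⊗ₜ[Kq] (1 : Uq)) ((1 : Uq) ⊗ₜ[Kq] E) ((1 : Uq) ⊗ₜ[Kq] F) ((1 : Uq) ⊗ₜ[Kq] K)
    ((1 : Uq) ⊗ₜ[Kq] Kinv) := by
  have h := Uq.relations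
  constructor <;> (try constructor) <;>
  simp only [Algebra.TensorProduct.tmul_mul_tmul, one_mul, mul_one, h.k_k', h.k'_k, h.k_e, h.k_f,
    ← TensorProduct.sub_tmul, ← TensorProduct.tmul_sub, h.e_f, TensorProduct.tmul_smul,
    ← TensorProduct.smul_tmul', Algebra.TensorProduct.one_def]

/-- The comultiplication `Δ(E) = E ⊗ K + 1 ⊗ E`, `Δ(F) = F ⊗ 1 + K⁻¹ ⊗ F`, `Δ(K) = K ⊗ K`. -/
def comul : Uq →ₐ[Kq] Uq ⊗[Kq] Uq :=
  Uq.lift (e := E ⊗ₜ K + 1 ⊗ₜ E) (f := F ⊗ₜ 1 + Kinv ⊗ₜ F) (k := K ⊗ₜ K) (k' := Kinv ⊗ₜ Kinv) (by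
    simpa using uqPair_tensor.coproduct q_ne_zero (sub_ne_zero.mpr q_sq_ne_one))

/-- The subalgebra `I_L` of `U_q(sl₂)` generated by `E`, `F K`, `K` and `Λ`. -/
def IL : Subalgebra Kq Uq := Algebra.adjoin Kq {E, F * K, K, casimir}

def genE : IL := ⟨E, Algebra.subset_adjoin (by simp)⟩
def genFK : IL := ⟨F * K, Algebra.subset_adjoin (by simp)⟩
def genK : IL := ⟨K, Algebra.subset_adjoin (by simp)⟩
def genCasimir : IL := ⟨casimir, Algebra.subset_adjoin (by simp)⟩

/-- The inclusion `U_q(sl₂) ⊗ I_L → U_q(sl₂) ⊗ U_q(sl₂)`. -/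
def inclIL : Uq ⊗[Kq] IL →ₐ[Kq] Uq ⊗[Kq] Uq :=
  Algebra.TensorProduct.map (AlgHom.id Kq Uq) IL.val

theorem inclIL_tmul (x : Uq) (y : IL) : inclIL (x ⊗ₜ y) = x ⊗ₜ (y : Uq) := rfl

theorem inclIL_injective : Function.Injective inclIL :=
  Module.Flat.lTensor_preserves_injective_linearMap (M := Uq) IL.val.toLinearMap
    Subtype.val_injective

/-- An algebra morphism factors through an injective one that contains its values. -/
def factor {A B C : Type*} [Ring A] [Ring B] [Ring C] [Algebra Kq A] [Algebra Kq B]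
    [Algebra Kq C] (j : B →ₐ[Kq] C) (hj : Function.Injective j) (f : A →ₐ[Kq] C)
    (h : ∀ a, f a ∈ j.range) : A →ₐ[Kq] B :=
  ((AlgEquiv.ofInjective j hj).symm : j.range →ₐ[Kq] B).comp (f.codRestrict j.range h)

theorem factor_apply {A B C : Type*} [Ring A] [Ring B] [Ring C] [Algebra Kq A] [Algebra Kq B]
    [Algebra Kq C] (j : B →ₐ[Kq] C) (hj : Function.Injective j) (f : A →ₐ[Kq] C)
    (h : ∀ a, f a ∈ j.range) (a : A) : j (factor j hj f h a) = f a := by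
  have := (AlgEquiv.ofInjective j hj).apply_symm_apply (f.codRestrict j.range h a)
  exact congrArg Subtype.val this

/-- To check that a morphism out of `I_L` takes values in a subalgebra, the generators suffice. -/
theorem IL_mem {C : Type*} [Ring C] [Algebra Kq C] (S : Subalgebra Kq C) (f : IL →ₐ[Kq] C)
    (h1 : f genE ∈ S) (h2 : f genFK ∈ S) (h3 : f genK ∈ S) (h4 : f genCasimir ∈ S) (x : IL) :
    f x ∈ S := by
  obtain ⟨x, hx⟩ := x
  induction hx using Algebra.adjoin_induction with
  | mem y hy =>
    simp only [Set.mem_insert_iff, Set.mem_singleton_iff] at hy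
    rcases hy with rfl | rfl | rfl | rfl
    · exact h1
    · exact h2
    · exact h3
    · exact h4
  | algebraMap r =>
    have := S.algebraMap_mem r
    rwa [← f.commutes] at this
  | add y z hy hz h h' =>
    have := S.add_mem h h'
    rwa [← map_add] at this
  | mul y z hy hz h h' =>
    have := S.mul_mem h h'
    rwa [← map_mul] at this

theorem comul_mem (x : IL) : (comul.comp IL.val) x ∈ inclIL.range := by
  have h := Uq.relations
  apply IL_mem
  · exact ⟨E ⊗ₜ genK + 1 ⊗ₜ genE, by
      simp [inclIL_tmul, genK, genE, comul, lift_E]⟩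
  · refine ⟨(F * K) ⊗ₜ genK + 1 ⊗ₜ genFK, ?_⟩
    simp [inclIL_tmul, genK, genFK, comul, lift_F, lift_K, add_mul, h.k'_k]
  · exact ⟨K ⊗ₜ genK, by simp [inclIL_tmul, genK, comul, lift_K]⟩
  · refine ⟨(q - q⁻¹) ^ 2 • ((F * E) ⊗ₜ genK + F ⊗ₜ genE + (Kinv * E) ⊗ₜ genFK)
      + Kinv ⊗ₜ (genCasimir - q • genK) + q • (K ⊗ₜ genK), ?_⟩
    have e : casimir - q • K = (q - q⁻¹) ^ 2 • (F * E) + q⁻¹ • Kinv := by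
      rw [casimir]; abel
    change inclIL _ = comul casimir
    simp only [map_add, map_smul, inclIL_tmul, genK, genE, genFK, genCasimir,
      Subalgebra.coe_sub, Subalgebra.coe_smul, e]
    simp only [casimir, map_add, map_smul, map_mul, comul, lift_E, lift_F, lift_K, lift_Kinv, add_mul,
      mul_add, Algebra.TensorProduct.tmul_mul_tmul, one_mul, mul_one, TensorProduct.tmul_add,
      TensorProduct.tmul_smul, smul_add]
    abel

/-- The comultiplication on the left coideal `I_L`. -/
def comulIL : IL →ₐ[Kq] Uq ⊗[Kq] IL :=
  factor inclIL inclIL_injective (comul.comp IL.val) comul_mem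

theorem inclIL_comulIL (x : IL) : inclIL (comulIL x) = comul x :=
  factor_apply ..


/-- `U_q(sl₂) ⊗ U_q(sl₂)`. -/
abbrev UU : Type := Uq ⊗[Kq] Uq

/-- The inclusion of polynomials into power series with coefficients in `U_q(sl₂)^{⊗2}`. -/
def polyIncl : Polynomial UU →ₐ[Kq] PowerSeries UU :=
  { Polynomial.coeToPowerSeries.ringHom with
    commutes' := fun r => by
      change ((Polynomial.C (algebraMap Kq UU r) : Polynomial UU) : PowerSeries UU) = _
      rw [Polynomial.coe_C, PowerSeries.algebraMap_apply] }

theorem polyIncl_injective : Function.Injective polyIncl := Polynomial.coe_injective UU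

/-- Evaluation of polynomials at `1`. -/
def evalOne : Polynomial UU →ₐ[Kq] UU :=
  { Polynomial.eval₂RingHom' (RingHom.id UU) 1 (fun a => Commute.one_right a) with
    commutes' := fun r => by
      change Polynomial.eval₂ (RingHom.id UU) 1 (Polynomial.C (algebraMap Kq UU r)) = _
      simp }

def polyC : UU →ₐ[Kq] Polynomial UU := Polynomial.CAlgHom

def pE : Polynomial UU := polyC (K ⊗ₜ E)

def pK : Polynomial UU :=
  tauK q Polynomial.X (polyC (F ⊗ₜ 1)) (polyC (K ⊗ₜ 1)) (polyC (1 ⊗ₜ E)) (polyC (1 ⊗ₜ K))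

def pFK : Polynomial UU :=
  tauFK q Polynomial.X (polyC (F ⊗ₜ 1)) (polyC (K ⊗ₜ 1)) (polyC (Kinv ⊗ₜ 1)) (polyC (1 ⊗ₜ E))
    (polyC (1 ⊗ₜ F)) (polyC (1 ⊗ₜ K)) (polyC (1 ⊗ₜ Kinv))

theorem poly_relations : pK * pE = q ^ 2 • (pE * pK) ∧ pK * pFK = (q ^ 2)⁻¹ • (pFK * pK) ∧
    pE * pFK - (q ^ 2)⁻¹ • (pFK * pE) = (q - q⁻¹)⁻¹ • (pK * pK - 1) ∧
    polyC (1 ⊗ₜ casimir) * pK = ((q ^ 2)⁻¹ * (q - q⁻¹) ^ 2) • (pFK * pE) + q • (pK * pK)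
      + algebraMap Kq _ q⁻¹ := by
  have h := (uqPair_tensor.map polyC).tau q_ne_zero (sub_ne_zero.mpr q_sq_ne_one) Polynomial.X
    (fun x => Polynomial.X_mul.symm)
  simp only [← map_mul, ← map_smul, ← map_add, Algebra.TensorProduct.tmul_mul_tmul, one_mul,
    mul_one, ← TensorProduct.tmul_smul, ← TensorProduct.tmul_add] at h
  simpa only [pK, pE, pFK, casimir] using h

/-- The inverse of `pK` as a power series. -/
def pKinv : PowerSeries UU :=
  PowerSeries.mk fun n =>
    ((1 ⊗ₜ Kinv) * ((q⁻¹ * (q - q⁻¹) ^ 2) • ((F * K) ⊗ₜ E))) ^ n * (1 ⊗ₜ Kinv)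

theorem polyIncl_pK : polyIncl pK = PowerSeries.C (1 ⊗ₜ K) -
    PowerSeries.X * PowerSeries.C ((q⁻¹ * (q - q⁻¹) ^ 2) • ((F * K) ⊗ₜ[Kq] E)) := by
  have h : pK = Polynomial.C ((1 : Uq) ⊗ₜ[Kq] K) -
      Polynomial.X * Polynomial.C ((q⁻¹ * (q - q⁻¹) ^ 2) • ((F * K) ⊗ₜ[Kq] E)) := by
    simp only [pK, tauK, ← map_mul, Algebra.TensorProduct.tmul_mul_tmul, one_mul, mul_one]
    rw [← mul_smul_comm, ← map_smul]
    rfl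
  have hC : ∀ a : UU, polyIncl (Polynomial.C a) = PowerSeries.C a := Polynomial.coe_C
  have hX : polyIncl Polynomial.X = PowerSeries.X := Polynomial.coe_X
  rw [h, map_sub, map_mul, hC, hC, hX]

theorem one_tmul_K_Kinv : ((1 : Uq) ⊗ₜ[Kq] K) * (1 ⊗ₜ Kinv) = 1 := uqPair_tensor.snd.k_k'
theorem one_tmul_Kinv_K : ((1 : Uq) ⊗ₜ[Kq] Kinv) * (1 ⊗ₜ K) = 1 := uqPair_tensor.snd.k'_k

theorem series_inverse {R : Type*} [Ring R] (a a' b : R) (h : a * a' = 1) (h' : a' * a = 1) :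
    (PowerSeries.C a - PowerSeries.X * PowerSeries.C b) *
      (PowerSeries.mk fun n => (a' * b) ^ n * a') = 1 ∧
    (PowerSeries.mk fun n => (a' * b) ^ n * a') *
      (PowerSeries.C a - PowerSeries.X * PowerSeries.C b) = 1 := by
  constructor
  · ext n
    cases n with
    | zero => simp [sub_mul, mul_assoc, h]
    | succ n =>
      simp [sub_mul, mul_assoc, PowerSeries.coeff_succ_X_mul, PowerSeries.coeff_one, pow_succ']
      simp [← mul_assoc, h]
  · ext n
    cases n with
    | zero => simp [mul_sub, PowerSeries.X_mul, ← mul_assoc, h']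
    | succ n =>
      simp [mul_sub, PowerSeries.X_mul, ← mul_assoc, PowerSeries.coeff_succ_mul_X,
        PowerSeries.coeff_one, pow_succ]
      simp [mul_assoc, h']

theorem pK_mul_pKinv : polyIncl pK * pKinv = 1 := by
  rw [polyIncl_pK]
  exact (series_inverse _ _ _ one_tmul_K_Kinv one_tmul_Kinv_K).1

theorem pKinv_mul_pK : pKinv * polyIncl pK = 1 := by
  rw [polyIncl_pK]
  exact (series_inverse _ _ _ one_tmul_K_Kinv one_tmul_Kinv_K).2

theorem tau_relations :
    UqRelations q (polyIncl pE) (polyIncl pFK * pKinv) (polyIncl pK) pKinv := by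
  obtain ⟨h1, h2, h3, -⟩ := poly_relations
  have h1' := congrArg polyIncl h1
  have h2' := congrArg polyIncl h2
  have h3' := congrArg polyIncl h3
  simp only [map_mul, map_smul, map_sub, map_one] at h1' h2' h3'
  have hi := pK_mul_pKinv
  have hi' := pKinv_mul_pK
  refine ⟨hi, hi', h1', ?_, ?_⟩
  · rw [← mul_assoc, h2', smul_mul_assoc, mul_assoc, hi, mul_assoc, hi']
  · have h4 : pKinv * polyIncl pE = (q ^ 2)⁻¹ • (polyIncl pE * pKinv) := by
      have h1 : pKinv * (polyIncl pK * polyIncl pE) * pKinv = polyIncl pE * pKinv := by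
        rw [← mul_assoc, hi', one_mul]
      rw [h1', mul_smul_comm, smul_mul_assoc, mul_assoc, mul_assoc, hi, mul_one] at h1
      rw [← h1, smul_smul, inv_mul_cancel₀ (pow_ne_zero 2 q_ne_zero), one_smul]
    rw [mul_assoc (polyIncl pFK), h4, mul_smul_comm, ← mul_assoc, ← mul_assoc, ← smul_mul_assoc,
      ← sub_mul, h3', smul_mul_assoc, sub_mul, mul_assoc, hi, mul_one, one_mul]

/-- The morphism `x ↦ ∑ τ_L(x)_d t^d`, where the degree `d` counts `F` in the first factor; it is
defined on the whole of `U_q(sl₂)`, with values in power series. -/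
def tauSeries : Uq →ₐ[Kq] PowerSeries UU := Uq.lift tau_relations

theorem tauSeries_E : tauSeries E = polyIncl pE := lift_E _
theorem tauSeries_K : tauSeries K = polyIncl pK := lift_K _

theorem tauSeries_FK : tauSeries (F * K) = polyIncl pFK := by
  rw [map_mul, tauSeries, lift_F, lift_K, mul_assoc, pKinv_mul_pK, mul_one]

theorem tauSeries_casimir : tauSeries casimir = polyIncl (polyC (1 ⊗ₜ casimir)) := by
  have h := Uq.relations
  have e : casimir * K = ((q ^ 2)⁻¹ * (q - q⁻¹) ^ 2) • ((F * K) * E) + q • (K * K)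
      + algebraMap Kq _ q⁻¹ := by
    simp only [casimir, add_mul, smul_mul_assoc, h.k'_k, mul_assoc, h.e_k q_ne_zero,
      mul_smul_comm, smul_smul, Algebra.algebraMap_eq_smul_one]
    rw [mul_comm ((q - q⁻¹) ^ 2)]
  have e1 := congrArg tauSeries e
  have e2 := congrArg polyIncl poly_relations.2.2.2
  rw [map_mul, map_add, map_add, map_smul, map_smul, map_mul _ (F * K), tauSeries_FK, map_mul,
    AlgHom.commutes, tauSeries_K, tauSeries_E] at e1
  rw [map_mul, map_add, map_add, map_smul, map_smul, map_mul, map_mul, AlgHom.commutes, ← e1] at e2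
  have e3 := congrArg (· * pKinv) e2
  simp only [mul_assoc, pK_mul_pKinv, mul_one] at e3
  exact e3.symm

theorem tauSeries_mem (x : IL) : (tauSeries.comp IL.val) x ∈ polyIncl.range := by
  apply IL_mem
  · exact ⟨pE, tauSeries_E.symm⟩
  · exact ⟨pFK, tauSeries_FK.symm⟩
  · exact ⟨pK, tauSeries_K.symm⟩
  · exact ⟨_, tauSeries_casimir.symm⟩

def tauPoly : IL →ₐ[Kq] Polynomial UU :=
  factor polyIncl polyIncl_injective (tauSeries.comp IL.val) tauSeries_mem

theorem tauPoly_eq {x : IL} {p : Polynomial UU} (h : tauSeries x = polyIncl p) :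
    tauPoly x = p :=
  polyIncl_injective ((factor_apply ..).trans h)

theorem evalOne_polyC (x : UU) : evalOne (polyC x) = x := Polynomial.eval₂_C _ _
theorem evalOne_X : evalOne Polynomial.X = 1 := Polynomial.eval₂_X _ _

/-- `τ_L` with values in `U_q(sl₂) ⊗ U_q(sl₂)`. -/
def tauUU : IL →ₐ[Kq] UU := evalOne.comp tauPoly

theorem tauUU_E : tauUU genE = K ⊗ₜ E := by
  rw [tauUU, AlgHom.comp_apply, tauPoly_eq (x := genE) tauSeries_E, pE, evalOne_polyC]

theorem tauUU_FK : tauUU genFK = Kinv ⊗ₜ (F * K) - q • (F ⊗ₜ casimir)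
    + (q * (q + q⁻¹)) • (F ⊗ₜ K) - (q⁻¹ * (q - q⁻¹) ^ 2) • ((F ^ 2 * K) ⊗ₜ E) := by
  rw [tauUU, AlgHom.comp_apply, tauPoly_eq (x := genFK) tauSeries_FK, pFK, tauFK]
  simp only [map_add, map_sub, map_smul, map_mul, evalOne_polyC, evalOne_X,
    Algebra.TensorProduct.tmul_mul_tmul, one_mul, mul_one, ← TensorProduct.tmul_smul,
    ← TensorProduct.tmul_add, pow_two, mul_assoc, casimir]

theorem tauUU_K : tauUU genK = 1 ⊗ₜ K - (q⁻¹ * (q - q⁻¹) ^ 2) • ((F * K) ⊗ₜ E) := by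
  rw [tauUU, AlgHom.comp_apply, tauPoly_eq (x := genK) tauSeries_K, pK, tauK]
  simp only [map_sub, map_smul, map_mul, evalOne_polyC, evalOne_X,
    Algebra.TensorProduct.tmul_mul_tmul, one_mul, mul_one]

theorem tauUU_casimir : tauUU genCasimir = 1 ⊗ₜ casimir := by
  rw [tauUU, AlgHom.comp_apply, tauPoly_eq (x := genCasimir) tauSeries_casimir, evalOne_polyC]

theorem tauUU_mem (x : IL) : tauUU x ∈ inclIL.range := by
  apply IL_mem
  · exact ⟨K ⊗ₜ genE, tauUU_E.symm⟩
  · refine ⟨Kinv ⊗ₜ genFK - q • (F ⊗ₜ genCasimir)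
      + (q * (q + q⁻¹)) • (F ⊗ₜ genK) - (q⁻¹ * (q - q⁻¹) ^ 2) • ((F ^ 2 * K) ⊗ₜ genE), ?_⟩
    rw [tauUU_FK]
    simp only [map_add, map_sub, map_smul]
    rfl
  · refine ⟨1 ⊗ₜ genK - (q⁻¹ * (q - q⁻¹) ^ 2) • ((F * K) ⊗ₜ genE), ?_⟩
    rw [tauUU_K]
    simp only [map_sub, map_smul]
    rfl
  · exact ⟨1 ⊗ₜ genCasimir, tauUU_casimir.symm⟩

/-- The left coaction `τ_L : I_L → U_q(sl₂) ⊗ I_L`. It is the algebra morphism whose values on the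
generators are given in `tauL_E`, `tauL_FK`, `tauL_K` and `tauL_casimir`. -/
def tauL : IL →ₐ[Kq] Uq ⊗[Kq] IL := factor inclIL inclIL_injective tauUU tauUU_mem

theorem inclIL_tauL (x : IL) : inclIL (tauL x) = tauUU x := factor_apply ..

theorem tauL_E : tauL genE = K ⊗ₜ genE :=
  inclIL_injective (by rw [inclIL_tauL, tauUU_E]; rfl)

theorem tauL_FK : tauL genFK = Kinv ⊗ₜ genFK - q • (F ⊗ₜ genCasimir)
    + (q * (q + q⁻¹)) • (F ⊗ₜ genK) - (q⁻¹ * (q - q⁻¹) ^ 2) • ((F ^ 2 * K) ⊗ₜ genE) :=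
  inclIL_injective (by
    rw [inclIL_tauL, tauUU_FK]
    simp only [map_add, map_sub, map_smul]
    rfl)

theorem tauL_K : tauL genK = 1 ⊗ₜ genK - (q⁻¹ * (q - q⁻¹) ^ 2) • ((F * K) ⊗ₜ genE) :=
  inclIL_injective (by
    rw [inclIL_tauL, tauUU_K]
    simp only [map_sub, map_smul]
    rfl)

theorem tauL_casimir : tauL genCasimir = 1 ⊗ₜ genCasimir :=
  inclIL_injective (by rw [inclIL_tauL, tauUU_casimir]; rfl)


/-- The identification `U^{⊗j} ⊗ U ≃ U^{⊗(j+1)}` appending a last tensor factor. -/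
def snoc (j : ℕ) : (⨂[Kq]^j Uq) ⊗[Kq] Uq ≃ₗ[Kq] (⨂[Kq]^(j + 1) Uq) :=
  (TensorProduct.congr (LinearEquiv.refl Kq (⨂[Kq]^j Uq))
    (PiTensorProduct.subsingletonEquiv (R := Kq) (s := fun _ : Fin 1 => Uq) 0).symm).trans
    TensorPower.mulEquiv

/-- The map `id^{⊗j} ⊗ α : U^{⊗j} ⊗ I_L → U^{⊗(j+1)} ⊗ I_L`. -/
def step (α : IL →ₐ[Kq] Uq ⊗[Kq] IL) (j : ℕ) :
    (⨂[Kq]^j Uq) ⊗[Kq] IL →ₗ[Kq] (⨂[Kq]^(j + 1) Uq) ⊗[Kq] IL :=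
  (snoc j).toLinearMap.rTensor IL ∘ₗ
    (TensorProduct.assoc Kq (⨂[Kq]^j Uq) Uq IL).symm.toLinearMap ∘ₗ
    α.toLinearMap.lTensor (⨂[Kq]^j Uq)

/-- The iterate `(id^{⊗(j-1)} ⊗ α_{j-1}) ∘ ⋯ ∘ (id ⊗ α_1) ∘ α_0 (Λ)` in `U^{⊗j} ⊗ I_L`, with
`α_i = Δ` if `i ∈ A` and `α_i = τ_L` otherwise; the tensor factors are numbered from `0`. -/
def casimirIter (A : Finset ℕ) : (j : ℕ) → (⨂[Kq]^j Uq) ⊗[Kq] IL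
  | 0 => 1 ⊗ₜ genCasimir
  | j + 1 => step (if j ∈ A then comulIL else tauL) j (casimirIter A j)

/-- The Casimir `Λ_A` in `U^{⊗n}` for a subset `A` of `{0, …, n-1}`: if `m` is the largest element
of `A`, it is the iterate in `U^{⊗m} ⊗ I_L ⊆ U^{⊗(m+1)}`, followed by `⊗ 1` for the remaining
factors. For `A = ∅` it is the scalar `q + q⁻¹`. -/
def casimirSet (A : Finset ℕ) : (n : ℕ) → ⨂[Kq]^n Uq
  | 0 => algebraMap Kq (⨂[Kq]^0 Uq) (q + q⁻¹)
  | n + 1 =>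
    if n ∈ A then snoc n (IL.val.toLinearMap.lTensor (⨂[Kq]^n Uq) (casimirIter A n))
    else snoc n (casimirSet A n ⊗ₜ 1)

/-- The higher rank Askey–Wilson algebra `AW(n)`. -/
def AW (n : ℕ) : Subalgebra Kq (⨂[Kq]^n Uq) :=
  Algebra.adjoin Kq {x | ∃ A : Finset ℕ, A.Nonempty ∧ A ⊆ Finset.range n ∧ x = casimirSet A n}

/-- The `q`-commutator `[x, y]_q = q x y - q⁻¹ y x`. -/
def qComm {n : ℕ} (x y : ⨂[Kq]^n Uq) : ⨂[Kq]^n Uq := q • (x * y) - q⁻¹ • (y * x)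

/-- The quantum integer `[z] = (q^z - q^{-z}) / (q - q⁻¹)`. -/
def qInt (z : ℤ) : Kq := (q ^ z - q ^ (-z)) / (q - q⁻¹)

/-- The quantum factorial `[r]! = [1] [2] ⋯ [r]`. -/
def qFactorial (r : ℕ) : Kq := ∏ s ∈ Finset.range r, qInt (s + 1)

/-- The weight of the basis vector `v_a` of the irreducible module `V_m` of dimension `m + 1`:
`K v_a = q^(m - 2a) v_a`. -/
def weight (m : ℕ) (a : Fin (m + 1)) : ℤ := m - 2 * (a : ℤ)

/-- The action of `E` on `V_m`: `E v_a = [m - a + 1] v_{a-1}`. -/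
def repE (m : ℕ) : Matrix (Fin (m + 1)) (Fin (m + 1)) Kq :=
  Matrix.of fun a b => if (a : ℕ) + 1 = b then qInt (m - a) else 0

/-- The action of `F` on `V_m`: `F v_a = [a + 1] v_{a+1}`. -/
def repF (m : ℕ) : Matrix (Fin (m + 1)) (Fin (m + 1)) Kq :=
  Matrix.of fun a b => if (a : ℕ) = b + 1 then qInt a else 0

def repK (m : ℕ) : Matrix (Fin (m + 1)) (Fin (m + 1)) Kq :=
  Matrix.diagonal fun a => q ^ weight m a

def repKinv (m : ℕ) : Matrix (Fin (m + 1)) (Fin (m + 1)) Kq :=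
  Matrix.diagonal fun a => q ^ (-weight m a)

theorem repE_mul (m : ℕ) (M : Matrix (Fin (m + 1)) (Fin (m + 1)) Kq) (a b : Fin (m + 1)) :
    (repE m * M) a b = if h : (a : ℕ) < m then qInt (m - a) * M ⟨a + 1, by omega⟩ b else 0 := by
  rw [Matrix.mul_apply]
  split_ifs with h
  · rw [Finset.sum_eq_single ⟨(a : ℕ) + 1, by omega⟩]
    · simp [repE]
    · intro c _ hc
      have : (a : ℕ) + 1 ≠ c := fun e => hc (Fin.ext e.symm)
      simp [repE, this]
    · simp
  · apply Finset.sum_eq_zero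
    intro c _
    have : (a : ℕ) + 1 ≠ c := by omega
    simp [repE, this]

theorem repF_mul (m : ℕ) (M : Matrix (Fin (m + 1)) (Fin (m + 1)) Kq) (a b : Fin (m + 1)) :
    (repF m * M) a b = if h : 0 < (a : ℕ) then qInt a * M ⟨a - 1, by omega⟩ b else 0 := by
  rw [Matrix.mul_apply]
  split_ifs with h
  · rw [Finset.sum_eq_single ⟨(a : ℕ) - 1, by omega⟩]
    · have : (a : ℕ) = a - 1 + 1 := by omega
      simp only [repF, Matrix.of_apply]
      rw [if_pos this]
    · intro c _ hc
      have : (a : ℕ) ≠ c + 1 := fun e => hc (Fin.ext (by simp; omega))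
      simp [repF, this]
    · simp
  · apply Finset.sum_eq_zero
    intro c _
    have : (a : ℕ) ≠ c + 1 := by omega
    simp [repF, this]

theorem qInt_zero : qInt 0 = 0 := by simp [qInt]

theorem qInt_identity (x y : ℤ) :
    qInt x * qInt (y + 1) - qInt y * qInt (x + 1)
      = (q - q⁻¹)⁻¹ * (q ^ (x - y) - q ^ (-(x - y))) := by
  have hq := q_ne_zero
  have h := q_sub_inv_ne_zero
  simp only [qInt, neg_sub, neg_add, zpow_sub₀ hq, zpow_add₀ hq, zpow_neg, zpow_one]
  generalize hz : q ^ x = X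
  generalize hw : q ^ y = Y
  have hX : X ≠ 0 := hz ▸ zpow_ne_zero x hq
  have hY : Y ≠ 0 := hw ▸ zpow_ne_zero y hq
  have h3 : q ^ 2 - 1 ≠ 0 := sub_ne_zero.mpr q_sq_ne_one
  field_simp
  ring

theorem rep_relations (m : ℕ) : UqRelations q (repE m) (repF m) (repK m) (repKinv m) := by
  have hq := q_ne_zero
  refine ⟨?_, ?_, ?_, ?_, ?_⟩
  · rw [repK, repKinv, Matrix.diagonal_mul_diagonal, ← Matrix.diagonal_one]
    congr 1
    ext a
    rw [← zpow_add₀ hq, add_neg_cancel, zpow_zero]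
  · rw [repK, repKinv, Matrix.diagonal_mul_diagonal, ← Matrix.diagonal_one]
    congr 1
    ext a
    rw [← zpow_add₀ hq, neg_add_cancel, zpow_zero]
  · ext a b
    rw [repK, Matrix.diagonal_mul, Matrix.smul_apply, Matrix.mul_diagonal, smul_eq_mul]
    by_cases h : (a : ℕ) + 1 = b
    · have : weight m a = 2 + weight m b := by simp only [weight, ← h]; push_cast; ring
      rw [this, zpow_add₀ hq]
      norm_cast
      ring
    · simp [repE, h]
  · ext a b
    rw [repK, Matrix.diagonal_mul, Matrix.smul_apply, Matrix.mul_diagonal, smul_eq_mul]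
    by_cases h : (a : ℕ) = b + 1
    · have : weight m a = -2 + weight m b := by simp only [weight, h]; push_cast; ring
      rw [this, zpow_add₀ hq, zpow_neg]
      norm_cast
      ring
    · simp [repF, h]
  · ext a b
    rw [Matrix.sub_apply, repE_mul, repF_mul, Matrix.smul_apply, Matrix.sub_apply, repK, repKinv,
      smul_eq_mul]
    by_cases hab : a = b
    · subst hab
      rw [Matrix.diagonal_apply_eq, Matrix.diagonal_apply_eq]
      have h1 : (if h : (a : ℕ) < m then
          qInt (m - a) * repF m ⟨a + 1, by omega⟩ a else 0) = qInt (m - a) * qInt (a + 1) := by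
        split_ifs with h
        · simp [repF]
        · have : (m : ℤ) - a = 0 := by omega
          rw [this, qInt_zero, zero_mul]
      have h2 : (if h : 0 < (a : ℕ) then qInt a * repE m ⟨a - 1, by omega⟩ a else 0)
          = qInt a * qInt (m - a + 1) := by
        split_ifs with h
        · have e : (a : ℕ) - 1 + 1 = a := by omega
          have e2 : (m : ℤ) - ((a - 1 : ℕ) : ℤ) = m - a + 1 := by omega
          simp only [repE, Matrix.of_apply, if_pos e, e2]
        · have : (a : ℤ) = 0 := by omega
          rw [this, qInt_zero, zero_mul]
      rw [h1, h2, qInt_identity]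
      congr 3 <;> simp only [weight] <;> ring_nf
    · have hab' : (a : ℕ) ≠ b := fun e => hab (Fin.ext e)
      rw [Matrix.diagonal_apply_ne _ hab, Matrix.diagonal_apply_ne _ hab]
      have h1 : ∀ h : (a : ℕ) < m, repF m ⟨a + 1, by omega⟩ b = 0 := fun h => by
        simp [repF, hab']
      have h2 : ∀ h : 0 < (a : ℕ), repE m ⟨a - 1, by omega⟩ b = 0 := fun h => by
        have : (a : ℕ) - 1 + 1 ≠ b := by omega
        simp [repE, this]
      split_ifs <;> simp [h1, h2, *]

/-- The irreducible representation of type `1` on `V_m`. -/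
def rep (m : ℕ) : Uq →ₐ[Kq] Matrix (Fin (m + 1)) (Fin (m + 1)) Kq := Uq.lift (rep_relations m)

/-- The completion of `U_q(sl₂)^{⊗n}` with respect to its finite-dimensional representations of
type `1`: the product over all `m = (m_1, …, m_n)` of the algebras `End(V_{m_1} ⊗ ⋯ ⊗ V_{m_n})`. -/
abbrev Completion (n : ℕ) : Type :=
  (m : Fin n → ℕ) → Matrix ((j : Fin n) → Fin (m j + 1)) ((j : Fin n) → Fin (m j + 1)) Kq

/-- The matrix coefficient of `x_1 ⊗ ⋯ ⊗ x_n` on `V_{m_1} ⊗ ⋯ ⊗ V_{m_n}`. -/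
def coeffTensor {n : ℕ} (m : Fin n → ℕ) (a b : (j : Fin n) → Fin (m j + 1)) :
    MultilinearMap Kq (fun _ : Fin n => Uq) Kq :=
  (MultilinearMap.mkPiAlgebra Kq (Fin n) Kq).compLinearMap fun j =>
    Matrix.entryLinearMap Kq Kq (a j) (b j) ∘ₗ (rep (m j)).toLinearMap

theorem coeffTensor_apply {n : ℕ} (m : Fin n → ℕ) (a b : (j : Fin n) → Fin (m j + 1))
    (x : Fin n → Uq) : coeffTensor m a b x = ∏ j, rep (m j) (x j) (a j) (b j) := rfl

/-- The action of `x_1 ⊗ ⋯ ⊗ x_n` on all the modules `V_{m_1} ⊗ ⋯ ⊗ V_{m_n}`. -/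
def repTensor (n : ℕ) : MultilinearMap Kq (fun _ : Fin n => Uq) (Completion n) where
  toFun x := fun m => Matrix.of fun a b => coeffTensor m a b x
  map_update_add' x i y z := by
    funext m
    ext a b
    exact (coeffTensor m a b).map_update_add x i y z
  map_update_smul' x i c y := by
    funext m
    ext a b
    exact (coeffTensor m a b).map_update_smul x i c y

theorem repTensor_apply {n : ℕ} (x : Fin n → Uq) (m : Fin n → ℕ)
    (a b : (j : Fin n) → Fin (m j + 1)) :
    repTensor n x m a b = ∏ j, rep (m j) (x j) (a j) (b j) := rfl

/-- The algebra morphism from `U_q(sl₂)^{⊗n}` to its completion. -/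
def toCompletion (n : ℕ) : (⨂[Kq]^n Uq) →ₐ[Kq] Completion n :=
  PiTensorProduct.liftAlgHom (repTensor n)
    (by
      funext m
      ext a b
      rw [repTensor_apply]
      simp only [Pi.one_apply, map_one, Matrix.one_apply, Finset.prod_ite_zero,
        Finset.mem_univ, true_implies, funext_iff, Finset.prod_const_one])
    (by
      intro x y
      funext m
      ext a b
      rw [repTensor_apply, Pi.mul_apply, Matrix.mul_apply]
      simp only [Pi.mul_apply, map_mul, Matrix.mul_apply, Finset.prod_univ_sum,
        Fintype.piFinset_univ, repTensor_apply, Finset.prod_mul_distrib])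

/-- The first of the two tensor factors `i`, `i + 1` on which the `i`-th generator acts. -/
def left {n : ℕ} (i : Fin (n - 1)) : Fin n := ⟨i, by omega⟩
/-- The second of the two tensor factors `i`, `i + 1` on which the `i`-th generator acts. -/
def right {n : ℕ} (i : Fin (n - 1)) : Fin n := ⟨i + 1, by omega⟩

/-- The quasi-`R`-matrix `Θ = ∑_r q^{r(r-1)/2} (q - q⁻¹)^r / [r]! E^r ⊗ F^r` in the tensor factors
`i` and `i + 1`. On a component of the completion the terms with `r > m_i` are zero, since
`E^r` acts by zero on `V_{m_i}`. -/
def theta (n : ℕ) (i : Fin (n - 1)) : Completion n := fun m =>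
  ∑ r ∈ Finset.range (m (left i) + 1),
    (q ^ (r.choose 2) * (q - q⁻¹) ^ r / qFactorial r) •
      toCompletion n (PiTensorProduct.singleAlgHom (left i) (E ^ r) *
        PiTensorProduct.singleAlgHom (right i) (F ^ r)) m

/-- The matrix unit taking `v_b` to `v_a` is homogeneous of degree `b - a`, so on the matrix
coefficient `(a, b)` the map `Ψ(x ⊗ y) = x K^{-|y|} ⊗ K^{-|x|} y` multiplies by `q ^ (-e)`, where
`e = |y| wt(b_i) + |x| wt(a_{i+1})` is this exponent. -/
def psiExponent {n : ℕ} (i : Fin (n - 1)) (m : Fin n → ℕ) (a b : (j : Fin n) → Fin (m j + 1)) : ℤ :=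
  ((b (right i) : ℤ) - a (right i)) * weight _ (b (left i)) +
    ((b (left i) : ℤ) - a (left i)) * weight _ (a (right i))

/-- The extension of `Ψ(x ⊗ y) = x K^{-|y|} ⊗ K^{-|x|} y`, acting on the factors `i` and `i + 1`, to
the completion. -/
def psi (n : ℕ) (i : Fin (n - 1)) : Completion n ≃ Completion n where
  toFun X := fun m => Matrix.of fun a b => q ^ (-psiExponent i m a b) * X m a b
  invFun X := fun m => Matrix.of fun a b => q ^ psiExponent i m a b * X m a b
  left_inv X := by
    funext m
    ext a b
    change q ^ psiExponent i m a b * (q ^ (-psiExponent i m a b) * X m a b) = X m a b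
    rw [← mul_assoc, ← zpow_add₀ q_ne_zero, add_neg_cancel,
      zpow_zero, one_mul]
  right_inv X := by
    funext m
    ext a b
    change q ^ (-psiExponent i m a b) * (q ^ psiExponent i m a b * X m a b) = X m a b
    rw [← mul_assoc, ← zpow_add₀ q_ne_zero, neg_add_cancel,
      zpow_zero, one_mul]

/-- The extension to the completion of the flip `σ` of the factors `i` and `i + 1`. -/
def flip (n : ℕ) (i : Fin (n - 1)) (X : Completion n) : Completion n := fun m =>
  Matrix.of fun a b => X (fun j => m (Equiv.swap (left i) (right i) j))
    (fun j => a (Equiv.swap (left i) (right i) j)) (fun j => b (Equiv.swap (left i) (right i) j))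

/-- The map `x ↦ σ(Ψ⁻¹(Θ x Θ⁻¹))` on the factors `i` and `i + 1`. -/
def braidOp (n : ℕ) (i : Fin (n - 1)) (X : Completion n) : Completion n :=
  flip n i ((psi n i).symm (theta n i * X * Ring.inverse (theta n i)))

/-- The relations of the braid group on `n` strands. -/
def braidRelations (n : ℕ) : Set (FreeGroup (Fin (n - 1))) :=
  {r | ∃ i j : Fin (n - 1), (i : ℕ) + 1 = j ∧ r =
    FreeGroup.of i * FreeGroup.of j * FreeGroup.of i *
      (FreeGroup.of j * FreeGroup.of i * FreeGroup.of j)⁻¹} ∪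
  {r | ∃ i j : Fin (n - 1), (i : ℕ) + 1 < j ∧ r =
    FreeGroup.of i * FreeGroup.of j * (FreeGroup.of j * FreeGroup.of i)⁻¹}

/-- The braid group on `n` strands. -/
abbrev BraidGroup (n : ℕ) : Type := PresentedGroup (braidRelations n)

/-- The standard generators of the braid group. -/
def braidGen {n : ℕ} (i : Fin (n - 1)) : BraidGroup n := PresentedGroup.of i

end

end AskeyWilson

set_option linter.unusedSimpArgs false

namespace AskeyWilson

noncomputable section

open scoped TensorProduct

/-! The maps Δ and τ_L both send the span of E, FK, K, Λ into U ⊗ span(E, FK, K, Λ). Dualizing, Λ_A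
becomes a product of n local steps, one for each tensor factor: a Δ-step at the factors in A and a
τ_L-step at the others. The product starts on the right from the counit values (0, 0, 1, q + q⁻¹),
and Λ_A is its last coordinate (`transfer`, `toCompletion_casimirSet`). A τ_L-step fixes the counit
values, which accounts both for the factors ⊗ 1 to the right of max A and for Λ_∅ = q + q⁻¹.

On the completion, Ψ⁻¹ is conjugation by a diagonal element D, so β_i is conjugation by the R-matrix
R = DΘ followed by a flip (`braidEquiv_eq_braidOp`). Here Θ is the q-exponential of E ⊗ F. The
addition formula exp(x + y) = exp(x) exp(y) for xy = q²yx (`qExp_add`), the relation between ΘΔ(E)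
and the bar-conjugate coproduct (`quasiR_mul_coprod_E`), and the commutation rules of D give the
Yang–Baxter equation (`yang_baxter`), hence the braid relations.

Since β_i fixes all tensor factors except i and i + 1, only two adjacent steps matter. By
coassociativity and the coaction axiom, two Δ-steps or two τ_L-steps in a row amount to one step
along Δ(U), and β_i fixes Δ(U); this settles the case where both or neither of i, i + 1 lie in A.
Moreover β_i(x ⊗ 1) has the values prescribed for τ_L(x), and from this one computes that β_i turns
a Δ-step followed by a τ_L-step into a τ_L-step followed by a Δ-step
(`IsBraiding.map_comulStep_tauStep`). This settles i ∈ A, i + 1 ∉ A.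

In the remaining case let A' be A with i + 1 replaced by i. A computation in two copies of U
(`UqPair.aw_relation`) gives the Askey–Wilson relation [Λ_{i,i+1}, Λ_{A'}]_q - (q - q⁻¹)(Λ_i Λ_{A ∪
{i}} + Λ_{i+1} Λ_{A \ {i+1}}) = -(q² - q⁻²) Λ_A. Applying β_i sends Λ_{A'} to Λ_A, exchanges Λ_i
with Λ_{i+1} and fixes the other elements on the left, so the relation becomes the formula for
β_i(Λ_A). The mirror relation `UqPair.aw_relation_symm` gives β_i⁻¹ on the Λ_A in the same way. Both
maps therefore preserve the image of AW(n), and each is onto.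

Injectivity into the completion follows from the fact that the V_m separate the monomials F^a K^b
E^c, which span U (`eq_zero_of_rep_eq_zero`), and an induction on the number of tensor factors. -/

/-! ### The coactions on the span of `E`, `F K`, `K`, `Λ` -/

/-- Values of a linear map on the basis `E`, `F K`, `K`, `Λ` of the four-dimensional comodule they
span inside `I_L`. -/
@[ext]
structure ILVec (C : Type*) where
  e : C
  fk : C
  k : C
  l : C

section Steps

variable {𝕜 C : Type*} [Field 𝕜] [Ring C] [Algebra 𝕜 C] (q : 𝕜)

/-- The pairing of a vector with the comultiplication, whose first factor acts through
`e, f, k, k'`. -/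
def comulStep (e f k k' : C) (v : ILVec C) : ILVec C where
  e := e * v.k + v.e
  fk := f * (k * v.k) + v.fk
  k := k * v.k
  l := (q - q⁻¹) ^ 2 • (f * (e * v.k)) + (q - q⁻¹) ^ 2 • (f * v.e)
    + (q - q⁻¹) ^ 2 • (k' * (e * v.fk)) + k' * v.l - q • (k' * v.k) + q • (k * v.k)

/-- The pairing of a vector with the coaction `τ_L`, whose first factor acts through
`f, k, k'`. -/
def tauStep (f k k' : C) (v : ILVec C) : ILVec C where
  e := k * v.e
  fk := k' * v.fk - q • (f * v.l) + (q * (q + q⁻¹)) • (f * v.k)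
    - (q⁻¹ * (q - q⁻¹) ^ 2) • (f * (f * (k * v.e)))
  k := v.k - (q⁻¹ * (q - q⁻¹) ^ 2) • (f * (k * v.e))
  l := v.l

/-- The quantum Casimir element of a copy of the generators of `U_q(sl₂)`. -/
def casimirOf (e f k k' : C) : C := (q - q⁻¹) ^ 2 • (f * e) + q • k + q⁻¹ • k'

/-- The coproduct of the quantum Casimir element for two copies of the generators of
`U_q(sl₂)`. -/
def casimirOfPair (e f k k' e₂ f₂ k₂ k₂' : C) : C :=
  casimirOf q (e * k₂ + e₂) (f + k' * f₂) (k * k₂) (k' * k₂')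

/-- The element `y` commutes with `e, f, k, k'`. -/
structure CommutesWith (e f k k' y : C) : Prop where
  e : y * e = e * y
  f : y * f = f * y
  k : y * k = k * y
  k' : y * k' = k' * y

/-- All entries of `v` commute with `e, f, k, k'`. -/
structure ILVec.CommutesWith (e f k k' : C) (v : ILVec C) : Prop where
  of_e : AskeyWilson.CommutesWith e f k k' v.e
  of_fk : AskeyWilson.CommutesWith e f k k' v.fk
  of_k : AskeyWilson.CommutesWith e f k k' v.k
  of_l : AskeyWilson.CommutesWith e f k k' v.l

variable {q} {e f k k' e₂ f₂ k₂ k₂' : C}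

/-- Coassociativity. All products are rewritten to normal form, the first copy before the second and
`f`, `k`, `e` in this order within a copy. The entries of `v` stay rightmost, so nothing need be
assumed about them. -/
theorem UqPair.comulStep_comulStep (hq : q ≠ 0) (hq3 : q ^ 2 - 1 ≠ 0)
    (h : UqPair q e f k k' e₂ f₂ k₂ k₂') (v : ILVec C) :
    comulStep q e f k k' (comulStep q e₂ f₂ k₂ k₂' v) =
      comulStep q (e * k₂ + e₂) (f + k' * f₂) (k * k₂) (k' * k₂') v := by
  obtain ⟨h1, h2, a1, a2, a3, a4, a5, a6, a7, a8, a9, a10, a11, a12, a13, a14, a15, a16⟩ := h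
  ext <;>
  · simp only [comulStep, mul_add, add_mul, mul_assoc, smul_mul_assoc, mul_smul_comm, mul_one, one_mul,
      sub_mul, mul_sub, smul_add, smul_sub, smul_smul,
      a1, a2, a3, a4, a5, a6, a7, a8, a9, a10, a11, a12, a13, a14, a15, a16,
      assoc_rule a1, assoc_rule a2, assoc_rule a3, assoc_rule a4, assoc_rule a5, assoc_rule a6,
      assoc_rule a7, assoc_rule a8, assoc_rule a9, assoc_rule a10, assoc_rule a11,
      assoc_rule a12, assoc_rule a13, assoc_rule a14, assoc_rule a15, assoc_rule a16,
      h1.k_k', h1.k'_k, h1.e_k hq, h1.e_k' hq, h1.k_f, h1.k'_f hq, h1.e_f',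
      h2.k_k', h2.k'_k, h2.e_k hq, h2.e_k' hq, h2.k_f, h2.k'_f hq, h2.e_f',
      assoc_rule h1.k_k', assoc_rule h1.k'_k, assoc_rule (h1.e_k hq), assoc_rule (h1.e_k' hq),
      assoc_rule h1.k_f, assoc_rule (h1.k'_f hq), assoc_rule h1.e_f',
      assoc_rule h2.k_k', assoc_rule h2.k'_k, assoc_rule (h2.e_k hq), assoc_rule (h2.e_k' hq),
      assoc_rule h2.k_f, assoc_rule (h2.k'_f hq), assoc_rule h2.e_f']
    try (match_scalars <;> (try field_simp) <;> (try ring))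

/-- The coaction axiom (id ⊗ τ_L) τ_L = (Δ ⊗ id) τ_L, checked on normal forms. -/
theorem UqPair.tauStep_tauStep (hq : q ≠ 0) (hq3 : q ^ 2 - 1 ≠ 0)
    (h : UqPair q e f k k' e₂ f₂ k₂ k₂') (v : ILVec C) :
    tauStep q f k k' (tauStep q f₂ k₂ k₂' v) =
      tauStep q (f + k' * f₂) (k * k₂) (k' * k₂') v := by
  obtain ⟨h1, h2, a1, a2, a3, a4, a5, a6, a7, a8, a9, a10, a11, a12, a13, a14, a15, a16⟩ := h
  ext <;>
  · simp only [tauStep, mul_add, add_mul, mul_assoc, smul_mul_assoc, mul_smul_comm, mul_one, one_mul,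
      sub_mul, mul_sub, smul_add, smul_sub, smul_smul,
      a1, a2, a3, a4, a5, a6, a7, a8, a9, a10, a11, a12, a13, a14, a15, a16,
      assoc_rule a1, assoc_rule a2, assoc_rule a3, assoc_rule a4, assoc_rule a5, assoc_rule a6,
      assoc_rule a7, assoc_rule a8, assoc_rule a9, assoc_rule a10, assoc_rule a11,
      assoc_rule a12, assoc_rule a13, assoc_rule a14, assoc_rule a15, assoc_rule a16,
      h1.k_k', h1.k'_k, h1.e_k hq, h1.e_k' hq, h1.k_f, h1.k'_f hq, h1.e_f',
      h2.k_k', h2.k'_k, h2.e_k hq, h2.e_k' hq, h2.k_f, h2.k'_f hq, h2.e_f',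
      assoc_rule h1.k_k', assoc_rule h1.k'_k, assoc_rule (h1.e_k hq), assoc_rule (h1.e_k' hq),
      assoc_rule h1.k_f, assoc_rule (h1.k'_f hq), assoc_rule h1.e_f',
      assoc_rule h2.k_k', assoc_rule h2.k'_k, assoc_rule (h2.e_k hq), assoc_rule (h2.e_k' hq),
      assoc_rule h2.k_f, assoc_rule (h2.k'_f hq), assoc_rule h2.e_f']
    try (match_scalars <;> field_simp)

variable (q) in
/-- The right-hand side of the Askey–Wilson relations: `[x, y]_q - (q - q⁻¹) (l s + l' t)`. -/
def awExpr (x y l s l' t : C) : C :=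
  q • (x * y) - q⁻¹ • (y * x) - (q - q⁻¹) • (l * s + l' * t)

theorem ILVec.CommutesWith.commute_casimirOfPair {v : ILVec C}
    (hv : v.CommutesWith e f k k') (hv₂ : v.CommutesWith e₂ f₂ k₂ k₂') :
    let x := casimirOfPair q e f k k' e₂ f₂ k₂ k₂'
    v.e * x = x * v.e ∧ v.fk * x = x * v.fk ∧ v.k * x = x * v.k ∧ v.l * x = x * v.l := by
  have key : ∀ y : C, AskeyWilson.CommutesWith e f k k' y →
      AskeyWilson.CommutesWith e₂ f₂ k₂ k₂' y →
      Commute y (casimirOfPair q e f k k' e₂ f₂ k₂ k₂') := by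
    rintro y ⟨a1, a2, a3, a4⟩ ⟨b1, b2, b3, b4⟩
    change Commute y _ at a1 a2 a3 a4 b1 b2 b3 b4
    exact (((((a2.add_right (a4.mul_right b2)).mul_right
      ((a1.mul_right b3).add_right b1))).smul_right _).add_right
        ((a3.mul_right b3).smul_right _)).add_right ((a4.mul_right b4).smul_right _)
  exact ⟨key _ hv.of_e hv₂.of_e, key _ hv.of_fk hv₂.of_fk, key _ hv.of_k hv₂.of_k,
    key _ hv.of_l hv₂.of_l⟩

set_option maxHeartbeats 2000000 in
-- The local Askey–Wilson relation. Once the coproduct Casimir has been moved to the left of the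
-- entries of `v`, both sides are combinations of these entries with coefficients in two copies of
-- U, and the normal forms of the coefficients agree.
theorem UqPair.aw_relation (hq : q ≠ 0) (hq3 : q ^ 2 - 1 ≠ 0)
    (h : UqPair q e f k k' e₂ f₂ k₂ k₂') (v : ILVec C) (g : ILVec C → C)
    (hg : g = ILVec.e ∨ g = ILVec.fk ∨ g = ILVec.k ∨ g = ILVec.l)
    (hv : v.CommutesWith e f k k') (hv₂ : v.CommutesWith e₂ f₂ k₂ k₂') :
    awExpr q (casimirOfPair q e f k k' e₂ f₂ k₂ k₂')
        (g (comulStep q e f k k' (tauStep q f₂ k₂ k₂' v)))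
        (casimirOf q e f k k') (g (comulStep q e f k k' (comulStep q e₂ f₂ k₂ k₂' v)))
        (casimirOf q e₂ f₂ k₂ k₂') (g (tauStep q f k k' (tauStep q f₂ k₂ k₂' v))) =
      -((q ^ 2 - (q ^ 2)⁻¹) • (g (tauStep q f k k' (comulStep q e₂ f₂ k₂ k₂' v)))) := by
  have hx := hv.commute_casimirOfPair hv₂ (q := q)
  obtain ⟨h1, h2, a1, a2, a3, a4, a5, a6, a7, a8, a9, a10, a11, a12, a13, a14, a15, a16⟩ := h
  -- The coproduct Casimir stays opaque while it is moved past the entries of `v`; it is expanded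
  -- only afterwards.
  generalize hX : casimirOfPair q e f k k' e₂ f₂ k₂ k₂' = x at hx ⊢
  obtain ⟨b1, b2, b3, b4⟩ := hx
  rcases hg with rfl | rfl | rfl | rfl <;>
  · simp only [awExpr, casimirOf, comulStep, tauStep,
      mul_add, add_mul, mul_assoc, smul_mul_assoc, mul_smul_comm,
      sub_mul, mul_sub, smul_add, smul_sub, smul_smul, b1, b2, b3, b4]
    simp only [← hX, casimirOfPair, casimirOf, one_mul, mul_one,
      mul_add, add_mul, mul_assoc, smul_mul_assoc, mul_smul_comm,
      sub_mul, mul_sub, smul_add, smul_sub, smul_smul,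
      a1, a2, a3, a4, a5, a6, a7, a8, a9, a10, a11, a12, a13, a14, a15, a16,
      assoc_rule a1, assoc_rule a2, assoc_rule a3, assoc_rule a4, assoc_rule a5, assoc_rule a6,
      assoc_rule a7, assoc_rule a8, assoc_rule a9, assoc_rule a10, assoc_rule a11,
      assoc_rule a12, assoc_rule a13, assoc_rule a14, assoc_rule a15, assoc_rule a16,
      h1.k_k', h1.k'_k, h1.e_k hq, h1.e_k' hq, h1.k_f, h1.k'_f hq, h1.e_f',
      h2.k_k', h2.k'_k, h2.e_k hq, h2.e_k' hq, h2.k_f, h2.k'_f hq, h2.e_f',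
      assoc_rule h1.k_k', assoc_rule h1.k'_k, assoc_rule (h1.e_k hq), assoc_rule (h1.e_k' hq),
      assoc_rule h1.k_f, assoc_rule (h1.k'_f hq), assoc_rule h1.e_f',
      assoc_rule h2.k_k', assoc_rule h2.k'_k, assoc_rule (h2.e_k hq), assoc_rule (h2.e_k' hq),
      assoc_rule h2.k_f, assoc_rule (h2.k'_f hq), assoc_rule h2.e_f']
    match_scalars <;> field_simp <;> ring

set_option maxHeartbeats 2000000 in
-- The mirror image of `UqPair.aw_relation`, with the two mixed products exchanged and the
-- q-commutator reversed. It serves to describe the inverse braiding.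
theorem UqPair.aw_relation_symm (hq : q ≠ 0) (hq3 : q ^ 2 - 1 ≠ 0)
    (h : UqPair q e f k k' e₂ f₂ k₂ k₂') (v : ILVec C) (g : ILVec C → C)
    (hg : g = ILVec.e ∨ g = ILVec.fk ∨ g = ILVec.k ∨ g = ILVec.l)
    (hv : v.CommutesWith e f k k') (hv₂ : v.CommutesWith e₂ f₂ k₂ k₂') :
    awExpr q (g (tauStep q f k k' (comulStep q e₂ f₂ k₂ k₂' v))) (casimirOfPair q e f k k' e₂ f₂ k₂ k₂')
        (casimirOf q e₂ f₂ k₂ k₂') (g (comulStep q e f k k' (comulStep q e₂ f₂ k₂ k₂' v)))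
        (casimirOf q e f k k') (g (tauStep q f k k' (tauStep q f₂ k₂ k₂' v))) =
      -((q ^ 2 - (q ^ 2)⁻¹) • (g (comulStep q e f k k' (tauStep q f₂ k₂ k₂' v)))) := by
  have hx := hv.commute_casimirOfPair hv₂ (q := q)
  obtain ⟨h1, h2, a1, a2, a3, a4, a5, a6, a7, a8, a9, a10, a11, a12, a13, a14, a15, a16⟩ := h
  generalize hX : casimirOfPair q e f k k' e₂ f₂ k₂ k₂' = x at hx ⊢
  obtain ⟨b1, b2, b3, b4⟩ := hx
  rcases hg with rfl | rfl | rfl | rfl <;>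
  · simp only [awExpr, casimirOf, comulStep, tauStep,
      mul_add, add_mul, mul_assoc, smul_mul_assoc, mul_smul_comm,
      sub_mul, mul_sub, smul_add, smul_sub, smul_smul, b1, b2, b3, b4]
    simp only [← hX, casimirOfPair, casimirOf, one_mul, mul_one,
      mul_add, add_mul, mul_assoc, smul_mul_assoc, mul_smul_comm,
      sub_mul, mul_sub, smul_add, smul_sub, smul_smul,
      a1, a2, a3, a4, a5, a6, a7, a8, a9, a10, a11, a12, a13, a14, a15, a16,
      assoc_rule a1, assoc_rule a2, assoc_rule a3, assoc_rule a4, assoc_rule a5, assoc_rule a6,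
      assoc_rule a7, assoc_rule a8, assoc_rule a9, assoc_rule a10, assoc_rule a11,
      assoc_rule a12, assoc_rule a13, assoc_rule a14, assoc_rule a15, assoc_rule a16,
      h1.k_k', h1.k'_k, h1.e_k hq, h1.e_k' hq, h1.k_f, h1.k'_f hq, h1.e_f',
      h2.k_k', h2.k'_k, h2.e_k hq, h2.e_k' hq, h2.k_f, h2.k'_f hq, h2.e_f',
      assoc_rule h1.k_k', assoc_rule h1.k'_k, assoc_rule (h1.e_k hq), assoc_rule (h1.e_k' hq),
      assoc_rule h1.k_f, assoc_rule (h1.k'_f hq), assoc_rule h1.e_f',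
      assoc_rule h2.k_k', assoc_rule h2.k'_k, assoc_rule (h2.e_k hq), assoc_rule (h2.e_k' hq),
      assoc_rule h2.k_f, assoc_rule (h2.k'_f hq), assoc_rule h2.e_f']
    match_scalars <;> field_simp <;> ring

end Steps

/-! ### Braidings -/

section Steps

variable {𝕜 C : Type*} [Field 𝕜] [Ring C] [Algebra 𝕜 C] {q : 𝕜}
variable {e f k k' e₂ f₂ k₂ k₂' : C}

variable (q) in
/-- The values on generators of the conjugation of two copies of `U_q(sl₂)` by the `R`-matrix,
followed by the flip. -/
structure IsBraiding (e f k k' e₂ f₂ k₂ k₂' : C) (β : C →ₐ[𝕜] C) : Prop where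
  map_e : β e = k * e₂
  map_f : β f₂ = f * k₂'
  map_k : β k = k₂ - (q⁻¹ * (q - q⁻¹) ^ 2) • (f * (k * e₂))
  map_coprod_k : β (k * k₂) = k * k₂
  map_coprod_e : β (e * k₂ + e₂) = e * k₂ + e₂
  map_coprod_f : β (f + k' * f₂) = f + k' * f₂
  map_casimir : β (casimirOf q e f k k') = casimirOf q e₂ f₂ k₂ k₂'
  map_casimir₂ : β (casimirOf q e₂ f₂ k₂ k₂') = casimirOf q e f k k'

/-- The identities of normal forms used to compute a braiding. -/
theorem UqPair.normal_forms (hq : q ≠ 0) (hq3 : q ^ 2 - 1 ≠ 0)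
    (h : UqPair q e f k k' e₂ f₂ k₂ k₂') :
    (1 - (q⁻¹ * (q - q⁻¹) ^ 2) • ((k * e₂) * (f * k₂'))) * (k * k₂) =
      k * (k₂ - (q⁻¹ * (q - q⁻¹) ^ 2) • (f * (k * e₂))) ∧
    1 - (q * (q - q⁻¹) ^ 2) • ((k * e₂) * (f * k₂')) =
      (k₂ - (q⁻¹ * (q - q⁻¹) ^ 2) • (f * (k * e₂))) * k₂' ∧
    (k₂ - (q⁻¹ * (q - q⁻¹) ^ 2) • (f * (k * e₂))) * (k' * k₂') =
      k' - (q * (q - q⁻¹) ^ 2) • (f * (k₂' * e₂)) ∧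
    (f + k' * f₂) * (k₂ - (q⁻¹ * (q - q⁻¹) ^ 2) • (f * (k * e₂))) =
      k' * (f₂ * k₂) - (q * (q - q⁻¹) ^ 2) • (f * (f₂ * e₂)) + f * k₂
        - (q⁻¹ * (q - q⁻¹) ^ 2) • (f * (f * (k * e₂))) ∧
    (f + k' * f₂) * k - f * k₂' * (k * k₂) = f₂ ∧
    f * k₂' * (k * k₂) = f * k ∧
    (f + k' * f₂) * (f * k₂' * (k * k₂)) = f * (f * k) + q ^ 2 • (f * f₂) ∧
    (f + k' * f₂) * k - f₂ = f * k ∧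
    (f + k' * f₂) * f₂ * (k * k₂) = f * (k * (f₂ * k₂)) + f₂ * (f₂ * k₂) ∧
    (q ^ 2)⁻¹ • (e * (k' * k₂')) = k' * (e * k₂') ∧
    (q ^ 2)⁻¹ • ((k * e₂) * (k' * k₂')) = k₂' * e₂ ∧
    (f + k' * f₂) * (k₂ - (q⁻¹ * (q - q⁻¹) ^ 2) • (e * (f₂ * k₂))) - f₂ * (k * k₂) =
      f * k₂ + k' * (f₂ * k₂) - k * (f₂ * k₂) - (q⁻¹ * (q - q⁻¹) ^ 2) • (f * (e * (f₂ * k₂)))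
        - (q⁻¹ * (q - q⁻¹) ^ 2) • (k' * (e * (f₂ * (f₂ * k₂)))) := by
  obtain ⟨h1, h2, a1, a2, a3, a4, a5, a6, a7, a8, a9, a10, a11, a12, a13, a14, a15, a16⟩ := h
  refine ⟨?_, ?_, ?_, ?_, ?_, ?_, ?_, ?_, ?_, ?_, ?_, ?_⟩ <;>
  · simp only [mul_add, add_mul, mul_assoc, smul_mul_assoc, mul_smul_comm, mul_one, one_mul,
      sub_mul, mul_sub, smul_add, smul_sub, smul_smul,
      a1, a2, a3, a4, a5, a6, a7, a8, a9, a10, a11, a12, a13, a14, a15, a16,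
      assoc_rule a1, assoc_rule a2, assoc_rule a3, assoc_rule a4, assoc_rule a5, assoc_rule a6,
      assoc_rule a7, assoc_rule a8, assoc_rule a9, assoc_rule a10, assoc_rule a11,
      assoc_rule a12, assoc_rule a13, assoc_rule a14, assoc_rule a15, assoc_rule a16,
      h1.k_k', h1.k'_k, h1.e_k hq, h1.e_k' hq, h1.k_f, h1.k'_f hq, h1.e_f',
      h2.k_k', h2.k'_k, h2.e_k hq, h2.e_k' hq, h2.k_f, h2.k'_f hq, h2.e_f',
      assoc_rule h1.k_k', assoc_rule h1.k'_k, assoc_rule (h1.e_k hq), assoc_rule (h1.e_k' hq),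
      assoc_rule h1.k_f, assoc_rule (h1.k'_f hq), assoc_rule h1.e_f',
      assoc_rule h2.k_k', assoc_rule h2.k'_k, assoc_rule (h2.e_k hq), assoc_rule (h2.e_k' hq),
      assoc_rule h2.k_f, assoc_rule (h2.k'_f hq), assoc_rule h2.e_f']
    try (match_scalars <;> (try field_simp) <;> (try ring))

namespace IsBraiding

variable {β : C →ₐ[𝕜] C}

/-- Inverses are unique, and `k * k₂` is fixed. -/
theorem map_coprod_k' (hβ : IsBraiding q e f k k' e₂ f₂ k₂ k₂' β)
    (h : UqPair q e f k k' e₂ f₂ k₂ k₂') : β (k' * k₂') = k' * k₂' := by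
  have h1 : (k * k₂) * (k' * k₂') = 1 := by
    rw [mul_assoc, ← mul_assoc k₂, h.k_k', mul_assoc, h.snd.k_k', mul_one, h.fst.k_k']
  have h2 : (k' * k₂') * (k * k₂) = 1 := by
    rw [mul_assoc, ← mul_assoc k₂', h.k'_k, mul_assoc, h.snd.k'_k, mul_one, h.fst.k'_k]
  have h3 := congrArg β h1
  rw [map_mul, hβ.map_coprod_k, map_one] at h3
  exact (left_inv_eq_right_inv h2 h3).symm

/-- A vector fixed by `β` in all entries. -/
structure _root_.AskeyWilson.ILVec.IsFixed (v : ILVec C) (β : C →ₐ[𝕜] C) : Prop where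
  e : β v.e = v.e
  fk : β v.fk = v.fk
  k : β v.k = v.k
  l : β v.l = v.l

/-- The entrywise image of a vector. -/
def _root_.AskeyWilson.ILVec.map (β : C →ₐ[𝕜] C) (v : ILVec C) : ILVec C :=
  ⟨β v.e, β v.fk, β v.k, β v.l⟩

/-- Two Δ-steps are one Δ-step along the coproduct of the two copies, and `β` fixes this coproduct.
-/
theorem map_comulStep_comulStep (hβ : IsBraiding q e f k k' e₂ f₂ k₂ k₂' β) (hq : q ≠ 0)
    (hq3 : q ^ 2 - 1 ≠ 0) (h : UqPair q e f k k' e₂ f₂ k₂ k₂') {v : ILVec C}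
    (hv : v.IsFixed β) :
    (comulStep q e f k k' (comulStep q e₂ f₂ k₂ k₂' v)).map β =
      comulStep q e f k k' (comulStep q e₂ f₂ k₂ k₂' v) := by
  rw [h.comulStep_comulStep hq hq3]
  have h1 := hβ.map_coprod_e
  have h2 := hβ.map_coprod_f
  have h3 := hβ.map_coprod_k
  have h4 := hβ.map_coprod_k' h
  generalize e * k₂ + e₂ = x at *
  generalize f + k' * f₂ = y at *
  generalize k * k₂ = z at *
  generalize k' * k₂' = w at *
  simp only [ILVec.map, comulStep, map_add, map_sub, map_smul, map_mul, h1, h2, h3, h4, hv.e, hv.fk,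
    hv.k, hv.l]

theorem map_tauStep_tauStep (hβ : IsBraiding q e f k k' e₂ f₂ k₂ k₂' β) (hq : q ≠ 0)
    (hq3 : q ^ 2 - 1 ≠ 0) (h : UqPair q e f k k' e₂ f₂ k₂ k₂') {v : ILVec C}
    (hv : v.IsFixed β) :
    (tauStep q f k k' (tauStep q f₂ k₂ k₂' v)).map β =
      tauStep q f k k' (tauStep q f₂ k₂ k₂' v) := by
  rw [h.tauStep_tauStep hq hq3]
  have h2 := hβ.map_coprod_f
  have h3 := hβ.map_coprod_k
  have h4 := hβ.map_coprod_k' h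
  generalize f + k' * f₂ = y at *
  generalize k * k₂ = z at *
  generalize k' * k₂' = w at *
  simp only [ILVec.map, tauStep, map_add, map_sub, map_smul, map_mul, h2, h3, h4, hv.e, hv.fk,
    hv.k, hv.l]

/-- The braiding is known only on E ⊗ 1, K ⊗ 1, 1 ⊗ F, the coproducts and the two Casimirs. So the
coefficient of each entry of `v` is first written in terms of these. The element `β k'` has no
simple expression of its own; the coefficients are grouped so that it cancels against `β k`. -/
theorem map_comulStep_tauStep (hβ : IsBraiding q e f k k' e₂ f₂ k₂ k₂' β) (hq : q ≠ 0)
    (hq3 : q ^ 2 - 1 ≠ 0) (h : UqPair q e f k k' e₂ f₂ k₂ k₂') {v : ILVec C}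
    (hv : v.IsFixed β) :
    (comulStep q e f k k' (tauStep q f₂ k₂ k₂' v)).map β =
      tauStep q f k k' (comulStep q e₂ f₂ k₂ k₂' v) := by
  obtain ⟨n1, n2, n3, n4, n5, n6, n7, n8, n9, n10, n11, n12⟩ := h.normal_forms hq hq3
  have hA : β k * β k' = 1 := by rw [← map_mul, h.fst.k_k', map_one]
  have hA' : β k' * β k = 1 := by rw [← map_mul, h.fst.k'_k, map_one]
  -- K ⊗ K is fixed, so the image of 1 ⊗ K is determined by that of K⁻¹ ⊗ 1.
  have hk₂ : β k₂ = k * k₂ * β k' := by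
    rw [← hβ.map_coprod_k, ← map_mul, ← h.k_k, mul_assoc, h.fst.k_k', mul_one]
  have hk₂' : β k₂' = β k * (k' * k₂') := by
    rw [← hβ.map_coprod_k' h, ← map_mul, ← mul_assoc, h.fst.k_k', one_mul]
  rw [← hβ.map_k] at n1 n2 n3 n4
  have c1 : β (k₂ - (q⁻¹ * (q - q⁻¹) ^ 2) • (e * (f₂ * k₂))) = k := by
    rw [map_sub, map_smul, map_mul, map_mul, hβ.map_e, hβ.map_f, hk₂]
    have := congrArg (· * β k') n1
    simp only [mul_assoc, hA, mul_one] at this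
    refine Eq.trans ?_ this
    simp only [sub_mul, one_mul, smul_mul_assoc, mul_assoc]
  have c2 : β (k * (f₂ * k₂)) = f * k := by
    rw [← mul_assoc, ← h.f_k, mul_assoc, map_mul, hβ.map_f, hβ.map_coprod_k, n6]
  have c3 : β k₂' = k' - (q * (q - q⁻¹) ^ 2) • (f * (k₂' * e₂)) := by rw [hk₂', n3]
  -- FK ⊗ 1 = Δ(F)(K ⊗ 1) - 1 ⊗ F, and the images of all three elements on the right are known.
  have c4 : β (f * k) = k' * (f₂ * k₂) - (q * (q - q⁻¹) ^ 2) • (f * (f₂ * e₂)) + f * k₂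
        - (q⁻¹ * (q - q⁻¹) ^ 2) • (f * (f * (k * e₂))) - f * k₂' := by
    rw [← n8, map_sub, map_mul, hβ.map_coprod_f, hβ.map_f, n4]
  have c5 : β (f * (k * (f₂ * k₂)) + f₂ * (f₂ * k₂)) = f * (f * k) + q ^ 2 • (f * f₂) := by
    rw [← n9, map_mul, map_mul, hβ.map_coprod_f, hβ.map_coprod_k, hβ.map_f, mul_assoc, n7]
  have c6 : β (k' * (e * k₂')) = k₂' * e₂ := by
    rw [← n10, map_smul, map_mul, hβ.map_e, hβ.map_coprod_k' h, n11]
  have c7 : β (k' - (q * (q - q⁻¹) ^ 2) • (k' * (e * f₂))) = k₂' := by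
    rw [map_sub, map_smul, map_mul, map_mul, hβ.map_e, hβ.map_f]
    have := congrArg (β k' * ·) n2
    simp only [← mul_assoc, hA', one_mul] at this
    refine Eq.trans ?_ this
    simp only [mul_sub, mul_one, mul_smul_comm, mul_assoc]
  have c8 : β (f * k₂ + k' * (f₂ * k₂) - k * (f₂ * k₂)
        - (q⁻¹ * (q - q⁻¹) ^ 2) • (f * (e * (f₂ * k₂)))
        - (q⁻¹ * (q - q⁻¹) ^ 2) • (k' * (e * (f₂ * (f₂ * k₂))))) = f₂ := by
    rw [← n12, map_sub, map_mul, map_mul, hβ.map_coprod_f, hβ.map_coprod_k, hβ.map_f, c1, n5]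
  ext
  · have : (comulStep q e f k k' (tauStep q f₂ k₂ k₂' v)).e =
        e * v.k + (k₂ - (q⁻¹ * (q - q⁻¹) ^ 2) • (e * (f₂ * k₂))) * v.e := by
      simp only [comulStep, tauStep, mul_sub, sub_mul, mul_smul_comm, smul_mul_assoc, mul_assoc]
      abel
    simp only [ILVec.map, this]
    rw [map_add, map_mul, map_mul, c1, hv.k, hv.e, hβ.map_e]
    simp only [comulStep, tauStep, mul_add, mul_assoc]
  · have : (comulStep q e f k k' (tauStep q f₂ k₂ k₂' v)).fk =
        (f * k + (q * (q + q⁻¹)) • f₂) * v.k + k₂' * v.fk - q • (f₂ * v.l)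
        - (q⁻¹ * (q - q⁻¹) ^ 2) • ((f * (k * (f₂ * k₂)) + f₂ * (f₂ * k₂)) * v.e) := by
      simp only [comulStep, tauStep, mul_sub, sub_mul, mul_smul_comm, smul_mul_assoc, mul_assoc,
        add_mul, smul_add]
      abel
    simp only [ILVec.map, this]
    rw [map_sub, map_sub, map_add, map_smul, map_smul, map_mul, map_mul, map_mul, map_mul, c5,
      map_add, map_smul, c4, c3, hv.k, hv.e, hv.l, hv.fk, hβ.map_f]
    simp only [comulStep, tauStep, mul_add, add_mul, mul_sub, sub_mul, mul_smul_comm,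
      smul_mul_assoc, mul_assoc, smul_add, smul_sub, smul_smul]
    match_scalars <;> field_simp <;> ring
  · have : (comulStep q e f k k' (tauStep q f₂ k₂ k₂' v)).k =
        k * v.k - (q⁻¹ * (q - q⁻¹) ^ 2) • ((k * (f₂ * k₂)) * v.e) := by
      simp only [comulStep, tauStep, mul_sub, mul_smul_comm, mul_assoc]
    simp only [ILVec.map, this]
    rw [map_sub, map_smul, map_mul, map_mul, c2, hv.k, hv.e, hβ.map_k]
    simp only [comulStep, tauStep, mul_add, sub_mul, mul_smul_comm, smul_mul_assoc, mul_assoc,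
      smul_add]
    abel
  · have : (comulStep q e f k k' (tauStep q f₂ k₂ k₂' v)).l =
        -- The terms in `f * e` are absorbed into the Casimir of the first copy, whose image is
        -- known.
        (casimirOf q e f k k' - (q + q⁻¹) • (k' - (q * (q - q⁻¹) ^ 2) • (k' * (e * f₂)))) * v.k
        + (q - q⁻¹) ^ 2 • ((k' * (e * k₂')) * v.fk)
        + (k' - (q * (q - q⁻¹) ^ 2) • (k' * (e * f₂))) * v.l
        + (q - q⁻¹) ^ 2 • ((f * k₂ + k' * (f₂ * k₂) - k * (f₂ * k₂)
        - (q⁻¹ * (q - q⁻¹) ^ 2) • (f * (e * (f₂ * k₂)))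
        - (q⁻¹ * (q - q⁻¹) ^ 2) • (k' * (e * (f₂ * (f₂ * k₂))))) * v.e) := by
      simp only [comulStep, tauStep, casimirOf, mul_sub, sub_mul, mul_smul_comm, smul_mul_assoc,
        mul_assoc, add_mul, mul_add, smul_add, smul_sub, smul_smul]
      match_scalars <;> field_simp <;> ring
    simp only [ILVec.map, this]
    rw [map_add, map_add, map_add, map_smul, map_smul, map_mul β _ v.k, map_mul β _ v.fk,
      map_mul β _ v.l, map_mul β _ v.e, map_sub β (casimirOf ..), map_smul, c6, c7, c8, hβ.map_casimir, hv.k, hv.e, hv.l, hv.fk]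
    simp only [comulStep, tauStep, casimirOf, mul_add, add_mul, mul_sub, sub_mul, mul_smul_comm,
      smul_mul_assoc, mul_assoc, smul_add, smul_sub, smul_smul]
    match_scalars <;> field_simp <;> ring

end IsBraiding

end Steps

/-! ### The `q`-exponential -/

theorem q_pow_ne_one {n : ℕ} (hn : n ≠ 0) : q ^ n ≠ 1 := by
  intro h
  have h2 : (Polynomial.X ^ n : Polynomial ℂ) = 1 := by
    apply RatFunc.algebraMap_injective ℂ
    simpa [q, RatFunc.algebraMap_X] using h
  have := congrArg Polynomial.natDegree h2
  simp at this
  exact hn this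

theorem q_pow_sub_inv_ne_zero {n : ℕ} (hn : n ≠ 0) : q ^ n - (q ^ n)⁻¹ ≠ 0 := by
  intro h
  have h0 := pow_ne_zero n q_ne_zero
  field_simp at h
  apply q_pow_ne_one (n := n * 2) (by omega)
  rw [pow_mul]
  linear_combination h

theorem qInt_natCast (n : ℕ) : qInt n = (q ^ n - (q ^ n)⁻¹) / (q - q⁻¹) := by
  simp [qInt]

theorem qInt_natCast_ne_zero {n : ℕ} (hn : n ≠ 0) : qInt n ≠ 0 := by
  rw [qInt_natCast]
  exact div_ne_zero (q_pow_sub_inv_ne_zero hn) q_sub_inv_ne_zero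

/-- The coefficients of the `q`-exponential series defining the quasi-`R`-matrix. -/
def expCoeff (r : ℕ) : Kq := q ^ (r.choose 2) * (q - q⁻¹) ^ r / qFactorial r

theorem expCoeff_zero : expCoeff 0 = 1 := by simp [expCoeff, qFactorial]

theorem qFactorial_ne_zero (r : ℕ) : qFactorial r ≠ 0 := by
  rw [qFactorial, Finset.prod_ne_zero_iff]
  intro s _
  have := qInt_natCast_ne_zero (n := s + 1) (by omega)
  exact_mod_cast this

/-- This recursion, with `expCoeff 0 = 1`, is the only property of the coefficients used below. -/
theorem expCoeff_succ (r : ℕ) :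
    (q ^ (r + 1) - (q ^ (r + 1))⁻¹) * expCoeff (r + 1) =
      q ^ r * (q - q⁻¹) ^ 2 * expCoeff r := by
  have h1 : qFactorial (r + 1) = qFactorial r * qInt ((r + 1 : ℕ) : ℤ) := by
    rw [qFactorial, Finset.prod_range_succ, ← qFactorial]
    push_cast
    rfl
  rw [expCoeff, expCoeff, h1, qInt_natCast, Nat.choose_succ_succ' r 1, Nat.choose_one_right]
  have h2 := qFactorial_ne_zero r
  have h3 := q_pow_sub_inv_ne_zero (n := r + 1) (by omega)
  have h4 := q_sub_inv_ne_zero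
  generalize q ^ (r + 1) - (q ^ (r + 1))⁻¹ = x at *
  generalize q - q⁻¹ = y at *
  field_simp
  ring

section Ring

variable {A : Type*} [Ring A] [Algebra Kq A]

/-- The partial sums of the `q`-exponential series. -/
def expSum (N : ℕ) (x : A) : A := ∑ r ∈ Finset.range N, expCoeff r • x ^ r

theorem expSum_eq_of_le {N M : ℕ} {x : A} (hx : x ^ N = 0) (h : N ≤ M) :
    expSum M x = expSum N x := by
  refine (Finset.sum_subset (Finset.range_mono h) fun r _ hr => ?_).symm
  rw [pow_eq_zero_of_le (by simpa using hr) hx, smul_zero]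

/-- The relation t x = y t passes to all powers of x and y. -/
theorem expSum_intertwine {N : ℕ} {x y t : A} (h : t * x = y * t) :
    t * expSum N x = expSum N y * t := by
  rw [expSum, expSum, Finset.mul_sum, Finset.sum_mul]
  refine Finset.sum_congr rfl fun r _ => ?_
  have : SemiconjBy t x y := h
  rw [mul_smul_comm, smul_mul_assoc, (this.pow_right r).eq]

/-- The constant term is 1, and the other terms have the nilpotent factor `x`, which commutes with
its cofactor. -/
theorem expSum_isUnit {N : ℕ} {x : A} (hx : x ^ N = 0) : IsUnit (expSum N x) := by
  rw [← expSum_eq_of_le hx (Nat.le_succ N), expSum, Finset.sum_range_succ', expCoeff_zero, pow_zero,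
    one_smul, add_comm]
  apply IsNilpotent.isUnit_one_add
  have : ∑ r ∈ Finset.range N, expCoeff (r + 1) • x ^ (r + 1) =
      x * ∑ r ∈ Finset.range N, expCoeff (r + 1) • x ^ r := by
    rw [Finset.mul_sum]
    refine Finset.sum_congr rfl fun r _ => ?_
    rw [mul_smul_comm, pow_succ']
  rw [this]
  have hc : Commute x (∑ r ∈ Finset.range N, expCoeff (r + 1) • x ^ r) :=
    Commute.sum_right _ _ _ fun r _ => ((Commute.refl x).pow_right r).smul_right _
  exact hc.isNilpotent_mul_right ⟨N, hx⟩

/-- The q-binomial theorem, with the q-binomial coefficients hidden in the ratios of `expCoeff`. In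
the induction both sides are multiplied by the nonzero scalar q^(r+1) - q^(-r-1), so that the
recursion for the coefficients applies. -/
theorem expCoeff_smul_add_pow {x y : A} (h : x * y = q ^ 2 • (y * x)) (r : ℕ) :
    expCoeff r • (x + y) ^ r = ∑ p ∈ Finset.HasAntidiagonal.antidiagonal r,
      (expCoeff p.1 * expCoeff p.2) • (x ^ p.1 * y ^ p.2) := by
  have hq := q_ne_zero
  have hyx : ∀ s, y * x ^ s = (q ^ (2 * s))⁻¹ • (x ^ s * y) := by
    intro s
    induction s with
    | zero => simp
    | succ s ih =>
      have h' : y * x = (q ^ 2)⁻¹ • (x * y) := by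
        rw [h, smul_smul, inv_mul_cancel₀ (pow_ne_zero 2 hq), one_smul]
      rw [pow_succ, ← mul_assoc, ih, smul_mul_assoc, mul_assoc, h', mul_smul_comm, smul_smul,
        ← mul_assoc]
      congr 1
      field_simp
      ring
  induction r with
  | zero => simp [expCoeff_zero]
  | succ r ih =>
    have hr := q_pow_sub_inv_ne_zero (n := r + 1) (by omega)
    have key : (q ^ (r + 1) - (q ^ (r + 1))⁻¹) • (expCoeff (r + 1) • (x + y) ^ (r + 1)) =
        (q ^ (r + 1) - (q ^ (r + 1))⁻¹) • ∑ p ∈ Finset.HasAntidiagonal.antidiagonal (r + 1),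
          (expCoeff p.1 * expCoeff p.2) • (x ^ p.1 * y ^ p.2) := by
      rw [smul_smul, expCoeff_succ, mul_smul, pow_succ' (x + y), ← mul_smul_comm, ih, add_mul, smul_add,
        Finset.mul_sum, Finset.mul_sum, Finset.smul_sum, Finset.smul_sum]
      -- The splitting q^(a+b) - q^(-a-b) = q^b (q^a - q^(-a)) + q^(-a) (q^b - q^(-b)). The first
      -- part corresponds to multiplication by `x` on the left, the second to multiplication by `y`,
      -- where q^(-a) compensates half of the factor from moving `y` past x^a.
      have e1 : ∀ p ∈ Finset.HasAntidiagonal.antidiagonal (r + 1),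
          (q ^ (r + 1) - (q ^ (r + 1))⁻¹) • (expCoeff p.1 * expCoeff p.2) • (x ^ p.1 * y ^ p.2) =
          (q ^ p.2 * (q ^ p.1 - (q ^ p.1)⁻¹) * expCoeff p.1 * expCoeff p.2) • (x ^ p.1 * y ^ p.2) +
          ((q ^ p.1)⁻¹ * (q ^ p.2 - (q ^ p.2)⁻¹) * expCoeff p.1 * expCoeff p.2) •
            (x ^ p.1 * y ^ p.2) := by
        intro p hp
        rw [Finset.HasAntidiagonal.mem_antidiagonal] at hp
        rw [smul_smul, ← add_smul, ← hp, pow_add]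
        congr 1
        have := pow_ne_zero p.1 hq
        have := pow_ne_zero p.2 hq
        field_simp
        ring
      rw [Finset.smul_sum, Finset.sum_congr rfl e1, Finset.sum_add_distrib]
      congr 1
      · rw [Finset.Nat.sum_antidiagonal_succ]
        simp only [pow_zero, inv_one, sub_self, mul_zero, zero_mul, zero_smul, zero_add]
        refine Finset.sum_congr rfl fun p hp => ?_
        rw [Finset.HasAntidiagonal.mem_antidiagonal] at hp
        rw [mul_smul_comm, smul_smul, ← mul_assoc x, ← pow_succ', ← mul_assoc (_ * _)]
        congr 1
        rw [mul_assoc (q ^ p.2), expCoeff_succ, ← hp, pow_add]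
        ring
      · rw [Finset.Nat.sum_antidiagonal_succ']
        simp only [pow_zero, inv_one, sub_self, mul_zero, zero_mul, zero_smul, zero_add]
        refine Finset.sum_congr rfl fun p hp => ?_
        rw [Finset.HasAntidiagonal.mem_antidiagonal] at hp
        rw [mul_smul_comm, smul_smul, ← mul_assoc y, hyx, smul_mul_assoc, smul_smul, mul_assoc (x ^ p.1),
          ← pow_succ']
        congr 1
        have e2 := expCoeff_succ p.2
        rw [mul_right_comm _ (expCoeff p.1), mul_assoc _ _ (expCoeff (p.2 + 1)), e2, ← hp, pow_add,
          two_mul, pow_add]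
        have := pow_ne_zero p.1 hq
        field_simp
    have := congrArg ((q ^ (r + 1) - (q ^ (r + 1))⁻¹)⁻¹ • ·) key
    simpa only [inv_smul_smul₀ hr] using this

/-- A product x^a y^b survives only for a, b < N, and then a + b < 2N. The truncation at 2N
therefore loses none of these terms, and the additional ones vanish. -/
theorem expSum_add {x y : A} (h : x * y = q ^ 2 • (y * x)) {N : ℕ} (hx : x ^ N = 0)
    (hy : y ^ N = 0) : expSum (2 * N) (x + y) = expSum N x * expSum N y := by
  have e : expSum (2 * N) (x + y) = ∑ r ∈ Finset.range (2 * N), ∑ p ∈ Finset.HasAntidiagonal.antidiagonal r,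
      (expCoeff p.1 * expCoeff p.2) • (x ^ p.1 * y ^ p.2) :=
    Finset.sum_congr rfl fun r _ => expCoeff_smul_add_pow h r
  rw [e, expSum, expSum, Finset.sum_mul_sum, ← Finset.sum_product', Finset.sum_sigma']
  symm
  refine Finset.sum_of_injOn (fun p => ⟨p.1 + p.2, p⟩) ?_ ?_ ?_ ?_
  · rintro ⟨a, b⟩ _ ⟨c, d⟩ _ hp
    simp only [Sigma.mk.injEq] at hp
    simpa using hp.2
  · rintro ⟨a, b⟩ hp
    simp only [Finset.coe_product, Finset.coe_range, Set.mem_prod, Set.mem_Iio] at hp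
    simp only [Finset.coe_sigma, Set.mem_sigma_iff, Finset.coe_range, Set.mem_Iio,
      SetLike.mem_coe, Finset.HasAntidiagonal.mem_antidiagonal, and_true]
    omega
  · rintro ⟨r, ⟨a, b⟩⟩ hp hn
    simp only [Finset.mem_sigma, Finset.mem_range, Finset.HasAntidiagonal.mem_antidiagonal] at hp
    by_cases ha : N ≤ a
    · simp [pow_eq_zero_of_le ha hx]
    by_cases hb : N ≤ b
    · simp [pow_eq_zero_of_le hb hy]
    exfalso
    apply hn
    refine ⟨⟨a, b⟩, by simp; omega, ?_⟩
    obtain ⟨-, rfl⟩ := hp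
    rfl
  · rintro ⟨a, b⟩ _
    rw [smul_mul_smul_comm]

/-- Moving `k` to the left replaces x by q⁻²x, and the q-difference equation exp(q⁻²x) = (1 - q⁻¹(q
- q⁻¹)²x) exp(x) is the recursion for the coefficients. This is the source of the correction term in
τ_L(K). -/
theorem expSum_mul_of_qCommute {x k : A} (h : k * x = q ^ 2 • (x * k)) {N : ℕ} (hx : x ^ N = 0) :
    expSum N x * k = k * (1 - (q⁻¹ * (q - q⁻¹) ^ 2) • x) * expSum N x := by
  have hq := q_ne_zero
  have hxk : ∀ s, x ^ s * k = (q ^ (2 * s))⁻¹ • (k * x ^ s) := by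
    intro s
    induction s with
    | zero => simp
    | succ s ih =>
      have h' : x * k = (q ^ 2)⁻¹ • (k * x) := by
        rw [h, smul_smul, inv_mul_cancel₀ (pow_ne_zero 2 hq), one_smul]
      rw [pow_succ', mul_assoc, ih, mul_smul_comm, ← mul_assoc, h', smul_mul_assoc, smul_smul,
        mul_assoc]
      congr 1
      field_simp
      ring
  rw [mul_assoc]
  have e1 : expSum N x * k = k * ∑ r ∈ Finset.range (N + 1), ((q ^ (2 * r))⁻¹ * expCoeff r) • x ^ r := by
    rw [← expSum_eq_of_le hx (Nat.le_succ N), expSum, Finset.sum_mul, Finset.mul_sum]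
    refine Finset.sum_congr rfl fun r _ => ?_
    rw [smul_mul_assoc, hxk, mul_smul_comm, smul_smul, mul_comm (expCoeff r)]
  rw [e1]
  congr 1
  rw [sub_mul, one_mul]
  -- Only the first of the two sums is lengthened, since the second gains a degree from the factor
  -- `x`.
  nth_rewrite 1 [← expSum_eq_of_le hx (Nat.le_succ N)]
  rw [expSum, expSum, smul_mul_assoc, Finset.mul_sum, Finset.smul_sum,
    Finset.sum_range_succ', Finset.sum_range_succ', add_sub_right_comm, ← Finset.sum_sub_distrib]
  congr 1
  · refine Finset.sum_congr rfl fun r _ => ?_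
    rw [mul_smul_comm, ← pow_succ', smul_smul, ← sub_smul]
    congr 1
    have := expCoeff_succ r
    have h1 := pow_ne_zero r hq
    have e2 : q ^ (2 * (r + 1)) = q ^ r * q ^ r * q ^ 2 := by ring
    rw [e2]
    rw [pow_succ] at this
    generalize q ^ r = c at *
    generalize expCoeff (r + 1) = a at *
    generalize expCoeff r = b at *
    field_simp at this ⊢
    linear_combination -this
  · simp


/-! ### Commutators with powers of the generators, and the intertwining property of the
quasi-R-matrix. -/

theorem UqRelations.e_mul_f_pow {𝕜 B : Type*} [Field 𝕜] [Ring B] [Algebra 𝕜 B] {q : 𝕜} {e f k k' : B}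
    (h : UqRelations q e f k k') (hq : q ≠ 0) (hq2 : q ^ 2 - 1 ≠ 0) (r : ℕ) :
    e * f ^ (r + 1) = f ^ (r + 1) * e +
      ((q ^ (r + 1) - (q ^ (r + 1))⁻¹) / (q - q⁻¹) ^ 2) •
        (f ^ r * ((q ^ r)⁻¹ • k - q ^ r • k')) := by
  induction r with
  | zero =>
    simp only [zero_add, pow_one, pow_zero, inv_one, one_smul, one_mul]
    rw [h.e_f', add_sub_assoc, ← smul_sub]
    congr 2
    field_simp
  | succ r ih =>
    have hr := pow_ne_zero r hq
    rw [pow_succ, ← mul_assoc, ih, add_mul, mul_assoc _ e f, h.e_f']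
    simp only [smul_mul_assoc, mul_assoc, sub_mul, h.k_f, h.k'_f hq, mul_add, mul_sub,
      mul_smul_comm, smul_smul, smul_sub, pow_succ f]
    match_scalars
    · rfl
    all_goals
      have hs : q ^ (r + 1 + 1) = q ^ r * q ^ 2 := by ring
      have hs' : q ^ (r + 1) = q ^ r * q := by ring
      rw [hs, hs']
      generalize q ^ r = c at *
      field_simp
      ring

theorem UqRelations.e_pow_mul_f {𝕜 B : Type*} [Field 𝕜] [Ring B] [Algebra 𝕜 B] {q : 𝕜} {e f k k' : B}
    (h : UqRelations q e f k k') (hq : q ≠ 0) (hq2 : q ^ 2 - 1 ≠ 0) (r : ℕ) :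
    e ^ (r + 1) * f = f * e ^ (r + 1) +
      ((q ^ (r + 1) - (q ^ (r + 1))⁻¹) / (q - q⁻¹) ^ 2) •
        (((q ^ r)⁻¹ • k - q ^ r • k') * e ^ r) := by
  induction r with
  | zero =>
    simp only [zero_add, pow_one, pow_zero, inv_one, one_smul, mul_one]
    rw [h.e_f', add_sub_assoc, ← smul_sub]
    congr 2
    field_simp
  | succ r ih =>
    have hr := pow_ne_zero r hq
    rw [pow_succ', mul_assoc, ih, mul_add, ← mul_assoc e f, h.e_f']
    simp only [smul_mul_assoc, ← mul_assoc, sub_mul, h.e_k hq, h.e_k' hq, add_mul, mul_sub,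
      mul_smul_comm, smul_smul, smul_sub, pow_succ' e]
    match_scalars
    · rfl
    all_goals
      have hs : q ^ (r + 1 + 1) = q ^ r * q ^ 2 := by ring
      have hs' : q ^ (r + 1) = q ^ r * q := by ring
      rw [hs, hs']
      generalize q ^ r = c at *
      field_simp
      ring

theorem UqRelations.k'_mul_f_pow {e f k k' : A} (h : UqRelations q e f k k') (r : ℕ) :
    k' * f ^ r = (q ^ r * q ^ r) • (f ^ r * k') := by
  induction r with
  | zero => simp
  | succ r ih =>
    rw [pow_succ, ← mul_assoc, ih, smul_mul_assoc, mul_assoc, h.k'_f q_ne_zero, mul_smul_comm,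
      smul_smul, ← mul_assoc (f ^ r)]
    congr 1
    ring

theorem UqRelations.e_pow_mul_k' {e f k k' : A} (h : UqRelations q e f k k') (r : ℕ) :
    e ^ r * k' = (q ^ r * q ^ r) • (k' * e ^ r) := by
  induction r with
  | zero => simp
  | succ r ih =>
    rw [pow_succ', mul_assoc, ih, mul_smul_comm, ← mul_assoc, h.e_k' q_ne_zero, smul_mul_assoc,
      smul_smul, mul_assoc k']
    congr 1
    ring

/-- The scalar in the commutator of E with F^(r+1) (or of E^(r+1) with F) lowers the coefficient of
the exponential by one index. -/
theorem expCoeff_succ_mul_div (r : ℕ) :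
    expCoeff (r + 1) * ((q ^ (r + 1) - (q ^ (r + 1))⁻¹) / (q - q⁻¹) ^ 2) = q ^ r * expCoeff r := by
  have h := expCoeff_succ r
  have h2 := q_sub_inv_ne_zero
  generalize q ^ (r + 1) - (q ^ (r + 1))⁻¹ = x at *
  generalize q - q⁻¹ = y at *
  field_simp
  linear_combination h

section Intertwine

variable {e f k k' e₂ f₂ k₂ k₂' : A}

theorem expSum_mul_pow (h : f₂ * e = e * f₂) (N : ℕ) :
    expSum N (e * f₂) = ∑ r ∈ Finset.range N, expCoeff r • (e ^ r * f₂ ^ r) :=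
  Finset.sum_congr rfl fun r _ => by
    have h : Commute f₂ e := h
    rw [h.symm.mul_pow]

/-- A comparison in each degree: the commutator of 1 ⊗ E with the term of index r + 1 of Θ equals
the difference of the products of the term of index r with E ⊗ K on the right and with E ⊗ K⁻¹ on
the left. -/
theorem UqPair.expSum_mul_coprod_e (h : UqPair q e f k k' e₂ f₂ k₂ k₂') {N : ℕ}
    (he : e ^ N = 0) :
    expSum N (e * f₂) * (e * k₂ + e₂) = (e * k₂' + e₂) * expSum N (e * f₂) := by
  have hx : (e * f₂) ^ N = 0 := by
    have h' : Commute e f₂ := h.f_e.symm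
    rw [h'.mul_pow, he, zero_mul]
  have hq := q_ne_zero
  have h1 : ∀ r, Commute e₂ (e ^ r) := fun r => (show Commute e₂ e from h.e_e).pow_right r
  have h2 : ∀ r, Commute (f₂ ^ r) e := fun r => (show Commute f₂ e from h.f_e).pow_left r
  have h3 : ∀ r, Commute k₂' (e ^ r) := fun r => (show Commute k₂' e from h.k'_e).pow_right r
  -- The sum on the left runs to N + 1 because its index is shifted by one; its term r = 0 is zero,
  -- and lengthening the exponential is harmless as `(e * f₂) ^ N = 0`.
  suffices hs : ∑ r ∈ Finset.range (N + 1), expCoeff r • (e ^ r * (e₂ * f₂ ^ r - f₂ ^ r * e₂)) =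
      ∑ r ∈ Finset.range N, expCoeff r • (e ^ (r + 1) * (f₂ ^ r * k₂ - k₂' * f₂ ^ r)) by
    have e1 : expSum N (e * f₂) * e₂ = e₂ * expSum N (e * f₂) -
        ∑ r ∈ Finset.range (N + 1), expCoeff r • (e ^ r * (e₂ * f₂ ^ r - f₂ ^ r * e₂)) := by
      rw [← expSum_eq_of_le hx (Nat.le_succ N), expSum_mul_pow h.f_e, Finset.sum_mul,
        Finset.mul_sum, ← Finset.sum_sub_distrib]
      refine Finset.sum_congr rfl fun r _ => ?_
      rw [mul_smul_comm, smul_mul_assoc, ← smul_sub, mul_sub, ← mul_assoc e₂, (h1 r).eq, mul_assoc,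
        mul_assoc]
      congr 1
      abel
    have e2 : expSum N (e * f₂) * (e * k₂) = e * k₂' * expSum N (e * f₂) +
        ∑ r ∈ Finset.range N, expCoeff r • (e ^ (r + 1) * (f₂ ^ r * k₂ - k₂' * f₂ ^ r)) := by
      rw [expSum_mul_pow h.f_e, Finset.sum_mul, Finset.mul_sum, ← Finset.sum_add_distrib]
      refine Finset.sum_congr rfl fun r _ => ?_
      rw [mul_smul_comm, smul_mul_assoc, ← smul_add, mul_sub, mul_assoc e k₂', ← mul_assoc k₂',
        (h3 r).eq, mul_assoc, ← mul_assoc (f₂ ^ r), (h2 r).eq, mul_assoc e, ← mul_assoc (e ^ r),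
        ← pow_succ, mul_assoc (e ^ r), ← mul_assoc e (e ^ r), ← pow_succ']
      congr 1
      abel
    rw [mul_add, e1, e2, hs, add_mul]
    abel
  rw [Finset.sum_range_succ']
  simp only [pow_zero, mul_one, one_mul, sub_self, smul_zero, add_zero]
  refine Finset.sum_congr rfl fun r _ => ?_
  rw [h.snd.e_mul_f_pow hq (sub_ne_zero.mpr q_sq_ne_one), add_sub_cancel_left, mul_smul_comm, smul_smul, expCoeff_succ_mul_div,
    h.snd.k'_mul_f_pow, mul_comm, mul_smul, ← mul_smul_comm, mul_sub, smul_sub, mul_smul_comm,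
    mul_smul_comm, smul_smul, smul_smul, mul_inv_cancel₀ (pow_ne_zero r hq), one_smul]

/-- The same cancellation as for Δ(E), now with the commutators of powers of E with F in the first
copy. -/
theorem UqPair.expSum_mul_coprod_f (h : UqPair q e f k k' e₂ f₂ k₂ k₂') {N : ℕ}
    (he : e ^ N = 0) :
    expSum N (e * f₂) * (f + k' * f₂) = (f + k * f₂) * expSum N (e * f₂) := by
  have hx : (e * f₂) ^ N = 0 := by
    have h' : Commute e f₂ := h.f_e.symm
    rw [h'.mul_pow, he, zero_mul]
  have hq := q_ne_zero
  have h1 : ∀ r, Commute (f₂ ^ r) f := fun r => (show Commute f₂ f from h.f_f).pow_left r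
  have h2 : ∀ r, Commute f₂ (e ^ r) := fun r => (show Commute f₂ e from h.f_e).pow_right r
  have h3 : ∀ r, Commute (f₂ ^ r) k' := fun r => (show Commute f₂ k' from h.f_k').pow_left r
  suffices hs : ∑ r ∈ Finset.range (N + 1), expCoeff r • ((e ^ r * f - f * e ^ r) * f₂ ^ r) =
      ∑ r ∈ Finset.range N, expCoeff r • ((k * e ^ r - e ^ r * k') * f₂ ^ (r + 1)) by
    have e1 : expSum N (e * f₂) * f = f * expSum N (e * f₂) +
        ∑ r ∈ Finset.range (N + 1), expCoeff r • ((e ^ r * f - f * e ^ r) * f₂ ^ r) := by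
      rw [← expSum_eq_of_le hx (Nat.le_succ N), expSum_mul_pow h.f_e, Finset.sum_mul,
        Finset.mul_sum, ← Finset.sum_add_distrib]
      refine Finset.sum_congr rfl fun r _ => ?_
      rw [mul_smul_comm, smul_mul_assoc, ← smul_add, sub_mul, mul_assoc, (h1 r).eq, ← mul_assoc,
        ← mul_assoc]
      congr 1
      abel
    have e2 : expSum N (e * f₂) * (k' * f₂) = k * f₂ * expSum N (e * f₂) -
        ∑ r ∈ Finset.range N, expCoeff r • ((k * e ^ r - e ^ r * k') * f₂ ^ (r + 1)) := by
      rw [expSum_mul_pow h.f_e, Finset.sum_mul, Finset.mul_sum, ← Finset.sum_sub_distrib]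
      refine Finset.sum_congr rfl fun r _ => ?_
      rw [mul_smul_comm, smul_mul_assoc, ← smul_sub, sub_mul, mul_assoc k f₂, ← mul_assoc f₂,
        (h2 r).eq, mul_assoc (e ^ r) f₂, ← pow_succ', mul_assoc (e ^ r), ← mul_assoc (f₂ ^ r) k',
        (h3 r).eq, mul_assoc k' (f₂ ^ r), ← pow_succ]
      simp only [mul_assoc]
      congr 1
      abel
    rw [mul_add, e1, e2, hs, add_mul]
    abel
  rw [Finset.sum_range_succ']
  simp only [pow_zero, mul_one, one_mul, sub_self, smul_zero, add_zero]
  refine Finset.sum_congr rfl fun r _ => ?_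
  rw [h.fst.e_pow_mul_f hq (sub_ne_zero.mpr q_sq_ne_one), add_sub_cancel_left, smul_mul_assoc,
    smul_smul, expCoeff_succ_mul_div, h.fst.e_pow_mul_k', mul_comm, mul_smul,
    ← smul_mul_assoc (q ^ r), ← smul_mul_assoc (q ^ r), smul_sub, smul_smul, smul_smul,
    mul_inv_cancel₀ (pow_ne_zero r hq), one_smul, sub_mul, smul_mul_assoc]

end Intertwine

end Ring

open Uq

/-! ### The tensor factors of the completion -/

/-- The `j`-th tensor factor of the completion. -/
def factorHom {n : ℕ} (j : Fin n) : Uq →ₐ[Kq] Completion n :=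
  (toCompletion n).comp (PiTensorProduct.singleAlgHom (R := Kq) (A := fun _ : Fin n => Uq) j)

theorem toCompletion_tprod {n : ℕ} (x : Fin n → Uq) :
    toCompletion n (PiTensorProduct.tprod Kq x) = repTensor n x :=
  PiTensorProduct.lift.tprod x

/-- All tensor factors other than `j` act by the identity matrix. -/
theorem factorHom_apply {n : ℕ} (j : Fin n) (x : Uq) (m : Fin n → ℕ)
    (a b : (l : Fin n) → Fin (m l + 1)) :
    factorHom j x m a b = if ∀ l, l ≠ j → a l = b l then rep (m j) x (a j) (b j) else 0 := by
  have h1 : factorHom j x m a b = ∏ l, rep (m l) (Pi.mulSingle (M := fun _ => Uq) j x l) (a l) (b l) := by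
    have := toCompletion_tprod (n := n) (Pi.mulSingle (M := fun _ => Uq) j x)
    rw [factorHom, AlgHom.comp_apply]
    exact (congrFun (congrFun (congrFun this m) a) b)
  rw [h1, ← Finset.mul_prod_erase _ _ (Finset.mem_univ j), Pi.mulSingle_eq_same]
  split_ifs with h
  · rw [Finset.prod_eq_one, mul_one]
    intro l hl
    have hl' := Finset.ne_of_mem_erase hl
    rw [Pi.mulSingle_eq_of_ne hl', map_one, h l hl', Matrix.one_apply_eq]
  · push Not at h
    obtain ⟨l, hl, hab⟩ := h
    rw [Finset.prod_eq_zero (Finset.mem_erase.mpr ⟨hl, Finset.mem_univ l⟩), mul_zero]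
    rw [Pi.mulSingle_eq_of_ne hl, map_one, Matrix.one_apply_ne hab]

theorem factorHom_commute {n : ℕ} {i j : Fin n} (h : i ≠ j) (x y : Uq) :
    Commute (factorHom i x) (factorHom j y) := by
  have : Commute (Pi.mulSingle (M := fun _ : Fin n => Uq) i x)
      (Pi.mulSingle (M := fun _ => Uq) j y) := Pi.mulSingle_commute (f := fun _ : Fin n => Uq) h x y
  exact (Commute.tprod this).map (toCompletion n)

theorem uqRelations_map {R S : Type*} [Ring R] [Algebra Kq R] [Ring S] [Algebra Kq S]
    {e f k k' : R} (h : UqRelations q e f k k') (φ : R →ₐ[Kq] S) :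
    UqRelations q (φ e) (φ f) (φ k) (φ k') := by
  obtain ⟨b1, b2, b3, b4, b5⟩ := h
  constructor <;> simp only [← map_mul, ← map_sub, ← map_smul, *, map_one]

theorem factorHom_pair {n : ℕ} {i j : Fin n} (h : i ≠ j) :
    UqPair q (factorHom i E) (factorHom i F) (factorHom i K) (factorHom i Kinv)
      (factorHom j E) (factorHom j F) (factorHom j K) (factorHom j Kinv) := by
  have hc := fun x y => (factorHom_commute h.symm x y).eq
  exact ⟨uqRelations_map Uq.relations _, uqRelations_map Uq.relations _,
    hc _ _, hc _ _, hc _ _, hc _ _, hc _ _, hc _ _, hc _ _, hc _ _, hc _ _, hc _ _, hc _ _, hc _ _,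
    hc _ _, hc _ _, hc _ _, hc _ _⟩

theorem rep_E (m : ℕ) : rep m E = repE m := lift_E _
theorem rep_F (m : ℕ) : rep m F = repF m := lift_F _
theorem rep_K (m : ℕ) : rep m K = repK m := lift_K _
theorem rep_Kinv (m : ℕ) : rep m Kinv = repKinv m := lift_Kinv _

theorem repE_pow_apply_of_ne (m r : ℕ) (a b : Fin (m + 1)) (h : (a : ℕ) + r ≠ b) :
    (repE m ^ r) a b = 0 := by
  induction r generalizing a with
  | zero =>
    rw [pow_zero, Matrix.one_apply_ne]
    rintro rfl
    exact h rfl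
  | succ r ih =>
    rw [pow_succ', repE_mul]
    split_ifs with ha
    · rw [ih, mul_zero]
      simp only
      omega
    · rfl

theorem repE_pow_eq_zero (m : ℕ) : repE m ^ (m + 1) = 0 := by
  ext a b
  exact repE_pow_apply_of_ne _ _ _ _ (by omega)

theorem repF_pow_apply_of_ne (m r : ℕ) (a b : Fin (m + 1)) (h : (a : ℕ) ≠ b + r) :
    (repF m ^ r) a b = 0 := by
  induction r generalizing a with
  | zero =>
    rw [pow_zero, Matrix.one_apply_ne]
    rintro rfl
    exact h rfl
  | succ r ih =>
    rw [pow_succ', repF_mul]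
    split_ifs with ha
    · rw [ih, mul_zero]
      simp only
      omega
    · rfl

theorem repF_pow_eq_zero (m : ℕ) : repF m ^ (m + 1) = 0 := by
  ext a b
  exact repF_pow_apply_of_ne _ _ _ _ (by omega)

theorem factorHom_apply_eq_zero {n : ℕ} (j : Fin n) {x : Uq} {m : Fin n → ℕ}
    (h : rep (m j) x = 0) : factorHom j x m = 0 := by
  ext a b
  rw [factorHom_apply, h]
  simp

theorem factorHom_E_pow {n : ℕ} (j : Fin n) (m : Fin n → ℕ) :
    (factorHom j E m) ^ (m j + 1) = 0 := by
  have h := factorHom_apply_eq_zero j (x := E ^ (m j + 1)) (m := m)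
    (by rw [map_pow, rep_E, repE_pow_eq_zero])
  rwa [map_pow] at h

theorem factorHom_F_pow {n : ℕ} (j : Fin n) (m : Fin n → ℕ) :
    (factorHom j F m) ^ (m j + 1) = 0 := by
  have h := factorHom_apply_eq_zero j (x := F ^ (m j + 1)) (m := m)
    (by rw [map_pow, rep_F, repF_pow_eq_zero])
  rwa [map_pow] at h

theorem factorHom_K {n : ℕ} (j : Fin n) (m : Fin n → ℕ) :
    factorHom j K m = Matrix.diagonal fun a => q ^ weight (m j) (a j) := by
  ext a b
  rw [factorHom_apply, rep_K, repK]
  by_cases hab : a = b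
  · subst hab; simp
  · rw [Matrix.diagonal_apply_ne _ hab]
    split_ifs with h
    · rw [Matrix.diagonal_apply_ne]
      intro h'
      apply hab
      funext l
      by_cases hl : l = j
      · rw [hl, h']
      · exact h l hl
    · rfl

theorem factorHom_Kinv {n : ℕ} (j : Fin n) (m : Fin n → ℕ) :
    factorHom j Kinv m = Matrix.diagonal fun a => q ^ (-weight (m j) (a j)) := by
  ext a b
  rw [factorHom_apply, rep_Kinv, repKinv]
  by_cases hab : a = b
  · subst hab; simp
  · rw [Matrix.diagonal_apply_ne _ hab]
    split_ifs with h
    · rw [Matrix.diagonal_apply_ne]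
      intro h'
      apply hab
      funext l
      by_cases hl : l = j
      · rw [hl, h']
      · exact h l hl
    · rfl

/-! ### The diagonal part of the `R`-matrix -/

/-- The exponent of the diagonal part of the `R`-matrix on the factors `i` and `j`: up to a
constant, half of the product of the weights. -/
def diagExponent {n : ℕ} (i j : Fin n) (m : Fin n → ℕ) (a : (l : Fin n) → Fin (m l + 1)) : ℤ :=
  2 * (a i : ℤ) * (a j : ℤ) - (a i : ℤ) * m j - (a j : ℤ) * m i

/-- The diagonal part of the `R`-matrix on the factors `i` and `j`. -/
def diagPart {n : ℕ} (i j : Fin n) : (Completion n)ˣ where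
  val := fun m => Matrix.diagonal fun a => q ^ diagExponent i j m a
  inv := fun m => Matrix.diagonal fun a => q ^ (-diagExponent i j m a)
  val_inv := by
    funext m
    rw [Pi.mul_apply, Matrix.diagonal_mul_diagonal, Pi.one_apply, ← Matrix.diagonal_one]
    congr 1
    funext a
    rw [← zpow_add₀ q_ne_zero, add_neg_cancel, zpow_zero]
  inv_val := by
    funext m
    rw [Pi.mul_apply, Matrix.diagonal_mul_diagonal, Pi.one_apply, ← Matrix.diagonal_one]
    congr 1
    funext a
    rw [← zpow_add₀ q_ne_zero, neg_add_cancel, zpow_zero]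

theorem diagPart_symm {n : ℕ} (i j : Fin n) : diagPart i j = diagPart j i := by
  ext m a b
  simp only [diagPart, Matrix.diagonal_apply, diagExponent]
  congr 2
  ring

theorem diagPart_commute {n : ℕ} (i j k l : Fin n) : Commute (diagPart i j) (diagPart k l) := by
  apply Units.ext
  funext m
  simp only [diagPart, Units.val_mul, Pi.mul_apply, Matrix.diagonal_mul_diagonal]
  congr 1
  funext a
  rw [mul_comm]

theorem diagPart_commute_factorHom {n : ℕ} {i j l : Fin n} (hi : i ≠ l) (hj : j ≠ l) (x : Uq) :
    Commute (diagPart i j : Completion n) (factorHom l x) := by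
  funext m
  ext a b
  simp only [diagPart, Pi.mul_apply, Matrix.diagonal_mul, Matrix.mul_diagonal]
  rw [factorHom_apply]
  split_ifs with h
  · rw [diagExponent, diagExponent, h i hi, h j hj, mul_comm]
  · simp

theorem diagPart_commute_K {n : ℕ} (i j l : Fin n) :
    Commute (diagPart i j : Completion n) (factorHom l K) := by
  funext m
  rw [Pi.mul_apply, Pi.mul_apply, factorHom_K]
  simp only [diagPart, Matrix.diagonal_mul_diagonal]
  congr 1
  funext a
  rw [mul_comm]

theorem diagPart_commute_Kinv {n : ℕ} (i j l : Fin n) :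
    Commute (diagPart i j : Completion n) (factorHom l Kinv) := by
  funext m
  rw [Pi.mul_apply, Pi.mul_apply, factorHom_Kinv]
  simp only [diagPart, Matrix.diagonal_mul_diagonal]
  congr 1
  funext a
  rw [mul_comm]

/-- E lowers the index by one; the resulting change of the bilinear exponent is the weight at `j`,
that is, an action of K there. -/
theorem diagPart_mul_E {n : ℕ} {i j : Fin n} (h : i ≠ j) :
    (diagPart i j : Completion n) * factorHom i E = factorHom i E * factorHom j K * diagPart i j := by
  funext m
  rw [Pi.mul_apply, Pi.mul_apply, Pi.mul_apply, factorHom_K]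
  ext a b
  simp only [diagPart, Matrix.diagonal_mul, Matrix.mul_diagonal]
  rw [factorHom_apply, rep_E]
  split_ifs with h1
  · simp only [repE, Matrix.of_apply]
    split_ifs with h2
    · rw [mul_assoc, ← zpow_add₀ q_ne_zero, mul_comm]
      congr 2
      rw [diagExponent, diagExponent, weight, h1 j h.symm, ← h2]
      push_cast
      ring
    · simp
  · simp

theorem diagPart_mul_F {n : ℕ} {i j : Fin n} (h : i ≠ j) :
    (diagPart i j : Completion n) * factorHom i F =
      factorHom i F * factorHom j Kinv * diagPart i j := by
  funext m
  rw [Pi.mul_apply, Pi.mul_apply, Pi.mul_apply, factorHom_Kinv]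
  ext a b
  simp only [diagPart, Matrix.diagonal_mul, Matrix.mul_diagonal]
  rw [factorHom_apply, rep_F]
  split_ifs with h1
  · simp only [repF, Matrix.of_apply]
    split_ifs with h2
    · rw [mul_assoc, ← zpow_add₀ q_ne_zero, mul_comm]
      congr 2
      rw [diagExponent, diagExponent, weight, h1 j h.symm, h2]
      push_cast
      ring
    · simp
  · simp

/-! ### Permutations of the tensor factors -/

/-- The automorphism of the completion which permutes the tensor factors. -/
def permHom {n : ℕ} (π : Equiv.Perm (Fin n)) : Completion n →ₐ[Kq] Completion n :=
  AlgHom.pi fun m => ((Matrix.reindexAlgEquiv Kq Kq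
    (Equiv.piCongrLeft (fun l => Fin (m l + 1)) π)).toAlgHom.comp
      (Pi.evalAlgHom Kq _ fun l => m (π l)))

theorem permHom_apply {n : ℕ} (π : Equiv.Perm (Fin n)) (X : Completion n) (m : Fin n → ℕ)
    (a b : (l : Fin n) → Fin (m l + 1)) :
    permHom π X m a b = X (fun l => m (π l)) (fun l => a (π l)) (fun l => b (π l)) := rfl

theorem permHom_permHom {n : ℕ} (π ρ : Equiv.Perm (Fin n)) (X : Completion n) :
    permHom π (permHom ρ X) = permHom (π * ρ) X := rfl

theorem permHom_one {n : ℕ} (X : Completion n) : permHom 1 X = X := rfl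

/-- The automorphism of the completion which permutes the tensor factors. -/
def permEquiv {n : ℕ} (π : Equiv.Perm (Fin n)) : Completion n ≃ₐ[Kq] Completion n :=
  AlgEquiv.ofAlgHom (permHom π) (permHom π⁻¹)
    (AlgHom.ext fun X => by
      rw [AlgHom.comp_apply, permHom_permHom, mul_inv_cancel, permHom_one, AlgHom.id_apply])
    (AlgHom.ext fun X => by
      rw [AlgHom.comp_apply, permHom_permHom, inv_mul_cancel, permHom_one, AlgHom.id_apply])

theorem permEquiv_apply {n : ℕ} (π : Equiv.Perm (Fin n)) (X : Completion n) :
    permEquiv π X = permHom π X := rfl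

theorem permEquiv_mul {n : ℕ} (π ρ : Equiv.Perm (Fin n)) :
    permEquiv (π * ρ) = permEquiv π * permEquiv ρ := rfl

theorem permHom_factorHom {n : ℕ} (π : Equiv.Perm (Fin n)) (j : Fin n) (x : Uq) :
    permHom π (factorHom j x) = factorHom (π j) x := by
  funext m
  ext a b
  rw [permHom_apply, factorHom_apply, factorHom_apply]
  have : (∀ l, l ≠ j → a (π l) = b (π l)) ↔ ∀ l, l ≠ π j → a l = b l := by
    constructor
    · intro h l hl
      obtain ⟨l, rfl⟩ := π.surjective l
      exact h l (by rintro rfl; exact hl rfl)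
    · intro h l hl
      exact h (π l) (by simpa using hl)
  simp only [this]

theorem permHom_diagPart {n : ℕ} (π : Equiv.Perm (Fin n)) (i j : Fin n) :
    permHom π (diagPart i j : Completion n) = diagPart (π i) (π j) := by
  funext m
  ext a b
  rw [permHom_apply]
  simp only [diagPart, Matrix.diagonal_apply]
  have : ((fun l => a (π l)) = fun l => b (π l)) ↔ a = b := by
    constructor
    · intro h
      funext l
      obtain ⟨l, rfl⟩ := π.surjective l
      exact congrFun h l
    · rintro rfl; rfl
  simp only [this]
  rfl

/-! ### The `q`-exponential in the completion -/

section LocallyNilpotent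

variable {n : ℕ}

/-- An element of the completion which is nilpotent on every component. -/
def LocallyNilpotent (x : Completion n) : Prop := ∀ m, ∃ N, x m ^ N = 0

/-- The `q`-exponential of a locally nilpotent element of the completion. -/
def qExp (x : Completion n) : Completion n := fun m => expSum (nilpotencyClass (x m)) (x m)

/-- The truncation in the definition is immaterial: any exponent that annihilates the component
gives the same sum. -/
theorem qExp_apply {x : Completion n} {m : Fin n → ℕ} {N : ℕ} (h : x m ^ N = 0) :
    qExp x m = expSum N (x m) :=
  (expSum_eq_of_le (pow_nilpotencyClass ⟨N, h⟩) (Nat.sInf_le h)).symm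

theorem qExp_isUnit {x : Completion n} (h : LocallyNilpotent x) : IsUnit (qExp x) := by
  rw [Pi.isUnit_iff]
  intro m
  obtain ⟨N, hN⟩ := h m
  rw [qExp_apply hN]
  exact expSum_isUnit hN

theorem qExp_intertwine {x y t : Completion n} (hx : LocallyNilpotent x) (hy : LocallyNilpotent y)
    (h : t * x = y * t) : t * qExp x = qExp y * t := by
  funext m
  obtain ⟨N, hN⟩ := hx m
  obtain ⟨M, hM⟩ := hy m
  rw [Pi.mul_apply, Pi.mul_apply, qExp_apply (pow_eq_zero_of_le (le_max_left N M) hN),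
    qExp_apply (pow_eq_zero_of_le (le_max_right N M) hM)]
  exact expSum_intertwine (congrFun h m)

theorem qExp_commute {x y : Completion n} (hx : LocallyNilpotent x) (h : Commute x y) :
    Commute (qExp x) y :=
  (qExp_intertwine hx hx h.symm).symm

theorem qExp_add {x y : Completion n} (hx : LocallyNilpotent x) (hy : LocallyNilpotent y)
    (hxy : LocallyNilpotent (x + y)) (h : x * y = q ^ 2 • (y * x)) :
    qExp (x + y) = qExp x * qExp y := by
  funext m
  obtain ⟨N, hN⟩ := hx m
  obtain ⟨M, hM⟩ := hy m
  obtain ⟨L, hL⟩ := hxy m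
  have hN' := pow_eq_zero_of_le (show N ≤ N + M + L by omega) hN
  have hM' := pow_eq_zero_of_le (show M ≤ N + M + L by omega) hM
  have hL' := pow_eq_zero_of_le (show L ≤ 2 * (N + M + L) by omega) hL
  rw [Pi.mul_apply, qExp_apply hN', qExp_apply hM', qExp_apply hL']
  exact expSum_add (congrFun h m) hN' hM'

theorem qExp_mul_of_qCommute {x k : Completion n} (hx : LocallyNilpotent x)
    (h : k * x = q ^ 2 • (x * k)) :
    qExp x * k = k * (1 - (q⁻¹ * (q - q⁻¹) ^ 2) • x) * qExp x := by
  funext m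
  obtain ⟨N, hN⟩ := hx m
  have := expSum_mul_of_qCommute (congrFun h m) hN
  rw [← qExp_apply hN] at this
  exact this

theorem map_expSum {A B : Type*} [Ring A] [Algebra Kq A] [Ring B] [Algebra Kq B] (φ : A →ₐ[Kq] B)
    (N : ℕ) (x : A) : φ (expSum N x) = expSum N (φ x) := by
  simp only [expSum, map_sum, map_smul, map_pow]

theorem permHom_qExp (π : Equiv.Perm (Fin n)) {x : Completion n} (hx : LocallyNilpotent x) :
    permHom π (qExp x) = qExp (permHom π x) := by
  funext m
  obtain ⟨N, hN⟩ := hx fun l => m (π l)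
  let φ := (Matrix.reindexAlgEquiv Kq Kq (Equiv.piCongrLeft (fun l => Fin (m l + 1)) π)).toAlgHom
  have e : ∀ X : Completion n, permHom π X m = φ (X fun l => m (π l)) := fun _ => rfl
  have h2 : permHom π x m ^ N = 0 := by rw [e, ← map_pow, hN, map_zero]
  rw [qExp_apply h2, e, e, qExp_apply hN, map_expSum]

theorem LocallyNilpotent.mul_right {x y : Completion n} (hy : LocallyNilpotent y)
    (h : Commute x y) : LocallyNilpotent (x * y) := by
  intro m
  obtain ⟨N, hN⟩ := hy m
  have h' : Commute (x m) (y m) := congrFun h m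
  exact ⟨N, by rw [Pi.mul_apply, h'.mul_pow, hN, mul_zero]⟩

theorem LocallyNilpotent.factorHom_F (j : Fin n) : LocallyNilpotent (factorHom j F) :=
  fun m => ⟨_, factorHom_F_pow j m⟩

end LocallyNilpotent

/-! ### The `R`-matrix -/

section RMatrix

variable {n : ℕ}

/-- The quasi-`R`-matrix on the factors `i` and `j`. -/
def quasiR (i j : Fin n) : Completion n := qExp (factorHom i E * factorHom j F)

theorem locallyNilpotent_E_mul_F {i j : Fin n} (h : i ≠ j) :
    LocallyNilpotent (factorHom i E * factorHom j F) :=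
  (LocallyNilpotent.factorHom_F j).mul_right (factorHom_commute h _ _)

/-- E and F in different factors commute, so E^r ⊗ F^r = (E ⊗ F)^r; the truncation at m_i is valid
as E^(m_i + 1) acts by zero. -/
theorem theta_eq_quasiR (i : Fin (n - 1)) : theta n i = quasiR (left i) (right i) := by
  have hne : left i ≠ right i := by simp [left, right]
  funext m
  have hc : Commute (factorHom (left i) E m) (factorHom (right i) F m) :=
    congrFun (factorHom_commute hne E F) m
  have hN : (factorHom (left i) E * factorHom (right i) F) m ^ (m (left i) + 1) = 0 := by
    rw [Pi.mul_apply, hc.mul_pow, factorHom_E_pow, zero_mul]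
  rw [quasiR, qExp_apply hN, expSum, theta]
  refine Finset.sum_congr rfl fun r _ => ?_
  rw [Pi.mul_apply, hc.mul_pow, map_mul, ← Pi.pow_apply (factorHom (left i) E),
    ← Pi.pow_apply (factorHom (right i) F), ← map_pow, ← map_pow]
  rfl

theorem quasiR_mul_coprod_E {i j : Fin n} (h : i ≠ j) :
    quasiR i j * (factorHom i E * factorHom j K + factorHom j E) =
      (factorHom i E * factorHom j Kinv + factorHom j E) * quasiR i j := by
  funext m
  have hp := (factorHom_pair h).map (Pi.evalAlgHom Kq _ m)
  have hN : (factorHom i E * factorHom j F) m ^ (m i + 1) = 0 := by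
    have hc : Commute (factorHom i E m) (factorHom j F m) := congrFun (factorHom_commute h E F) m
    rw [Pi.mul_apply, hc.mul_pow, factorHom_E_pow, zero_mul]
  rw [quasiR, Pi.mul_apply, Pi.mul_apply, qExp_apply hN]
  exact hp.expSum_mul_coprod_e (factorHom_E_pow i m)

theorem quasiR_mul_coprod_F {i j : Fin n} (h : i ≠ j) :
    quasiR i j * (factorHom i F + factorHom i Kinv * factorHom j F) =
      (factorHom i F + factorHom i K * factorHom j F) * quasiR i j := by
  funext m
  have hp := (factorHom_pair h).map (Pi.evalAlgHom Kq _ m)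
  have hN : (factorHom i E * factorHom j F) m ^ (m i + 1) = 0 := by
    have hc : Commute (factorHom i E m) (factorHom j F m) := congrFun (factorHom_commute h E F) m
    rw [Pi.mul_apply, hc.mul_pow, factorHom_E_pow, zero_mul]
  rw [quasiR, Pi.mul_apply, Pi.mul_apply, qExp_apply hN]
  exact hp.expSum_mul_coprod_f (factorHom_E_pow i m)

theorem quasiR_isUnit {i j : Fin n} (h : i ≠ j) : IsUnit (quasiR i j) :=
  qExp_isUnit (locallyNilpotent_E_mul_F h)

theorem permHom_quasiR (π : Equiv.Perm (Fin n)) {i j : Fin n} (h : i ≠ j) :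
    permHom π (quasiR i j) = quasiR (π i) (π j) := by
  rw [quasiR, permHom_qExp _ (locallyNilpotent_E_mul_F h), map_mul, permHom_factorHom,
    permHom_factorHom, quasiR]

/-- The `R`-matrix on the factors `i` and `j`. -/
def rMatrix (i j : Fin n) : Completion n := diagPart i j * quasiR i j

theorem rMatrix_isUnit {i j : Fin n} (h : i ≠ j) : IsUnit (rMatrix i j) :=
  (diagPart i j).isUnit.mul (quasiR_isUnit h)

theorem permHom_rMatrix (π : Equiv.Perm (Fin n)) {i j : Fin n} (h : i ≠ j) :
    permHom π (rMatrix i j) = rMatrix (π i) (π j) := by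
  rw [rMatrix, map_mul, permHom_diagPart, permHom_quasiR π h, rMatrix]

/-- Passing E_i creates K_k, passing F_j creates K_k⁻¹, and the two cancel. -/
theorem diagPart_mul_diagPart_commute_E_mul_F {i j k : Fin n} (hij : i ≠ j) (hik : i ≠ k)
    (hjk : j ≠ k) :
    Commute ((diagPart i k : Completion n) * diagPart j k) (factorHom i E * factorHom j F) := by
  have h1 := diagPart_mul_E hik
  have h2 := diagPart_mul_F hjk
  have h3 := (diagPart_commute_factorHom hij.symm hik.symm E (i := j) (j := k)).eq
  have h4 := (diagPart_commute_factorHom hij hjk.symm F (i := i) (j := k)).eq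
  have h5 := (factorHom_commute hjk F K).eq
  have h6 : factorHom k K * factorHom k Kinv = 1 := by
    rw [← map_mul, Uq.relations.k_k', map_one]
  have h7 := (diagPart_commute_Kinv i k k).eq
  change _ * _ * (_ * _) = _ * _ * (_ * _)
  calc (diagPart i k : Completion n) * diagPart j k * (factorHom i E * factorHom j F)
      = diagPart i k * (diagPart j k * factorHom i E) * factorHom j F := by
        simp only [mul_assoc]
    _ = (diagPart i k * factorHom i E) * (diagPart j k * factorHom j F) := by
        rw [h3]; simp only [mul_assoc]
    _ = factorHom i E * factorHom k K * (diagPart i k * factorHom j F) * factorHom k Kinv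
          * diagPart j k := by
        rw [h1, h2]; simp only [mul_assoc]
    _ = factorHom i E * (factorHom k K * factorHom j F) * (diagPart i k * factorHom k Kinv)
          * diagPart j k := by
        rw [h4]; simp only [mul_assoc]
    _ = factorHom i E * factorHom j F * (factorHom k K * factorHom k Kinv) *
          (diagPart i k * diagPart j k) := by
        rw [h7, ← h5]; simp only [mul_assoc]
    _ = _ := by rw [h6, mul_one]

theorem mul_mul_mul_of_commute {A : Type*} [Ring A] {a b c : A} (h : Commute c b) :
    a * c * (b * c) = a * b * (c * c) := by
  rw [mul_assoc, ← mul_assoc c, h.eq, mul_assoc, mul_assoc]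

/-- By the addition formula, (Δ ⊗ id)(Θ) splits as exp(E_i K_j F_k) Θ_jk, and its bar-conjugate
splits in the opposite order. Conjugation by Θ_ij exchanges the two, and the diagonal parts turn the
twisted exponentials into Θ_ik. -/
theorem yang_baxter {i j k : Fin n} (hij : i ≠ j) (hik : i ≠ k) (hjk : j ≠ k) :
    rMatrix i j * rMatrix i k * rMatrix j k = rMatrix j k * rMatrix i k * rMatrix i j := by
  have rj := uqRelations_map Uq.relations (factorHom j)
  have hy : LocallyNilpotent (factorHom i E * factorHom j K * factorHom k F) :=
    (LocallyNilpotent.factorHom_F k).mul_right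
      ((factorHom_commute hik _ _).mul_left (factorHom_commute hjk _ _))
  have hz : LocallyNilpotent (factorHom i E * factorHom j Kinv * factorHom k F) :=
    (LocallyNilpotent.factorHom_F k).mul_right
      ((factorHom_commute hik _ _).mul_left (factorHom_commute hjk _ _))
  have hx := locallyNilpotent_E_mul_F hjk
  have hs : LocallyNilpotent ((factorHom i E * factorHom j K + factorHom j E) * factorHom k F) :=
    (LocallyNilpotent.factorHom_F k).mul_right
      (((factorHom_commute hik _ _).mul_left (factorHom_commute hjk _ _)).add_left
        (factorHom_commute hjk _ _))
  have ht : LocallyNilpotent ((factorHom i E * factorHom j Kinv + factorHom j E) * factorHom k F) :=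
    (LocallyNilpotent.factorHom_F k).mul_right
      (((factorHom_commute hik _ _).mul_left (factorHom_commute hjk _ _)).add_left
        (factorHom_commute hjk _ _))
  -- The two summands q-commute because K_j E_j = q² E_j K_j.
  have s1 : qExp ((factorHom i E * factorHom j K + factorHom j E) * factorHom k F) =
      qExp (factorHom i E * factorHom j K * factorHom k F) * quasiR j k := by
    rw [add_mul, quasiR]
    rw [add_mul] at hs
    refine qExp_add hy hx hs ?_
    rw [mul_mul_mul_of_commute (factorHom_commute hjk.symm _ _),
      mul_mul_mul_of_commute ((factorHom_commute hik.symm _ _).mul_right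
        (factorHom_commute hjk.symm _ _)), ← smul_mul_assoc, mul_assoc _ (factorHom j K), rj.k_e,
      mul_smul_comm, ← mul_assoc (factorHom i E), (factorHom_commute hij E E).eq,
      mul_assoc (factorHom j E)]
  have s2 : qExp ((factorHom i E * factorHom j Kinv + factorHom j E) * factorHom k F) =
      quasiR j k * qExp (factorHom i E * factorHom j Kinv * factorHom k F) := by
    rw [add_mul, add_comm, quasiR]
    rw [add_mul, add_comm] at ht
    refine qExp_add hx hz ht ?_
    rw [mul_mul_mul_of_commute (factorHom_commute hjk.symm _ _),
      mul_mul_mul_of_commute ((factorHom_commute hik.symm _ _).mul_right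
        (factorHom_commute hjk.symm _ _)), ← smul_mul_assoc, mul_assoc _ (factorHom j Kinv),
      rj.k'_e q_ne_zero, mul_smul_comm, smul_smul, mul_inv_cancel₀ (pow_ne_zero 2 q_ne_zero),
      one_smul, ← mul_assoc (factorHom i E), (factorHom_commute hij E E).eq]
    simp only [mul_assoc]
  have s3 : quasiR i j * qExp ((factorHom i E * factorHom j K + factorHom j E) * factorHom k F) =
      qExp ((factorHom i E * factorHom j Kinv + factorHom j E) * factorHom k F) * quasiR i j := by
    refine qExp_intertwine hs ht ?_
    have hc : Commute (quasiR i j) (factorHom k F) :=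
      qExp_commute (locallyNilpotent_E_mul_F hij)
        ((factorHom_commute hik _ _).mul_left (factorHom_commute hjk _ _))
    rw [← mul_assoc, quasiR_mul_coprod_E hij, mul_assoc, hc.eq, mul_assoc]
  -- The diagonal part on j, k turns F_k into F_k K_j⁻¹, which removes the factor K_j.
  have d1 : (diagPart j k : Completion n) * qExp (factorHom i E * factorHom j K * factorHom k F) =
      quasiR i k * diagPart j k := by
    refine qExp_intertwine hy (locallyNilpotent_E_mul_F hik) ?_
    rw [← mul_assoc, ← mul_assoc, (diagPart_commute_factorHom hij.symm hik.symm E).eq,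
      mul_assoc (factorHom i E), (diagPart_commute_K j k j).eq, mul_assoc, mul_assoc, mul_assoc,
      diagPart_symm j k, diagPart_mul_F hjk.symm, ← mul_assoc (factorHom j K),
      ← mul_assoc (factorHom j K), (factorHom_commute hjk K F).eq, mul_assoc (factorHom k F),
      rj.k_k', mul_one]
  have d2 : (diagPart i j : Completion n) * qExp (factorHom i E * factorHom j Kinv * factorHom k F)
      = quasiR i k * diagPart i j := by
    refine qExp_intertwine hz (locallyNilpotent_E_mul_F hik) ?_
    rw [← mul_assoc, ← mul_assoc, diagPart_mul_E hij, mul_assoc _ _ (factorHom j Kinv),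
      (diagPart_commute_Kinv i j j).eq, ← mul_assoc, mul_assoc (factorHom i E), rj.k_k', mul_one,
      mul_assoc, mul_assoc, (diagPart_commute_factorHom hik hjk F).eq]
  have d3 : quasiR i j * ((diagPart i k : Completion n) * diagPart j k) =
      diagPart i k * diagPart j k * quasiR i j :=
    (qExp_commute (locallyNilpotent_E_mul_F hij)
      (diagPart_mul_diagPart_commute_E_mul_F hij hik hjk).symm).eq
  have d4 : quasiR j k * ((diagPart i k : Completion n) * diagPart i j) =
      diagPart i k * diagPart i j * quasiR j k := by
    have := (qExp_commute (locallyNilpotent_E_mul_F hjk)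
      (diagPart_mul_diagPart_commute_E_mul_F hjk hij.symm hik.symm).symm).eq
    rw [diagPart_symm j i, diagPart_symm k i] at this
    have hc : (diagPart i k : Completion n) * diagPart i j = diagPart i j * diagPart i k :=
      congrArg Units.val (diagPart_commute i k i j).eq
    rw [hc]
    exact this
  have hc1 : (diagPart i j : Completion n) * (diagPart i k * diagPart j k) =
      diagPart j k * (diagPart i k * diagPart i j) := by
    have e1 : (diagPart i k : Completion n) * diagPart j k = diagPart j k * diagPart i k :=
      congrArg Units.val (diagPart_commute i k j k).eq
    have e2 : (diagPart i j : Completion n) * diagPart j k = diagPart j k * diagPart i j :=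
      congrArg Units.val (diagPart_commute i j j k).eq
    have e3 : (diagPart i j : Completion n) * diagPart i k = diagPart i k * diagPart i j :=
      congrArg Units.val (diagPart_commute i j i k).eq
    rw [e1, ← mul_assoc, e2, mul_assoc, e3]
  calc rMatrix i j * rMatrix i k * rMatrix j k
      = diagPart i j * quasiR i j * diagPart i k * (quasiR i k * diagPart j k) * quasiR j k := by
        simp only [rMatrix, mul_assoc]
    _ = diagPart i j * (quasiR i j * (diagPart i k * diagPart j k)) *
          (qExp (factorHom i E * factorHom j K * factorHom k F) * quasiR j k) := by
        rw [← d1]; simp only [mul_assoc]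
    _ = diagPart i j * (diagPart i k * diagPart j k) * (quasiR i j *
          qExp ((factorHom i E * factorHom j K + factorHom j E) * factorHom k F)) := by
        rw [d3, s1]; simp only [mul_assoc]
    _ = diagPart j k * (diagPart i k * diagPart i j * quasiR j k) *
          (qExp (factorHom i E * factorHom j Kinv * factorHom k F) * quasiR i j) := by
        rw [s3, s2, hc1]; simp only [mul_assoc]
    _ = diagPart j k * quasiR j k * diagPart i k * (diagPart i j *
          qExp (factorHom i E * factorHom j Kinv * factorHom k F)) * quasiR i j := by
        rw [← d4]; simp only [mul_assoc]
    _ = rMatrix j k * rMatrix i k * rMatrix i j := by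
        rw [d2]; simp only [rMatrix, mul_assoc]

end RMatrix

/-! ### The braiding automorphisms of the completion -/

theorem casimirOf_commute {𝕜 C : Type*} [Field 𝕜] [Ring C] [Algebra 𝕜 C] {q : 𝕜} {e f k k' : C}
    (h : UqRelations q e f k k') (hq : q ≠ 0) (hq3 : q ^ 2 - 1 ≠ 0) :
    Commute (casimirOf q e f k k') e ∧ Commute (casimirOf q e f k k') f ∧
      Commute (casimirOf q e f k k') k := by
  refine ⟨?_, ?_, ?_⟩ <;>
  · simp only [Commute, SemiconjBy, casimirOf, mul_add, add_mul, mul_assoc, smul_mul_assoc,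
      mul_smul_comm, mul_one, one_mul, sub_mul, mul_sub, smul_add, smul_sub, smul_smul,
      h.k_k', h.k'_k, h.e_k hq, h.e_k' hq, h.k_f, h.k'_f hq, h.e_f',
      assoc_rule h.k_k', assoc_rule h.k'_k, assoc_rule (h.e_k hq), assoc_rule (h.e_k' hq),
      assoc_rule h.k_f, assoc_rule (h.k'_f hq), assoc_rule h.e_f']
    try (match_scalars <;> (try field_simp) <;> (try ring))

/-- Conjugation by units, as algebra automorphisms. -/
def conjEquiv {C : Type*} [Ring C] [Algebra Kq C] : Cˣ →* (C ≃ₐ[Kq] C) :=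
  (MulSemiringAction.toAlgAut (ConjAct Cˣ) Kq C).comp ConjAct.toConjAct.toMonoidHom

theorem conjEquiv_apply {C : Type*} [Ring C] [Algebra Kq C] (u : Cˣ) (x : C) :
    conjEquiv u x = u * x * (u⁻¹ : Cˣ) := rfl

section Braiding

variable {n : ℕ}

theorem left_ne_right (i : Fin (n - 1)) : left i ≠ right i := by simp [left, right]

/-- The `R`-matrix as a unit. -/
def rUnit {i j : Fin n} (h : i ≠ j) : (Completion n)ˣ := (rMatrix_isUnit h).unit

theorem val_rUnit {i j : Fin n} (h : i ≠ j) : (rUnit h : Completion n) = rMatrix i j := rfl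

/-- The action of a generator of the braid group: conjugation by the `R`-matrix followed by the
flip. -/
def braidEquiv (i : Fin (n - 1)) : Completion n ≃ₐ[Kq] Completion n :=
  permEquiv (Equiv.swap (left i) (right i)) * conjEquiv (rUnit (left_ne_right i))

/-- This moves all permutations to the left of all conjugations, so that relations among the β_i
split into relations among permutations and relations among R-matrices. -/
theorem permEquiv_mul_conjEquiv (π : Equiv.Perm (Fin n)) {i j : Fin n} (h : i ≠ j) :
    permEquiv π * conjEquiv (rUnit h) =
      conjEquiv (rUnit (π.injective.ne h)) * permEquiv π := by
  ext1 X
  simp only [AlgEquiv.mul_apply, conjEquiv_apply, permEquiv_apply, map_mul, val_rUnit,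
    permHom_rMatrix π h]
  congr 1
  have h1 : permHom π (rMatrix i j) * permHom π ((rUnit h)⁻¹ : (Completion n)ˣ) = 1 := by
    rw [← map_mul, ← val_rUnit h, Units.mul_inv, map_one]
  rw [permHom_rMatrix π h, ← val_rUnit (π.injective.ne h)] at h1
  exact (Units.inv_eq_of_mul_eq_one_right h1).symm

theorem rUnit_yang_baxter {i j k : Fin n} (hij : i ≠ j) (hik : i ≠ k) (hjk : j ≠ k) :
    rUnit hij * rUnit hik * rUnit hjk = rUnit hjk * rUnit hik * rUnit hij :=
  Units.ext (yang_baxter hij hik hjk)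

theorem rUnit_congr {i j i' j' : Fin n} (h : i ≠ j) (hi : i = i') (hj : j = j') :
    rUnit h = rUnit (hi ▸ hj ▸ h : i' ≠ j') := by
  subst hi hj
  rfl

theorem diagPart_commute_E_mul_F {i j k l : Fin n} (hik : i ≠ k) (hil : i ≠ l) (hjk : j ≠ k)
    (hjl : j ≠ l) : Commute (diagPart i j : Completion n) (factorHom k E * factorHom l F) :=
  (diagPart_commute_factorHom hik hjk E).mul_right (diagPart_commute_factorHom hil hjl F)

theorem rMatrix_commute {i j k l : Fin n} (hij : i ≠ j) (hkl : k ≠ l) (hik : i ≠ k) (hil : i ≠ l)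
    (hjk : j ≠ k) (hjl : j ≠ l) : Commute (rMatrix i j) (rMatrix k l) := by
  have h1 : Commute (diagPart i j : Completion n) (quasiR k l) :=
    (qExp_commute (locallyNilpotent_E_mul_F hkl)
      (diagPart_commute_E_mul_F hik hil hjk hjl).symm).symm
  have h2 : Commute (quasiR i j) (diagPart k l : Completion n) :=
    qExp_commute (locallyNilpotent_E_mul_F hij)
      (diagPart_commute_E_mul_F hik.symm hjk.symm hil.symm hjl.symm).symm
  have h3 : Commute (quasiR i j) (quasiR k l) := by
    refine qExp_commute (locallyNilpotent_E_mul_F hij) (qExp_commute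
      (locallyNilpotent_E_mul_F hkl) ?_).symm
    exact ((factorHom_commute hik.symm E E).mul_right (factorHom_commute hjk.symm E F)).mul_left
      ((factorHom_commute hil.symm F E).mul_right (factorHom_commute hjl.symm F F))
  have h4 : Commute (diagPart i j : Completion n) (diagPart k l) :=
    congrArg Units.val (diagPart_commute i j k l).eq
  exact (h4.mul_right h1).mul_left (h2.mul_right h3)

theorem braidEquiv_commute {i j : Fin (n - 1)} (h : (i : ℕ) + 1 < j) :
    braidEquiv i * braidEquiv j = braidEquiv j * braidEquiv i := by
  have h1 : left i ≠ left j := by simp [left, Fin.ext_iff]; omega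
  have h2 : left i ≠ right j := by simp [left, right, Fin.ext_iff]; omega
  have h3 : right i ≠ left j := by simp [left, right, Fin.ext_iff]; omega
  have h4 : right i ≠ right j := by simp [right, Fin.ext_iff]; omega
  have hi := left_ne_right i
  have hj := left_ne_right j
  have key : ∀ (i j : Fin (n - 1)), left i ≠ left j → left i ≠ right j → right i ≠ left j →
      right i ≠ right j → braidEquiv i * braidEquiv j =
        permEquiv (Equiv.swap (left i) (right i) * Equiv.swap (left j) (right j)) *
          conjEquiv (rUnit (left_ne_right i) * rUnit (left_ne_right j)) := by
    intro i j h1 h2 h3 h4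
    have e := permEquiv_mul_conjEquiv (Equiv.swap (left j) (right j)) (left_ne_right i)
    rw [rUnit_congr (Equiv.injective _ |>.ne (left_ne_right i))
      (Equiv.swap_apply_of_ne_of_ne h1 h2) (Equiv.swap_apply_of_ne_of_ne h3 h4)] at e
    rw [braidEquiv, braidEquiv, mul_assoc, ← mul_assoc (conjEquiv _), ← e, permEquiv_mul, map_mul]
    simp only [mul_assoc]
  rw [key i j h1 h2 h3 h4, key j i h1.symm h3.symm h2.symm h4.symm]
  have hc : rUnit hi * rUnit hj = rUnit hj * rUnit hi :=
    Units.ext (rMatrix_commute hi hj h1 h2 h3 h4).eq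
  rw [hc]
  congr 2
  exact (Equiv.Perm.disjoint_iff_disjoint_support.mpr (by
    rw [Equiv.Perm.support_swap hi, Equiv.Perm.support_swap hj]
    simp [h1, h2, h3, h4, h1.symm, h2.symm, h3.symm, h4.symm])).commute.eq

theorem swap_braid {α : Type*} [DecidableEq α] {x y z : α} (hxy : x ≠ y) (hxz : x ≠ z)
    (hyz : y ≠ z) :
    Equiv.swap x y * Equiv.swap y z * Equiv.swap x y =
      Equiv.swap y z * Equiv.swap x y * Equiv.swap y z := by
  have h1 := Equiv.swap_mul_swap_mul_swap hyz.symm hxz.symm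
  rw [Equiv.swap_comm y x, Equiv.swap_comm z y] at h1
  rw [h1, Equiv.swap_mul_swap_mul_swap hxy hxz, Equiv.swap_comm]

/-- With the permutations collected on the left, the conjugating elements are R_yz R_xz R_xy on one
side and R_xy R_xz R_yz on the other; these agree by Yang–Baxter. -/
theorem braidEquiv_braid {i j : Fin (n - 1)} (h : (i : ℕ) + 1 = j) :
    braidEquiv i * braidEquiv j * braidEquiv i = braidEquiv j * braidEquiv i * braidEquiv j := by
  have hx : right i = left j := by simp [left, right, Fin.ext_iff, h]
  obtain ⟨x, hxd⟩ : ∃ x, x = left i := ⟨_, rfl⟩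
  obtain ⟨y, hyd⟩ : ∃ y, y = left j := ⟨_, rfl⟩
  obtain ⟨z, hzd⟩ : ∃ z, z = right j := ⟨_, rfl⟩
  have hxy : x ≠ y := by rw [hxd, hyd]; simp [left, Fin.ext_iff]; omega
  have hxz : x ≠ z := by rw [hxd, hzd]; simp [left, right, Fin.ext_iff]; omega
  have hyz : y ≠ z := by rw [hyd, hzd]; exact left_ne_right j
  have ei : braidEquiv i = permEquiv (Equiv.swap x y) * conjEquiv (rUnit hxy) := by
    simp only [braidEquiv, hxd, hyd, ← hx]
  have ej : braidEquiv j = permEquiv (Equiv.swap y z) * conjEquiv (rUnit hyz) := by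
    simp only [braidEquiv, hyd, hzd]
  have m1 : conjEquiv (rUnit hyz) * permEquiv (Equiv.swap x y) =
      permEquiv (Equiv.swap x y) * conjEquiv (rUnit hxz) := by
    rw [permEquiv_mul_conjEquiv, rUnit_congr (Equiv.injective _ |>.ne hxz)
      (Equiv.swap_apply_left x y) (Equiv.swap_apply_of_ne_of_ne hxz.symm hyz.symm)]
  have m2 : conjEquiv (rUnit hxy) * permEquiv (Equiv.swap y z) =
      permEquiv (Equiv.swap y z) * conjEquiv (rUnit hxz) := by
    rw [permEquiv_mul_conjEquiv, rUnit_congr (Equiv.injective _ |>.ne hxz)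
      (Equiv.swap_apply_of_ne_of_ne hxy hxz) (Equiv.swap_apply_right y z)]
  have m3 : conjEquiv (rUnit hxz) * permEquiv (Equiv.swap x y) =
      permEquiv (Equiv.swap x y) * conjEquiv (rUnit hyz) := by
    rw [permEquiv_mul_conjEquiv, rUnit_congr (Equiv.injective _ |>.ne hyz)
      (Equiv.swap_apply_right x y) (Equiv.swap_apply_of_ne_of_ne hxz.symm hyz.symm)]
  have m4 : conjEquiv (rUnit hxz) * permEquiv (Equiv.swap y z) =
      permEquiv (Equiv.swap y z) * conjEquiv (rUnit hxy) := by
    rw [permEquiv_mul_conjEquiv, rUnit_congr (Equiv.injective _ |>.ne hxy)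
      (Equiv.swap_apply_of_ne_of_ne hxy hxz) (Equiv.swap_apply_left y z)]
  have h1 : braidEquiv i * braidEquiv j * braidEquiv i =
      permEquiv (Equiv.swap x y * Equiv.swap y z * Equiv.swap x y) *
        conjEquiv (rUnit hyz * rUnit hxz * rUnit hxy) := by
    rw [ei, ej, permEquiv_mul, permEquiv_mul, map_mul, map_mul]
    calc _ = permEquiv (Equiv.swap x y) * (conjEquiv (rUnit hxy) * permEquiv (Equiv.swap y z)) *
          (conjEquiv (rUnit hyz) * permEquiv (Equiv.swap x y)) * conjEquiv (rUnit hxy) := by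
          simp only [mul_assoc]
      _ = permEquiv (Equiv.swap x y) * permEquiv (Equiv.swap y z) *
          (conjEquiv (rUnit hxz) * permEquiv (Equiv.swap x y)) * conjEquiv (rUnit hxz) *
          conjEquiv (rUnit hxy) := by
          rw [m1, m2]; simp only [mul_assoc]
      _ = _ := by rw [m3]; simp only [mul_assoc]
  have h2 : braidEquiv j * braidEquiv i * braidEquiv j =
      permEquiv (Equiv.swap y z * Equiv.swap x y * Equiv.swap y z) *
        conjEquiv (rUnit hxy * rUnit hxz * rUnit hyz) := by
    rw [ei, ej, permEquiv_mul, permEquiv_mul, map_mul, map_mul]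
    calc _ = permEquiv (Equiv.swap y z) * (conjEquiv (rUnit hyz) * permEquiv (Equiv.swap x y)) *
          (conjEquiv (rUnit hxy) * permEquiv (Equiv.swap y z)) * conjEquiv (rUnit hyz) := by
          simp only [mul_assoc]
      _ = permEquiv (Equiv.swap y z) * permEquiv (Equiv.swap x y) *
          (conjEquiv (rUnit hxz) * permEquiv (Equiv.swap y z)) * conjEquiv (rUnit hxz) *
          conjEquiv (rUnit hyz) := by
          rw [m1, m2]; simp only [mul_assoc]
      _ = _ := by rw [m4]; simp only [mul_assoc]
  rw [h1, h2, swap_braid hxy hxz hyz, rUnit_yang_baxter hxy hxz hyz]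

theorem braidEquiv_eq_braidOp (i : Fin (n - 1)) (X : Completion n) :
    braidEquiv i X = braidOp n i X := by
  have hθ : Ring.inverse (theta n i) = ((quasiR_isUnit (left_ne_right i)).unit⁻¹ : (Completion n)ˣ) := by
    rw [theta_eq_quasiR]
    exact Ring.inverse_unit (quasiR_isUnit (left_ne_right i)).unit
  -- The exponent of Ψ⁻¹ at the entry (a, b) is the difference of the values of `diagExponent` at a
  -- and at b, so Ψ⁻¹ is a conjugation.
  have hψ : ∀ Y : Completion n, (psi n i).symm Y =
      (diagPart (left i) (right i) : Completion n) * Y *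
        ((diagPart (left i) (right i))⁻¹ : (Completion n)ˣ) := by
    intro Y
    funext m
    ext a b
    change q ^ psiExponent i m a b * Y m a b =
      ((Matrix.diagonal fun a => q ^ diagExponent (left i) (right i) m a) * Y m *
        Matrix.diagonal fun a => q ^ (-diagExponent (left i) (right i) m a)) a b
    rw [Matrix.mul_diagonal, Matrix.diagonal_mul, mul_right_comm, ← zpow_add₀ q_ne_zero]
    congr 2
    simp only [psiExponent, diagExponent, weight]
    ring
  have hr : (rUnit (left_ne_right i)) = diagPart (left i) (right i) *
      (quasiR_isUnit (left_ne_right i)).unit := Units.ext rfl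
  rw [braidOp, hθ, hψ, braidEquiv, AlgEquiv.mul_apply, conjEquiv_apply, hr, mul_inv_rev,
    Units.val_mul, Units.val_mul, theta_eq_quasiR, IsUnit.unit_spec]
  simp only [mul_assoc]
  rfl

/-- This computes β_i from an intertwining relation, without handling the inverse of the R-matrix.
-/
theorem permHom_of_rMatrix_mul {i : Fin (n - 1)} {X Y : Completion n}
    (h : rMatrix (left i) (right i) * X = Y * rMatrix (left i) (right i)) :
    braidEquiv i X = permHom (Equiv.swap (left i) (right i)) Y := by
  rw [braidEquiv, AlgEquiv.mul_apply, conjEquiv_apply, val_rUnit, h, mul_assoc, ← val_rUnit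
    (left_ne_right i), Units.mul_inv, mul_one, permEquiv_apply]

theorem braidEquiv_factorHom {i : Fin (n - 1)} {j : Fin n} (hl : j ≠ left i) (hr : j ≠ right i)
    (x : Uq) : braidEquiv i (factorHom j x) = factorHom j x := by
  rw [permHom_of_rMatrix_mul (Y := factorHom j x), permHom_factorHom,
    Equiv.swap_apply_of_ne_of_ne hl hr]
  have h1 : Commute (quasiR (left i) (right i)) (factorHom j x) :=
    qExp_commute (locallyNilpotent_E_mul_F (left_ne_right i))
      ((factorHom_commute hl.symm _ _).mul_left (factorHom_commute hr.symm _ _))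
  exact ((diagPart_commute_factorHom hl.symm hr.symm x).mul_left h1).eq

theorem rMatrix_mul_of_quasiR_mul {i j : Fin n} {X Y Z : Completion n}
    (h1 : quasiR i j * X = Y * quasiR i j)
    (h2 : (diagPart i j : Completion n) * Y = Z * diagPart i j) :
    rMatrix i j * X = Z * rMatrix i j := by
  rw [rMatrix, mul_assoc, h1, ← mul_assoc, h2, mul_assoc]

theorem diagPart_mul_F' {i j : Fin n} (h : i ≠ j) :
    (diagPart i j : Completion n) * factorHom j F =
      factorHom j F * factorHom i Kinv * diagPart i j := by
  rw [diagPart_symm, diagPart_mul_F h.symm]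

theorem diagPart_mul_E' {i j : Fin n} (h : i ≠ j) :
    (diagPart i j : Completion n) * factorHom j E =
      factorHom j E * factorHom i K * diagPart i j := by
  rw [diagPart_symm, diagPart_mul_E h.symm]

theorem map_casimirOf {A B : Type*} [Ring A] [Algebra Kq A] [Ring B] [Algebra Kq B]
    (φ : A →ₐ[Kq] B) (e f k k' : A) :
    φ (casimirOf q e f k k') = casimirOf q (φ e) (φ f) (φ k) (φ k') := by
  simp only [casimirOf, map_add, map_smul, map_mul]

/-- In FE the factors K_j and K_j⁻¹ created by E and F cancel. -/
theorem diagPart_commute_casimirOf {i j : Fin n} (h : i ≠ j) :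
    Commute (diagPart i j : Completion n)
      (casimirOf q (factorHom i E) (factorHom i F) (factorHom i K) (factorHom i Kinv)) := by
  refine ((Commute.smul_right ?_ _).add_right ((diagPart_commute_K i j i).smul_right _)).add_right
    ((diagPart_commute_Kinv i j i).smul_right _)
  have h6 : factorHom j Kinv * factorHom j K = 1 := by
    rw [← map_mul, Uq.relations.k'_k, map_one]
  change _ * (_ * _) = _ * _ * _
  rw [← mul_assoc, diagPart_mul_F h, mul_assoc, diagPart_mul_E h, mul_assoc (factorHom i F),
    ← mul_assoc (factorHom j Kinv), ← mul_assoc (factorHom j Kinv),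
    (factorHom_commute h.symm Kinv E).eq, mul_assoc (factorHom i E), h6, mul_one, mul_assoc]

theorem UqPair.conj_normal_form {𝕜 C : Type*} [Field 𝕜] [Ring C] [Algebra 𝕜 C] {q : 𝕜}
    {e f k k' e₂ f₂ k₂ k₂' : C} (h : UqPair q e f k k' e₂ f₂ k₂ k₂') (hq : q ≠ 0) :
    k₂ * (e₂ * k * (f * k₂')) = f * (k * e₂) := by
  rw [h.e_k, mul_assoc k, ← mul_assoc e₂, h.e_f, mul_assoc f, h.snd.e_k' hq, ← mul_assoc k,
    h.fst.k_f, smul_mul_assoc, mul_smul_comm, mul_smul_comm, mul_smul_comm, smul_smul,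
    inv_mul_cancel₀ (pow_ne_zero 2 hq), one_smul, ← mul_assoc, ← mul_assoc k₂ f, h.k_f,
    mul_assoc f, h.k_k, ← mul_assoc f, mul_assoc (f * k), ← mul_assoc k₂, h.snd.k_k', one_mul,
    mul_assoc]

/-- Each value is found by passing Θ, then D, then the flip. E ⊗ 1, 1 ⊗ F, K ⊗ K and the Casimirs
commute with E ⊗ F; K ⊗ 1 uses the q-difference equation; Δ(E) and Δ(F) use the intertwining
property of Θ. -/
theorem isBraiding_braidEquiv (i : Fin (n - 1)) :
    IsBraiding q (factorHom (left i) E) (factorHom (left i) F) (factorHom (left i) K)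
      (factorHom (left i) Kinv) (factorHom (right i) E) (factorHom (right i) F)
      (factorHom (right i) K) (factorHom (right i) Kinv)
      (braidEquiv i : Completion n →ₐ[Kq] Completion n) := by
  have h := left_ne_right i
  have hq := q_ne_zero
  have hq3 : q ^ 2 - 1 ≠ 0 := sub_ne_zero.mpr q_sq_ne_one
  have hp := factorHom_pair h
  have hp' := factorHom_pair h.symm
  have hn := locallyNilpotent_E_mul_F h
  have πl : ∀ x, permHom (Equiv.swap (left i) (right i)) (factorHom (left i) x) =
      factorHom (right i) x := fun x => by rw [permHom_factorHom, Equiv.swap_apply_left]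
  have πr : ∀ x, permHom (Equiv.swap (left i) (right i)) (factorHom (right i) x) =
      factorHom (left i) x := fun x => by rw [permHom_factorHom, Equiv.swap_apply_right]
  constructor
  · refine (permHom_of_rMatrix_mul (rMatrix_mul_of_quasiR_mul (qExp_commute hn ?_).eq
      (diagPart_mul_E h))).trans ?_
    · exact (Commute.refl _).mul_left (factorHom_commute h.symm _ _)
    · rw [map_mul, πl, πr, (factorHom_commute h.symm _ _).eq]
  · refine (permHom_of_rMatrix_mul (rMatrix_mul_of_quasiR_mul (qExp_commute hn ?_).eq
      (diagPart_mul_F' h))).trans ?_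
    · exact (factorHom_commute h _ _).mul_left (Commute.refl _)
    · rw [map_mul, πl, πr]
  · refine (permHom_of_rMatrix_mul (rMatrix_mul_of_quasiR_mul
      (Z := factorHom (left i) K * (1 - (q⁻¹ * (q - q⁻¹) ^ 2) • (factorHom (left i) E *
        factorHom (right i) K * (factorHom (right i) F * factorHom (left i) Kinv))))
      (qExp_mul_of_qCommute hn ?_) ?_)).trans ?_
    · rw [← mul_assoc, hp.fst.k_e, smul_mul_assoc, mul_assoc, ← hp.f_k, mul_assoc]
    · rw [← mul_assoc, (diagPart_commute_K _ _ _).eq, mul_assoc, mul_assoc, mul_sub, sub_mul,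
        mul_one, one_mul, mul_smul_comm, smul_mul_assoc, ← mul_assoc _ (factorHom (left i) E),
        diagPart_mul_E h, mul_assoc _ _ (factorHom (right i) F), diagPart_mul_F' h]
      simp only [mul_assoc]
    · simp only [map_mul, map_sub, map_one, map_smul, πl, πr]
      rw [mul_sub, mul_one, mul_smul_comm, hp.conj_normal_form hq]
  · refine (permHom_of_rMatrix_mul (rMatrix_mul_of_quasiR_mul (qExp_commute hn ?_).eq
      (((diagPart_commute_K _ _ _).mul_right (diagPart_commute_K _ _ _)).eq))).trans ?_
    · have e1 := hp.fst.k_e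
      have e2 := hp.snd.k_f
      change _ * _ = _ * _
      symm
      rw [mul_assoc, ← mul_assoc (factorHom (right i) K), hp.k_e, mul_assoc (factorHom (left i) E),
        e2, ← mul_assoc, e1]
      rw [smul_mul_assoc, mul_smul_comm, smul_smul, mul_inv_cancel₀
        (pow_ne_zero 2 hq), one_smul, mul_assoc, ← mul_assoc (factorHom (left i) K), ← hp.f_k]
      simp only [mul_assoc]
    · rw [map_mul, πl, πr, hp.k_k]
  -- D turns the bar-conjugate of Δ(E) into the opposite coproduct, which the flip carries back to
  -- Δ(E).
  · refine (permHom_of_rMatrix_mul (rMatrix_mul_of_quasiR_mul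
      (Z := factorHom (left i) E + factorHom (right i) E * factorHom (left i) K)
      (quasiR_mul_coprod_E h) ?_)).trans ?_
    · rw [mul_add, ← mul_assoc, diagPart_mul_E h, diagPart_mul_E' h, mul_assoc _ _
        (factorHom (right i) Kinv), (diagPart_commute_Kinv _ _ _).eq, ← mul_assoc,
        mul_assoc _ (factorHom (right i) K), hp.snd.k_k', mul_one, add_mul]
    · rw [map_add, map_mul, πl, πr, πl, add_comm]
  · refine (permHom_of_rMatrix_mul (rMatrix_mul_of_quasiR_mul
      (Z := factorHom (left i) F * factorHom (right i) Kinv + factorHom (right i) F)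
      (quasiR_mul_coprod_F h) ?_)).trans ?_
    · rw [mul_add, ← mul_assoc, diagPart_mul_F h, (diagPart_commute_K _ _ _).eq,
        mul_assoc (factorHom (left i) K), diagPart_mul_F' h, hp.f_k', ← mul_assoc, ← mul_assoc,
        hp.fst.k_k', one_mul, add_mul]
    · rw [map_add, map_mul, πl, πr, πr, add_comm, hp.f_k']
  · obtain ⟨c1, c2, c3⟩ := casimirOf_commute hp.fst hq hq3
    refine (permHom_of_rMatrix_mul (rMatrix_mul_of_quasiR_mul (qExp_commute hn ?_).eq
      (diagPart_commute_casimirOf h).eq)).trans ?_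
    · refine c1.symm.mul_left ?_
      rw [← map_casimirOf (factorHom (left i))]
      exact factorHom_commute h.symm _ _
    · rw [map_casimirOf, πl, πl, πl, πl]
  · obtain ⟨c1, c2, c3⟩ := casimirOf_commute hp.snd hq hq3
    have hd := diagPart_commute_casimirOf h.symm
    rw [diagPart_symm] at hd
    refine (permHom_of_rMatrix_mul (rMatrix_mul_of_quasiR_mul (qExp_commute hn ?_).eq
      hd.eq)).trans ?_
    · refine Commute.mul_left ?_ c2.symm
      rw [← map_casimirOf (factorHom (right i))]
      exact factorHom_commute h _ _
    · rw [map_casimirOf, πr, πr, πr, πr]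

end Braiding

/-! ### Casimir elements as transfer products -/

section Transfer

variable {C : Type*} [Ring C] [Algebra Kq C]

/-- The vector of values of the counit. -/
def counitVec : ILVec C := ⟨0, 0, 1, (q + q⁻¹) • 1⟩

/-- One step of the transfer product: the comultiplication if `j ∈ A`, and `τ_L` otherwise, with the
first tensor factor acting through `ι j`. -/
def transferStep (ι : ℕ → Uq →ₐ[Kq] C) (A : Finset ℕ) (j : ℕ) (v : ILVec C) : ILVec C :=
  if j ∈ A then comulStep q (ι j E) (ι j F) (ι j K) (ι j Kinv) v
  else tauStep q (ι j F) (ι j K) (ι j Kinv) v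

/-- The transfer product over the `k` factors starting with the factor `j`. -/
def transfer (ι : ℕ → Uq →ₐ[Kq] C) (A : Finset ℕ) : ℕ → ℕ → ILVec C
  | 0, _ => counitVec
  | k + 1, j => transferStep ι A j (transfer ι A k (j + 1))

variable (ι : ℕ → Uq →ₐ[Kq] C)

/-- The value q + q⁻¹ of the counit at Λ makes the two terms with F in τ_L(FK) cancel. -/
theorem tauStep_counitVec (f k k' : C) : tauStep q f k k' counitVec = counitVec := by
  have hq := q_ne_zero
  simp only [tauStep, counitVec, mul_zero, mul_smul_comm, mul_one, smul_smul, smul_zero, sub_zero,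
    zero_sub, neg_add_cancel]

theorem comulStep_counitVec (e f k k' : C) :
    comulStep q e f k k' counitVec = ⟨e, f * k, k, casimirOf q e f k k'⟩ := by
  ext
  · simp only [comulStep, counitVec, mul_one, add_zero]
  · simp only [comulStep, counitVec, mul_one, add_zero]
  · simp only [comulStep, counitVec, mul_one]
  · simp only [comulStep, counitVec, casimirOf, mul_one, mul_zero, smul_zero, add_zero,
      mul_smul_comm, add_smul, mul_add]
    abel

theorem transfer_eq_counitVec {A : Finset ℕ} {k j : ℕ} (h : ∀ l ∈ A, l < j) :
    transfer ι A k j = counitVec := by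
  induction k generalizing j with
  | zero => rfl
  | succ k ih =>
    rw [transfer, transferStep, if_neg (fun hj => (h j hj).false), ih fun l hl => (h l hl).trans
      (Nat.lt_succ_self j), tauStep_counitVec]

/-- The linear map `x_1 ⊗ ⋯ ⊗ x_j ↦ ι_1 x_1 ⋯ ι_j x_j`. -/
def prodMap (j : ℕ) : (⨂[Kq]^j Uq) →ₗ[Kq] C :=
  PiTensorProduct.lift ((MultilinearMap.mkPiAlgebraFin Kq j C).compLinearMap
    fun i => (ι i).toLinearMap)

theorem prodMap_tprod (j : ℕ) (x : Fin j → Uq) :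
    prodMap ι j (PiTensorProduct.tprod Kq x) = (List.ofFn fun i : Fin j => ι i (x i)).prod := by
  rw [prodMap, PiTensorProduct.lift.tprod, MultilinearMap.compLinearMap_apply,
    MultilinearMap.mkPiAlgebraFin_apply]
  rfl

theorem snoc_tprod (j : ℕ) (x : Fin j → Uq) (y : Uq) :
    snoc j (PiTensorProduct.tprod Kq x ⊗ₜ y) =
      PiTensorProduct.tprod Kq (Fin.snoc (α := fun _ => Uq) x y) := by
  have h : (PiTensorProduct.subsingletonEquiv (R := Kq) (s := fun _ : Fin 1 => Uq) 0).symm y =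
      PiTensorProduct.tprod Kq fun _ => y := by
    rw [LinearEquiv.symm_apply_eq, PiTensorProduct.subsingletonEquiv_apply_tprod]
  rw [snoc, LinearEquiv.trans_apply, TensorProduct.congr_tmul, h, LinearEquiv.refl_apply]
  have := TensorPower.tprod_mul_tprod Kq x fun _ : Fin 1 => y
  rw [Fin.append_right_eq_snoc] at this
  exact this

theorem prodMap_snoc (j : ℕ) (u : ⨂[Kq]^j Uq) (y : Uq) :
    prodMap ι (j + 1) (snoc j (u ⊗ₜ y)) = prodMap ι j u * ι j y := by
  induction u using PiTensorProduct.induction_on with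
  | smul_tprod r x =>
    rw [← TensorProduct.smul_tmul', map_smul, map_smul, map_smul, smul_mul_assoc, snoc_tprod,
      prodMap_tprod, prodMap_tprod, List.ofFn_succ', List.concat_eq_append, List.prod_append]
    simp
  | add x z hx hz => rw [TensorProduct.add_tmul, map_add, map_add, hx, hz, map_add, add_mul]

/-! ### Comparison of the iterated coactions with the transfer products. -/

theorem comulIL_E : comulIL genE = E ⊗ₜ genK + 1 ⊗ₜ genE :=
  inclIL_injective (by
    rw [inclIL_comulIL]
    simp [inclIL_tmul, genK, genE, comul, lift_E])

theorem comulIL_FK : comulIL genFK = (F * K) ⊗ₜ genK + 1 ⊗ₜ genFK :=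
  inclIL_injective (by
    rw [inclIL_comulIL]
    simp [inclIL_tmul, genK, genFK, comul, lift_F, lift_K, add_mul, Uq.relations.k'_k])

theorem comulIL_K : comulIL genK = K ⊗ₜ genK :=
  inclIL_injective (by
    rw [inclIL_comulIL]
    simp [inclIL_tmul, genK, comul, lift_K])

theorem comulIL_casimir : comulIL genCasimir =
    (q - q⁻¹) ^ 2 • ((F * E) ⊗ₜ genK) + (q - q⁻¹) ^ 2 • (F ⊗ₜ genE)
      + (q - q⁻¹) ^ 2 • ((Kinv * E) ⊗ₜ genFK) + Kinv ⊗ₜ genCasimir - q • (Kinv ⊗ₜ genK)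
      + q • (K ⊗ₜ genK) :=
  inclIL_injective (by
    rw [inclIL_comulIL]
    change comul casimir = _
    simp only [map_add, map_sub, map_smul, inclIL_tmul, genK, genE, genFK, genCasimir]
    simp only [casimir, map_add, map_smul, map_mul, comul, lift_E, lift_F, lift_K, lift_Kinv,
      add_mul, mul_add, Algebra.TensorProduct.tmul_mul_tmul, one_mul, mul_one,
      TensorProduct.tmul_add, TensorProduct.tmul_smul, smul_add]
    abel)

/-- The element of `U^{⊗j} ⊗ I_L` with given coefficients of `E`, `F K`, `K`, `Λ`. -/
def combine (j : ℕ) (p : ILVec (⨂[Kq]^j Uq)) : (⨂[Kq]^j Uq) ⊗[Kq] IL :=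
  p.e ⊗ₜ genE + p.fk ⊗ₜ genFK + p.k ⊗ₜ genK + p.l ⊗ₜ genCasimir

/-- The pairing of the coefficients of `E`, `F K`, `K`, `Λ` with a vector of values. -/
def pairing (j : ℕ) (p : ILVec (⨂[Kq]^j Uq)) (v : ILVec C) : C :=
  prodMap ι j p.e * v.e + prodMap ι j p.fk * v.fk + prodMap ι j p.k * v.k + prodMap ι j p.l * v.l

theorem step_tmul (α : IL →ₐ[Kq] Uq ⊗[Kq] IL) (j : ℕ) (u : ⨂[Kq]^j Uq) (x : IL) :
    step α j (u ⊗ₜ x) = (snoc j).toLinearMap.rTensor IL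
      ((TensorProduct.assoc Kq (⨂[Kq]^j Uq) Uq IL).symm (u ⊗ₜ α x)) := rfl

theorem snoc_assoc_tmul (j : ℕ) (u : ⨂[Kq]^j Uq) (y : Uq) (z : IL) :
    (snoc j).toLinearMap.rTensor IL
      ((TensorProduct.assoc Kq (⨂[Kq]^j Uq) Uq IL).symm (u ⊗ₜ (y ⊗ₜ z))) =
        snoc j (u ⊗ₜ y) ⊗ₜ z := rfl

/-- Applying Δ to the coefficients is adjoint to applying a Δ-step to the values. The witness
collects the coefficients of the four generators in the expansion of Δ. -/
theorem exists_combine_step_comul (j : ℕ) (p : ILVec (⨂[Kq]^j Uq)) :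
    ∃ p', step comulIL j (combine j p) = combine (j + 1) p' ∧ ∀ v : ILVec C,
      pairing ι (j + 1) p' v =
        pairing ι j p (comulStep q (ι j E) (ι j F) (ι j K) (ι j Kinv) v) := by
  refine ⟨⟨snoc j (p.e ⊗ₜ 1) + (q - q⁻¹) ^ 2 • snoc j (p.l ⊗ₜ F),
    snoc j (p.fk ⊗ₜ 1) + (q - q⁻¹) ^ 2 • snoc j (p.l ⊗ₜ (Kinv * E)),
    snoc j (p.e ⊗ₜ E) + snoc j (p.fk ⊗ₜ (F * K)) + snoc j (p.k ⊗ₜ K)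
      + (q - q⁻¹) ^ 2 • snoc j (p.l ⊗ₜ (F * E)) - q • snoc j (p.l ⊗ₜ Kinv)
      + q • snoc j (p.l ⊗ₜ K),
    snoc j (p.l ⊗ₜ Kinv)⟩, ?_, fun v => ?_⟩
  · simp only [combine, map_add, step_tmul, comulIL_E, comulIL_FK, comulIL_K, comulIL_casimir,
      TensorProduct.tmul_add, TensorProduct.tmul_sub, TensorProduct.tmul_smul, map_smul, map_sub,
      snoc_assoc_tmul, TensorProduct.add_tmul, TensorProduct.sub_tmul, ← TensorProduct.smul_tmul']
    abel
  · simp only [pairing, comulStep, map_add, map_sub, map_smul, prodMap_snoc, map_mul, map_one,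
      mul_one, mul_add, add_mul, mul_sub, sub_mul, smul_mul_assoc, mul_smul_comm, mul_assoc]
    abel

theorem exists_combine_step_tau (j : ℕ) (p : ILVec (⨂[Kq]^j Uq)) :
    ∃ p', step tauL j (combine j p) = combine (j + 1) p' ∧ ∀ v : ILVec C,
      pairing ι (j + 1) p' v =
        pairing ι j p (tauStep q (ι j F) (ι j K) (ι j Kinv) v) := by
  refine ⟨⟨snoc j (p.e ⊗ₜ K) - (q⁻¹ * (q - q⁻¹) ^ 2) • snoc j (p.k ⊗ₜ (F * K))
      - (q⁻¹ * (q - q⁻¹) ^ 2) • snoc j (p.fk ⊗ₜ (F ^ 2 * K)),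
    snoc j (p.fk ⊗ₜ Kinv),
    snoc j (p.k ⊗ₜ 1) + (q * (q + q⁻¹)) • snoc j (p.fk ⊗ₜ F),
    snoc j (p.l ⊗ₜ 1) - q • snoc j (p.fk ⊗ₜ F)⟩, ?_, fun v => ?_⟩
  · simp only [combine, map_add, step_tmul, tauL_E, tauL_FK, tauL_K, tauL_casimir,
      TensorProduct.tmul_add, TensorProduct.tmul_sub, TensorProduct.tmul_smul, map_smul, map_sub,
      snoc_assoc_tmul, TensorProduct.add_tmul, TensorProduct.sub_tmul, ← TensorProduct.smul_tmul']
    abel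
  · simp only [pairing, tauStep, map_add, map_sub, map_smul, prodMap_snoc, map_mul, map_one,
      mul_one, mul_add, add_mul, mul_sub, sub_mul, smul_mul_assoc, mul_smul_comm, mul_assoc, pow_two]
    abel

/-- The definition of Λ_A consumes factors from the left, the transfer product from the right.
Pairing the first `j` factors, as coefficients, with the last `k`, as values, does not depend on
where the cut is made. -/
theorem exists_combine_casimirIter (A : Finset ℕ) (n j k : ℕ) (hn : j + k = n) :
    ∃ p, casimirIter A j = combine j p ∧
      pairing ι j p (transfer ι A k j) = (transfer ι A n 0).l := by
  induction j generalizing k with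
  | zero =>
    obtain rfl : k = n := by omega
    refine ⟨⟨0, 0, 0, 1⟩, ?_, ?_⟩
    · simp [combine, casimirIter]
    · have : prodMap ι 0 1 = 1 := by
        rw [PiTensorProduct.one_def, prodMap_tprod]
        rfl
      simp [pairing, this]
  | succ j ih =>
    obtain ⟨p, hp, hp'⟩ := ih (k + 1) (by omega)
    rw [transfer, transferStep] at hp'
    rw [casimirIter, hp]
    split_ifs with hj
    · rw [if_pos hj] at hp'
      obtain ⟨p', h1, h2⟩ := exists_combine_step_comul ι j p
      exact ⟨p', h1, (h2 _).trans hp'⟩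
    · rw [if_neg hj] at hp'
      obtain ⟨p', h1, h2⟩ := exists_combine_step_tau ι j p
      exact ⟨p', h1, (h2 _).trans hp'⟩

/-- Beyond the largest element of `A` only τ_L-steps occur, and they fix the counit vector; so the
length `n` of the transfer product may exceed `m`. -/
theorem prodMap_casimirSet (A : Finset ℕ) {n m : ℕ} (hA : A ⊆ Finset.range m) (hm : m ≤ n) :
    prodMap ι m (casimirSet A m) = (transfer ι A n 0).l := by
  induction m with
  | zero =>
    obtain rfl : A = ∅ := by simpa using hA
    rw [transfer_eq_counitVec ι (by simp), casimirSet, Algebra.algebraMap_eq_smul_one, map_smul,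
      PiTensorProduct.one_def, prodMap_tprod]
    rfl
  | succ m ih =>
    rw [casimirSet]
    split_ifs with hmA
    · obtain ⟨k, rfl⟩ := Nat.exists_eq_add_of_le hm
      obtain ⟨p, hp, hp'⟩ := exists_combine_casimirIter ι A (m + 1 + k) m (k + 1) (by omega)
      -- The Δ-step at the largest element acts on the counit vector and returns the generators in
      -- that factor, which is the inclusion of I_L into U.
      rw [transfer, transfer_eq_counitVec ι (fun l hl => by simpa using hA hl), transferStep,
        if_pos hmA, comulStep_counitVec] at hp'
      rw [hp, ← hp']
      simp only [combine, pairing, map_add, LinearMap.lTensor_tmul, prodMap_snoc]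
      simp only [AlgHom.toLinearMap_apply, Subalgebra.coe_val, genE, genFK, genK, genCasimir,
        map_mul, casimir, casimirOf, map_add, map_smul]
    · rw [prodMap_snoc, map_one, mul_one]
      refine ih (fun l hl => ?_) (by omega)
      have h1 := Finset.mem_range.mp (hA hl)
      have h2 : l ≠ m := fun h => hmA (h ▸ hl)
      exact Finset.mem_range.mpr (by omega)

end Transfer

/-! ### Transfer products over the tensor factors of the completion. -/

/-- The counit of `U_q(sl₂)`. -/
def counit : Uq →ₐ[Kq] Kq :=
  Uq.lift (e := 0) (f := 0) (k := 1) (k' := 1) (by constructor <;> simp)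

/-- The `j`-th tensor factor of the completion, extended to all `j` by the counit. -/
def factorExt (n j : ℕ) : Uq →ₐ[Kq] Completion n :=
  if h : j < n then factorHom ⟨j, h⟩ else (Algebra.ofId Kq (Completion n)).comp counit

theorem factorExt_of_lt {n j : ℕ} (h : j < n) : factorExt n j = factorHom ⟨j, h⟩ := dif_pos h

theorem factorExt_val {n : ℕ} (j : Fin n) : factorExt n j = factorHom j := factorExt_of_lt j.2

theorem prod_map_mulSingle {n : ℕ} (x : Fin n → Uq) (L : List (Fin n)) (hL : L.Nodup) (l : Fin n) :
    (L.map fun i => Pi.mulSingle (M := fun _ => Uq) i (x i)).prod l = if l ∈ L then x l else 1 := by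
  induction L with
  | nil => simp
  | cons i L ih =>
    rw [List.nodup_cons] at hL
    rw [List.map_cons, List.prod_cons, Pi.mul_apply, ih hL.2]
    by_cases hl : l = i
    · subst hl
      simp [hL.1]
    · simp [hl]

theorem prodMap_factorExt (n : ℕ) (u : ⨂[Kq]^n Uq) :
    prodMap (factorExt n) n u = toCompletion n u := by
  have : prodMap (factorExt n) n = (toCompletion n).toLinearMap := by
    refine PiTensorProduct.ext (MultilinearMap.ext fun x => ?_)
    rw [LinearMap.compMultilinearMap_apply, LinearMap.compMultilinearMap_apply, prodMap_tprod,
      AlgHom.toLinearMap_apply]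
    simp only [factorExt_val]
    -- A pure tensor is the product of its components, each placed in its own factor.
    have h1 : x = (List.map (fun i => Pi.mulSingle (M := fun _ => Uq) i (x i))
        (List.finRange n)).prod := by
      funext l
      rw [prod_map_mulSingle x _ (List.nodup_finRange n), if_pos (List.mem_finRange l)]
    have h2 := congrArg (fun y => toCompletion n (PiTensorProduct.tprodMonoidHom Kq y)) h1
    simp only [map_list_prod, List.map_map] at h2
    rw [List.ofFn_eq_map]
    exact h2.symm
  rw [this]
  rfl

theorem toCompletion_casimirSet {n : ℕ} {A : Finset ℕ} (hA : A ⊆ Finset.range n) :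
    toCompletion n (casimirSet A n) = (transfer (factorExt n) A n 0).l := by
  rw [← prodMap_factorExt, prodMap_casimirSet _ A hA le_rfl]

/-! ### The action of the generators on the Casimir elements -/

section Transfer

variable {C : Type*} [Ring C] [Algebra Kq C] {ι : ℕ → Uq →ₐ[Kq] C}

theorem transferStep_map {β : C →ₐ[Kq] C} {A : Finset ℕ} {j : ℕ} (h : ∀ x, β (ι j x) = ι j x)
    (v : ILVec C) : (transferStep ι A j v).map β = transferStep ι A j (v.map β) := by
  rw [transferStep, transferStep]
  split_ifs
  · simp only [ILVec.map, comulStep, map_add, map_sub, map_smul, map_mul, h]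
  · simp only [ILVec.map, tauStep, map_add, map_sub, map_smul, map_mul, h]

theorem transfer_map_of_fixed {β : C →ₐ[Kq] C} {A : Finset ℕ} {k j : ℕ}
    (h : ∀ l, j ≤ l → ∀ x, β (ι l x) = ι l x) :
    (transfer ι A k j).map β = transfer ι A k j := by
  induction k generalizing j with
  | zero => simp [transfer, counitVec, ILVec.map]
  | succ k ih =>
    rw [transfer, transferStep_map (h j le_rfl), ih fun l hl => h l (by omega)]

theorem transferStep_congr {A A' : Finset ℕ} {j : ℕ} (h : j ∈ A ↔ j ∈ A') (v : ILVec C) :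
    transferStep ι A j v = transferStep ι A' j v := by
  rw [transferStep, transferStep]
  simp only [h]

theorem transfer_congr {A A' : Finset ℕ} {k j : ℕ} (h : ∀ l, j ≤ l → (l ∈ A ↔ l ∈ A')) :
    transfer ι A k j = transfer ι A' k j := by
  induction k generalizing j with
  | zero => rfl
  | succ k ih =>
    rw [transfer, transfer, ih fun l hl => h l (by omega), transferStep_congr (h j le_rfl)]

/-- A morphism fixing the factors before `i` commutes with the steps there, so only the part from
`i` on has to be examined. -/
theorem transfer_map_of_le {β : C →ₐ[Kq] C} {A A' : Finset ℕ} {i k : ℕ}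
    (hβ : ∀ l, l < i → ∀ x, β (ι l x) = ι l x) (hA : ∀ l, l < i → (l ∈ A ↔ l ∈ A'))
    (h : (transfer ι A k i).map β = transfer ι A' k i) :
    (transfer ι A (i + k) 0).map β = transfer ι A' (i + k) 0 := by
  have key : ∀ d j, j + d = i → (transfer ι A (d + k) j).map β = transfer ι A' (d + k) j := by
    intro d
    induction d with
    | zero => rintro j rfl; simpa using h
    | succ d ih =>
      intro j hj
      rw [show d + 1 + k = (d + k) + 1 by omega]
      simp only [transfer]
      rw [transferStep_map (hβ j (by omega)), ih (j + 1) (by omega),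
        transferStep_congr (hA j (by omega))]
  exact key i 0 (by omega)

theorem transfer_commutesWith {A : Finset ℕ} {k j : ℕ} {e f k₁ k₁' : C}
    (h : ∀ l, j ≤ l → ∀ x, CommutesWith e f k₁ k₁' (ι l x)) :
    (transfer ι A k j).CommutesWith e f k₁ k₁' := by
  have key : ∀ y : C, (∀ l, j ≤ l → ∀ x, Commute (ι l x) y) →
      Commute (transfer ι A k j).e y ∧ Commute (transfer ι A k j).fk y ∧
      Commute (transfer ι A k j).k y ∧ Commute (transfer ι A k j).l y := by
    intro y
    clear h
    induction k generalizing j with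
    | zero =>
      intro _
      exact ⟨Commute.zero_left y, Commute.zero_left y, Commute.one_left y,
        (Commute.one_left y).smul_left _⟩
    | succ k ih =>
      intro h
      obtain ⟨h1, h2, h3, h4⟩ := ih (j := j + 1) fun l hl => h l (by omega)
      have g := h j le_rfl
      rw [transfer, transferStep]
      generalize transfer ι A k (j + 1) = v at *
      have gE := g E
      have gF := g F
      have gK := g K
      have gK' := g Kinv
      split_ifs
      · exact ⟨(gE.mul_left h3).add_left h1, (gF.mul_left (gK.mul_left h3)).add_left h2,
          gK.mul_left h3,
          (((((((gF.mul_left (gE.mul_left h3)).smul_left _).add_left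
            ((gF.mul_left h1).smul_left _)).add_left
            ((gK'.mul_left (gE.mul_left h2)).smul_left _)).add_left (gK'.mul_left h4)).sub_left
            ((gK'.mul_left h3).smul_left _)).add_left ((gK.mul_left h3).smul_left _))⟩
      · exact ⟨gK.mul_left h1, ((((gK'.mul_left h2).sub_left
          ((gF.mul_left h4).smul_left _)).add_left ((gF.mul_left h3).smul_left _)).sub_left
          ((gF.mul_left (gF.mul_left (gK.mul_left h1))).smul_left _)),
          h3.sub_left ((gF.mul_left (gK.mul_left h1)).smul_left _), h4⟩
  obtain ⟨a1, a2, a3, a4⟩ := key e fun l hl x => (h l hl x).e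
  obtain ⟨b1, b2, b3, b4⟩ := key f fun l hl x => (h l hl x).f
  obtain ⟨c1, c2, c3, c4⟩ := key k₁ fun l hl x => (h l hl x).k
  obtain ⟨d1, d2, d3, d4⟩ := key k₁' fun l hl x => (h l hl x).k'
  exact ⟨⟨a1, b1, c1, d1⟩, ⟨a2, b2, c2, d2⟩, ⟨a3, b3, c3, d3⟩, ⟨a4, b4, c4, d4⟩⟩

/-! ### Propagation of the Askey–Wilson relation to the factors on the left. -/

/-- The entrywise application of `awExpr`. -/
def awVec (r : Kq) (x : C) (y : ILVec C) (l : C) (s : ILVec C) (l' : C) (t : ILVec C) : ILVec C :=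
  ⟨awExpr r x y.e l s.e l' t.e, awExpr r x y.fk l s.fk l' t.fk, awExpr r x y.k l s.k l' t.k,
    awExpr r x y.l l s.l l' t.l⟩

/-- The multiple of a vector by a scalar. -/
def ILVec.scale (c : Kq) (v : ILVec C) : ILVec C := ⟨c • v.e, c • v.fk, c • v.k, c • v.l⟩

theorem awExpr_add (r : Kq) (x y y' l s s' l' t t' : C) :
    awExpr r x (y + y') l (s + s') l' (t + t') = awExpr r x y l s l' t + awExpr r x y' l s' l' t' := by
  simp only [awExpr, mul_add, add_mul, smul_add]
  abel

theorem awExpr_smul (r c : Kq) (x y l s l' t : C) :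
    awExpr r x (c • y) l (c • s) l' (c • t) = c • awExpr r x y l s l' t := by
  simp only [awExpr, mul_smul_comm, smul_mul_assoc, smul_add, smul_sub, smul_comm c]

theorem awExpr_sub (r : Kq) (x y y' l s s' l' t t' : C) :
    awExpr r x (y - y') l (s - s') l' (t - t') = awExpr r x y l s l' t - awExpr r x y' l s' l' t' := by
  simp only [awExpr, mul_sub, sub_mul, smul_add, smul_sub]
  abel

/-- With the additivity lemmas this makes `awExpr` linear in its arguments `y`, `s`, `t` taken
jointly, over coefficients commuting with `x`, `l`, `l'`; hence it commutes with steps in other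
factors. -/
theorem awExpr_mul {r : Kq} {x l l' u : C} (hx : Commute u x) (hl : Commute u l)
    (hl' : Commute u l') (y s t : C) :
    awExpr r x (u * y) l (u * s) l' (u * t) = u * awExpr r x y l s l' t := by
  simp only [awExpr, mul_sub, mul_add, mul_smul_comm, smul_add, ← mul_assoc, hx.eq, hl.eq, hl'.eq]

theorem awVec_transferStep {r : Kq} {x l l' : C} {A : Finset ℕ} {j : ℕ}
    (hx : ∀ u, Commute (ι j u) x) (hl : ∀ u, Commute (ι j u) l) (hl' : ∀ u, Commute (ι j u) l')
    (y s t : ILVec C) :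
    awVec r x (transferStep ι A j y) l (transferStep ι A j s) l' (transferStep ι A j t) =
      transferStep ι A j (awVec r x y l s l' t) := by
  have hm := fun u => awExpr_mul (r := r) (hx u) (hl u) (hl' u)
  simp only [transferStep]
  split_ifs
  · simp only [awVec, comulStep, awExpr_add, awExpr_sub, awExpr_smul, hm]
  · simp only [awVec, tauStep, awExpr_add, awExpr_sub, awExpr_smul, hm]

theorem transferStep_scale (c : Kq) (A : Finset ℕ) (j : ℕ) (v : ILVec C) :
    transferStep ι A j (v.scale c) = (transferStep ι A j v).scale c := by
  simp only [transferStep]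
  split_ifs
  · simp only [ILVec.scale, comulStep, mul_smul_comm, smul_add, smul_sub, smul_comm c]
  · simp only [ILVec.scale, tauStep, mul_smul_comm, smul_add, smul_sub, smul_comm c]

theorem awVec_transfer {r c : Kq} {x l l' : C} {A₁ A₂ A₃ A₄ : Finset ℕ} {i k : ℕ}
    (hx : ∀ j, j < i → ∀ u, Commute (ι j u) x) (hl : ∀ j, j < i → ∀ u, Commute (ι j u) l)
    (hl' : ∀ j, j < i → ∀ u, Commute (ι j u) l')
    (h₂ : ∀ l, l < i → (l ∈ A₂ ↔ l ∈ A₁)) (h₃ : ∀ l, l < i → (l ∈ A₃ ↔ l ∈ A₁))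
    (h₄ : ∀ l, l < i → (l ∈ A₄ ↔ l ∈ A₁))
    (h : awVec r x (transfer ι A₁ k i) l (transfer ι A₂ k i) l' (transfer ι A₃ k i) =
      (transfer ι A₄ k i).scale c) :
    awVec r x (transfer ι A₁ (i + k) 0) l (transfer ι A₂ (i + k) 0) l' (transfer ι A₃ (i + k) 0) =
      (transfer ι A₄ (i + k) 0).scale c := by
  have key : ∀ d j, j + d = i →
      awVec r x (transfer ι A₁ (d + k) j) l (transfer ι A₂ (d + k) j) l' (transfer ι A₃ (d + k) j) =
        (transfer ι A₄ (d + k) j).scale c := by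
    intro d
    induction d with
    | zero => rintro j rfl; simpa using h
    | succ d ih =>
      intro j hj
      have hji : j < i := by omega
      rw [show d + 1 + k = (d + k) + 1 by omega]
      simp only [transfer]
      rw [transferStep_congr (h₂ j hji), transferStep_congr (h₃ j hji),
        transferStep_congr (h₄ j hji), awVec_transferStep (hx j hji) (hl j hji) (hl' j hji),
        ih (j + 1) (by omega), transferStep_scale]
  exact key i 0 (by omega)

end Transfer

/-! ### The Casimir elements in the completion. -/

section Casimir

variable {n : ℕ}

theorem factorExt_commute {i j : ℕ} (h : i ≠ j) (x y : Uq) :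
    Commute (factorExt n i x) (factorExt n j y) := by
  unfold factorExt
  split_ifs with hi hj hj
  · exact factorHom_commute (by simpa [Fin.ext_iff] using h) x y
  · exact Algebra.commute_algebraMap_right (counit y) _
  · exact Algebra.commute_algebraMap_left (counit x) _
  · exact Algebra.commute_algebraMap_left (counit x) _

theorem braidEquiv_factorExt {i : Fin (n - 1)} {j : ℕ} (h1 : j ≠ i) (h2 : j ≠ i + 1) (x : Uq) :
    braidEquiv i (factorExt n j x) = factorExt n j x := by
  unfold factorExt
  split_ifs with hj
  · exact braidEquiv_factorHom (by simpa [left, Fin.ext_iff] using h1)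
      (by simpa [right, Fin.ext_iff] using h2) x
  · exact (braidEquiv i).commutes _

theorem factorExt_pair {i j : ℕ} (h : i ≠ j) : 
    UqPair q (factorExt n i E) (factorExt n i F) (factorExt n i K) (factorExt n i Kinv)
      (factorExt n j E) (factorExt n j F) (factorExt n j K) (factorExt n j Kinv) := by
  have hc := fun x y => (factorExt_commute (n := n) h.symm x y).eq
  exact ⟨uqRelations_map Uq.relations _, uqRelations_map Uq.relations _,
    hc _ _, hc _ _, hc _ _, hc _ _, hc _ _, hc _ _, hc _ _, hc _ _, hc _ _, hc _ _, hc _ _, hc _ _,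
    hc _ _, hc _ _, hc _ _, hc _ _⟩

theorem isBraiding_factorExt (i : Fin (n - 1)) :
    IsBraiding q (factorExt n i E) (factorExt n i F) (factorExt n i K) (factorExt n i Kinv)
      (factorExt n (i + 1) E) (factorExt n (i + 1) F) (factorExt n (i + 1) K)
      (factorExt n (i + 1) Kinv) (braidEquiv i : Completion n →ₐ[Kq] Completion n) := by
  have h1 : factorExt n i = factorHom (left i) := factorExt_of_lt (by omega)
  have h2 : factorExt n (i + 1) = factorHom (right i) := factorExt_of_lt (by omega)
  rw [h1, h2]
  exact isBraiding_braidEquiv i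

/-- The image in the completion of the Casimir element of `A`. -/
def casimirVec (n : ℕ) (A : Finset ℕ) : ILVec (Completion n) := transfer (factorExt n) A n 0

/-- Since τ_L(Λ) = 1 ⊗ Λ, the steps to the left of `j` do not change the last entry. -/
theorem casimirVec_singleton {j : ℕ} (hj : j < n) :
    (casimirVec n {j}).l =
      casimirOf q (factorExt n j E) (factorExt n j F) (factorExt n j K) (factorExt n j Kinv) := by
  have key : ∀ d l k, l + d = j → (transfer (factorExt n) {j} (d + (k + 1)) l).l =
      casimirOf q (factorExt n j E) (factorExt n j F) (factorExt n j K) (factorExt n j Kinv) := by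
    intro d
    induction d with
    | zero =>
      rintro l k rfl
      rw [zero_add, transfer, transfer_eq_counitVec _ (by simp), transferStep, if_pos (by simp),
        comulStep_counitVec]
      rfl
    | succ d ih =>
      intro l k h
      rw [show d + 1 + (k + 1) = (d + (k + 1)) + 1 by omega, transfer, transferStep,
        if_neg (by simp; omega), tauStep]
      exact ih (l + 1) k (by omega)
  have := key j 0 (n - j - 1) (by omega)
  rwa [show j + (n - j - 1 + 1) = n by omega] at this

theorem casimirVec_pair {j : ℕ} (hj : j + 1 < n) :
    (casimirVec n {j, j + 1}).l =
      casimirOfPair q (factorExt n j E) (factorExt n j F) (factorExt n j K) (factorExt n j Kinv)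
        (factorExt n (j + 1) E) (factorExt n (j + 1) F) (factorExt n (j + 1) K)
        (factorExt n (j + 1) Kinv) := by
  have key : ∀ d l k, l + d = j → (transfer (factorExt n) {j, j + 1} (d + (k + 2)) l).l =
      casimirOfPair q (factorExt n j E) (factorExt n j F) (factorExt n j K) (factorExt n j Kinv)
        (factorExt n (j + 1) E) (factorExt n (j + 1) F) (factorExt n (j + 1) K)
        (factorExt n (j + 1) Kinv) := by
    intro d
    induction d with
    | zero =>
      rintro l k rfl
      rw [zero_add, transfer, transfer, transfer_eq_counitVec _ (by simp), transferStep, transferStep,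
        if_pos (by simp), if_pos (by simp), (factorExt_pair (by omega)).comulStep_comulStep q_ne_zero
          (sub_ne_zero.mpr q_sq_ne_one), comulStep_counitVec]
      rfl
    | succ d ih =>
      intro l k h
      rw [show d + 1 + (k + 2) = (d + (k + 2)) + 1 by omega, transfer, transferStep,
        if_neg (by simp; omega), tauStep]
      exact ih (l + 1) k (by omega)
  have := key j 0 (n - j - 2) (by omega)
  rwa [show j + (n - j - 2 + 2) = n by omega] at this

end Casimir

section Casimir

variable {n : ℕ}

theorem commute_casimirOf {C : Type*} [Ring C] [Algebra Kq C] {y e f k k' : C} (he : Commute y e)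
    (hf : Commute y f) (hk : Commute y k) (hk' : Commute y k') :
    Commute y (casimirOf q e f k k') :=
  (((hf.mul_right he).smul_right _).add_right (hk.smul_right _)).add_right (hk'.smul_right _)

theorem factorExt_commute_casimirOf {i j : ℕ} (h : i ≠ j) (x : Uq) :
    Commute (factorExt n i x) (casimirOf q (factorExt n j E) (factorExt n j F) (factorExt n j K)
      (factorExt n j Kinv)) :=
  commute_casimirOf (factorExt_commute h ..) (factorExt_commute h ..) (factorExt_commute h ..)
    (factorExt_commute h ..)

theorem factorExt_commute_casimirOfPair {i j l : ℕ} (h : i ≠ j) (h' : i ≠ l) (x : Uq) :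
    Commute (factorExt n i x) (casimirOfPair q (factorExt n j E) (factorExt n j F) (factorExt n j K)
      (factorExt n j Kinv) (factorExt n l E) (factorExt n l F) (factorExt n l K)
      (factorExt n l Kinv)) :=
  commute_casimirOf (((factorExt_commute h ..).mul_right (factorExt_commute h' ..)).add_right
    (factorExt_commute h' ..)) ((factorExt_commute h ..).add_right
    ((factorExt_commute h ..).mul_right (factorExt_commute h' ..)))
    ((factorExt_commute h ..).mul_right (factorExt_commute h' ..))
    ((factorExt_commute h ..).mul_right (factorExt_commute h' ..))

variable (i : Fin (n - 1)) {A A' : Finset ℕ}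

theorem casimirVec_eq_transfer (A : Finset ℕ) :
    casimirVec n A = transfer (factorExt n) A ((i : ℕ) + (n - i - 2 + 2)) 0 := by
  rw [casimirVec, show (i : ℕ) + (n - i - 2 + 2) = n by omega]

theorem isFixed_transfer (A : Finset ℕ) (k : ℕ) :
    (transfer (factorExt n) A k (i + 2)).IsFixed
      (braidEquiv i : Completion n →ₐ[Kq] Completion n) := by
  have h := transfer_map_of_fixed (ι := factorExt n) (A := A) (k := k) (j := (i : ℕ) + 2)
    (β := (braidEquiv i : Completion n →ₐ[Kq] Completion n))
    fun l hl x => braidEquiv_factorExt (by omega) (by omega) x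
  exact ⟨congrArg ILVec.e h, congrArg ILVec.fk h, congrArg ILVec.k h, congrArg ILVec.l h⟩

theorem commutesWith_transfer {j l : ℕ} (h : l < j) (A : Finset ℕ) (k : ℕ) :
    (transfer (factorExt n) A k j).CommutesWith (factorExt n l E) (factorExt n l F)
      (factorExt n l K) (factorExt n l Kinv) :=
  transfer_commutesWith fun _ hl _ => ⟨factorExt_commute (by omega) .., factorExt_commute (by omega) ..,
    factorExt_commute (by omega) .., factorExt_commute (by omega) ..⟩

/-- Reduction to the two steps at i and i + 1: the part to their right is fixed by β_i, and the
steps to their left commute with it. -/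
theorem braidEquiv_casimirVec_of (hA : ∀ l : ℕ, l ≠ i → l ≠ i + 1 → (l ∈ A ↔ l ∈ A'))
    (h : ∀ v : ILVec (Completion n),
      v.IsFixed (braidEquiv i : Completion n →ₐ[Kq] Completion n) →
      (transferStep (factorExt n) A i (transferStep (factorExt n) A (i + 1) v)).map
        (braidEquiv i : Completion n →ₐ[Kq] Completion n) =
      transferStep (factorExt n) A' i (transferStep (factorExt n) A' (i + 1) v)) :
    braidEquiv i (casimirVec n A).l = (casimirVec n A').l := by
  have := transfer_map_of_le (ι := factorExt n) (A := A) (A' := A') (i := i) (k := n - i - 2 + 2)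
    (β := (braidEquiv i : Completion n →ₐ[Kq] Completion n))
    (fun l hl x => braidEquiv_factorExt (by omega) (by omega) x)
    (fun l hl => hA l (by omega) (by omega)) (by
      rw [transfer, transfer, transfer, transfer, h _ (isFixed_transfer i A _),
        transfer_congr fun l hl => hA l (by omega) (by omega)])
  rw [← casimirVec_eq_transfer, ← casimirVec_eq_transfer] at this
  exact congrArg ILVec.l this

theorem braidEquiv_casimirVec_of_iff (hA : (i : ℕ) ∈ A ↔ (i : ℕ) + 1 ∈ A) :
    braidEquiv i (casimirVec n A).l = (casimirVec n A).l := by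
  refine braidEquiv_casimirVec_of i (fun _ _ _ => Iff.rfl) fun v hv => ?_
  have hp := factorExt_pair (n := n) (i := i) (j := i + 1) (by omega)
  by_cases h : (i : ℕ) ∈ A
  · simp only [transferStep, if_pos h, if_pos (hA.mp h)]
    exact (isBraiding_factorExt i).map_comulStep_comulStep q_ne_zero
      (sub_ne_zero.mpr q_sq_ne_one) hp hv
  · simp only [transferStep, if_neg h, if_neg fun h' => h (hA.mpr h')]
    exact (isBraiding_factorExt i).map_tauStep_tauStep q_ne_zero
      (sub_ne_zero.mpr q_sq_ne_one) hp hv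

theorem braidEquiv_casimirVec_of_mem (h : (i : ℕ) ∈ A) (h' : (i : ℕ) + 1 ∉ A) :
    braidEquiv i (casimirVec n A).l = (casimirVec n (insert ((i : ℕ) + 1) (A.erase i))).l := by
  refine braidEquiv_casimirVec_of i (fun l h1 h2 => by simp [h1, h2]) fun v hv => ?_
  simp only [transferStep, if_pos h, if_neg h', if_pos (Finset.mem_insert_self _ _),
    if_neg (show (i : ℕ) ∉ insert ((i : ℕ) + 1) (A.erase i) by simp)]
  exact (isBraiding_factorExt i).map_comulStep_tauStep q_ne_zero
    (sub_ne_zero.mpr q_sq_ne_one) (factorExt_pair (by omega)) hv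

theorem braidEquiv_casimirVec_left :
    braidEquiv i (casimirVec n {(i : ℕ)}).l = (casimirVec n {(i : ℕ) + 1}).l := by
  rw [casimirVec_singleton (by omega), casimirVec_singleton (by omega)]
  exact (isBraiding_factorExt i).map_casimir

theorem braidEquiv_casimirVec_right :
    braidEquiv i (casimirVec n {(i : ℕ) + 1}).l = (casimirVec n {(i : ℕ)}).l := by
  rw [casimirVec_singleton (by omega), casimirVec_singleton (by omega)]
  exact (isBraiding_factorExt i).map_casimir₂

/-- Inverting q reverses the q-commutator up to sign, so the relation and its mirror image propagate
by the same lemma. -/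
theorem awExpr_inv {C : Type*} [Ring C] [Algebra Kq C] (x y l s l' t : C) :
    awExpr q⁻¹ x y l s l' t = -awExpr q y x l s l' t := by
  simp only [awExpr, inv_inv, sub_smul]
  abel

theorem awVec_casimirVec {r c : Kq} {l l' : ℕ} (hl : (i : ℕ) ≤ l) (hl' : (i : ℕ) ≤ l')
    (hln : l < n) (hln' : l' < n)
    {A₁ A₂ A₃ A₄ : Finset ℕ} (h₂ : ∀ l : ℕ, l ≠ i → l ≠ i + 1 → (l ∈ A₂ ↔ l ∈ A₁))
    (h₃ : ∀ l : ℕ, l ≠ i → l ≠ i + 1 → (l ∈ A₃ ↔ l ∈ A₁))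
    (h₄ : ∀ l : ℕ, l ≠ i → l ≠ i + 1 → (l ∈ A₄ ↔ l ∈ A₁))
    (h : ∀ v : ILVec (Completion n),
      v.CommutesWith (factorExt n i E) (factorExt n i F) (factorExt n i K) (factorExt n i Kinv) →
      v.CommutesWith (factorExt n (i + 1) E) (factorExt n (i + 1) F) (factorExt n (i + 1) K)
        (factorExt n (i + 1) Kinv) →
      ∀ g : ILVec (Completion n) → Completion n,
        (g = ILVec.e ∨ g = ILVec.fk ∨ g = ILVec.k ∨ g = ILVec.l) →
        awExpr r (casimirOfPair q (factorExt n i E) (factorExt n i F) (factorExt n i K)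
          (factorExt n i Kinv) (factorExt n (i + 1) E) (factorExt n (i + 1) F)
          (factorExt n (i + 1) K) (factorExt n (i + 1) Kinv))
          (g (transferStep (factorExt n) A₁ i (transferStep (factorExt n) A₁ (i + 1) v)))
          (casimirOf q (factorExt n l E) (factorExt n l F) (factorExt n l K) (factorExt n l Kinv))
          (g (transferStep (factorExt n) A₂ i (transferStep (factorExt n) A₂ (i + 1) v)))
          (casimirOf q (factorExt n l' E) (factorExt n l' F) (factorExt n l' K)
            (factorExt n l' Kinv))
          (g (transferStep (factorExt n) A₃ i (transferStep (factorExt n) A₃ (i + 1) v))) =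
        c • g (transferStep (factorExt n) A₄ i (transferStep (factorExt n) A₄ (i + 1) v))) :
    awExpr r (casimirVec n {(i : ℕ), (i : ℕ) + 1}).l (casimirVec n A₁).l (casimirVec n {l}).l
      (casimirVec n A₂).l (casimirVec n {l'}).l (casimirVec n A₃).l =
    c • (casimirVec n A₄).l := by
  have := awVec_transfer (ι := factorExt n) (i := i) (k := n - i - 2 + 2) (r := r) (c := c)
    (A₁ := A₁) (A₂ := A₂) (A₃ := A₃) (A₄ := A₄)
    (fun j hj u => factorExt_commute_casimirOfPair (j := i) (l := i + 1) (by omega) (by omega) u)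
    (fun j hj u => factorExt_commute_casimirOf (j := l) (by omega) u)
    (fun j hj u => factorExt_commute_casimirOf (j := l') (by omega) u)
    (fun j hj => h₂ j (by omega) (by omega)) (fun j hj => h₃ j (by omega) (by omega))
    (fun j hj => h₄ j (by omega) (by omega)) (by
      simp only [transfer]
      rw [transfer_congr fun l hl => h₂ l (by omega) (by omega),
        transfer_congr fun l hl => h₃ l (by omega) (by omega),
        transfer_congr fun l hl => h₄ l (by omega) (by omega)]
      have hv := commutesWith_transfer (n := n) (j := i + 1 + 1) (l := i) (by omega) A₁ (n - i - 2)
      have hv₂ := commutesWith_transfer (n := n) (j := i + 1 + 1) (l := i + 1) (by omega) A₁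
        (n - i - 2)
      refine ILVec.ext ?_ ?_ ?_ ?_
      · exact h _ hv hv₂ ILVec.e (by simp)
      · exact h _ hv hv₂ ILVec.fk (by simp)
      · exact h _ hv hv₂ ILVec.k (by simp)
      · exact h _ hv hv₂ ILVec.l (by simp))
  simp only [← casimirVec_eq_transfer] at this
  rw [casimirVec_pair (by omega), casimirVec_singleton hln, casimirVec_singleton hln']
  exact congrArg ILVec.l this

theorem awExpr_casimirVec (h : (i : ℕ) ∉ A) (h' : (i : ℕ) + 1 ∈ A) :
    awExpr q (casimirVec n {(i : ℕ), (i : ℕ) + 1}).l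
      (casimirVec n (insert (i : ℕ) (A.erase (i + 1)))).l (casimirVec n {(i : ℕ)}).l
      (casimirVec n (insert (i : ℕ) A)).l (casimirVec n {(i : ℕ) + 1}).l
      (casimirVec n (A.erase (i + 1))).l = (-(q ^ 2 - (q ^ 2)⁻¹)) • (casimirVec n A).l := by
  refine awVec_casimirVec i le_rfl (by omega) (by omega) (by omega)
    (fun l h1 h2 => by simp [h1, h2]) (fun l h1 h2 => by simp [h1, h2])
    (fun l h1 h2 => by simp [h1, h2]) fun v hv hv₂ g hg => ?_
  simp only [transferStep, h, h', Finset.mem_insert, Finset.mem_erase, ne_eq, not_true_eq_false,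
    false_and, and_false, or_false, true_or, or_true, if_true, if_false, Nat.add_eq_left,
    one_ne_zero]
  rw [neg_smul]
  exact (factorExt_pair (by omega)).aw_relation q_ne_zero (sub_ne_zero.mpr q_sq_ne_one) v g hg hv hv₂

theorem awExpr_casimirVec_symm (h : (i : ℕ) ∈ A) (h' : (i : ℕ) + 1 ∉ A) :
    awExpr q (casimirVec n (insert ((i : ℕ) + 1) (A.erase i))).l
      (casimirVec n {(i : ℕ), (i : ℕ) + 1}).l (casimirVec n {(i : ℕ) + 1}).l
      (casimirVec n (insert ((i : ℕ) + 1) A)).l (casimirVec n {(i : ℕ)}).l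
      (casimirVec n (A.erase i)).l = (-(q ^ 2 - (q ^ 2)⁻¹)) • (casimirVec n A).l := by
  rw [← neg_inj, ← awExpr_inv, ← neg_smul, neg_neg]
  refine awVec_casimirVec i (by omega) le_rfl (by omega) (by omega)
    (fun l h1 h2 => by simp [h1, h2]) (fun l h1 h2 => by simp [h1, h2])
    (fun l h1 h2 => by simp [h1, h2]) fun v hv hv₂ g hg => ?_
  simp only [transferStep, h, h', Finset.mem_insert, Finset.mem_erase, ne_eq, not_true_eq_false,
    false_and, and_false, or_false, true_or, or_true, if_true, if_false, Nat.left_eq_add,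
    one_ne_zero]
  rw [awExpr_inv, neg_eq_iff_eq_neg]
  exact (factorExt_pair (by omega)).aw_relation_symm q_ne_zero (sub_ne_zero.mpr q_sq_ne_one) v g hg
    hv hv₂

theorem map_awExpr {C : Type*} [Ring C] [Algebra Kq C] (φ : C ≃ₐ[Kq] C) (r : Kq)
    (x y l s l' t : C) :
    φ (awExpr r x y l s l' t) = awExpr r (φ x) (φ y) (φ l) (φ s) (φ l') (φ t) := by
  simp only [awExpr, map_sub, map_add, map_smul, map_mul]

theorem q_sq_sub_inv_ne_zero : q ^ 2 - (q ^ 2)⁻¹ ≠ 0 := by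
  have := q_pow_sub_inv_ne_zero (n := 2) (by norm_num)
  exact this

theorem eq_of_neg_smul_eq {C : Type*} [AddCommGroup C] [Module Kq C] {c : Kq} (hc : c ≠ 0) {x y : C}
    (h : x = (-c) • y) : y = -(c⁻¹ • x) := by
  rw [h, smul_smul, mul_neg, inv_mul_cancel₀ hc, neg_smul, one_smul, neg_neg]

/-- The image under β_i of the Askey–Wilson relation. Every term other than Λ_A has a known image,
so the relation can be solved for the image of Λ_A. -/
theorem braidEquiv_casimirVec_of_notMem (h : (i : ℕ) ∉ A) (h' : (i : ℕ) + 1 ∈ A) :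
    braidEquiv i (casimirVec n A).l = -((q ^ 2 - (q ^ 2)⁻¹)⁻¹ •
      awExpr q (casimirVec n {(i : ℕ), (i : ℕ) + 1}).l (casimirVec n A).l
        (casimirVec n {(i : ℕ) + 1}).l (casimirVec n (insert (i : ℕ) A)).l
        (casimirVec n {(i : ℕ)}).l (casimirVec n (A.erase (i + 1))).l) := by
  have key := congrArg (braidEquiv i) (awExpr_casimirVec i h h')
  rw [map_awExpr, map_smul] at key
  rw [braidEquiv_casimirVec_left, braidEquiv_casimirVec_right,
    braidEquiv_casimirVec_of_iff i (A := {(i : ℕ), (i : ℕ) + 1}) (by simp),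
    braidEquiv_casimirVec_of_iff i (A := insert (i : ℕ) A) (by simp [h']),
    braidEquiv_casimirVec_of_iff i (A := A.erase (i + 1)) (by simp [h]),
    braidEquiv_casimirVec_of_mem i (by simp) (by simp)] at key
  have hA : insert ((i : ℕ) + 1) ((insert (i : ℕ) (A.erase (i + 1))).erase i) = A := by
    rw [Finset.erase_insert (by simp [h]), Finset.insert_erase h']
  rw [hA] at key
  exact eq_of_neg_smul_eq q_sq_sub_inv_ne_zero key

/-- After applying β_i, the claim becomes the mirror Askey–Wilson relation for `A`. -/
theorem braidEquiv_symm_casimirVec_of_mem (h : (i : ℕ) ∈ A) (h' : (i : ℕ) + 1 ∉ A) :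
    (braidEquiv i).symm (casimirVec n A).l = -((q ^ 2 - (q ^ 2)⁻¹)⁻¹ •
      awExpr q (casimirVec n A).l (casimirVec n {(i : ℕ), (i : ℕ) + 1}).l
        (casimirVec n {(i : ℕ)}).l (casimirVec n (insert ((i : ℕ) + 1) A)).l
        (casimirVec n {(i : ℕ) + 1}).l (casimirVec n (A.erase i)).l) := by
  rw [AlgEquiv.symm_apply_eq, map_neg, map_smul, map_awExpr]
  rw [braidEquiv_casimirVec_left, braidEquiv_casimirVec_right,
    braidEquiv_casimirVec_of_iff i (A := {(i : ℕ), (i : ℕ) + 1}) (by simp),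
    braidEquiv_casimirVec_of_iff i (A := insert ((i : ℕ) + 1) A) (by simp [h]),
    braidEquiv_casimirVec_of_iff i (A := A.erase i) (by simp [h']), braidEquiv_casimirVec_of_mem i h h']
  exact eq_of_neg_smul_eq q_sq_sub_inv_ne_zero (awExpr_casimirVec_symm i h h')

end Casimir

/-! ### The braid group action -/

section BraidAction

/-- The action of the braid group on the completion. -/
def braidAction (n : ℕ) : BraidGroup n →* (Completion n ≃ₐ[Kq] Completion n) :=
  PresentedGroup.toGroup (f := fun i => braidEquiv i) (by
    rintro r (⟨i, j, h, rfl⟩ | ⟨i, j, h, rfl⟩)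
    · simp only [map_mul, map_inv, FreeGroup.lift_apply_of]
      rw [braidEquiv_braid h, mul_inv_cancel]
    · simp only [map_mul, map_inv, FreeGroup.lift_apply_of]
      rw [braidEquiv_commute h, mul_inv_cancel])

theorem braidAction_braidGen {n : ℕ} (i : Fin (n - 1)) :
    braidAction n (braidGen i) = braidEquiv i :=
  PresentedGroup.toGroup.of _

variable {n : ℕ}

theorem casimirVec_mem {A : Finset ℕ} (hA : A ⊆ Finset.range n) :
    (casimirVec n A).l ∈ (AW n).map (toCompletion n) := by
  rcases A.eq_empty_or_nonempty with rfl | h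
  -- The generators of AW(n) exclude the empty set, but Λ_∅ is a scalar and so lies in AW(n) as
  -- well.
  · rw [casimirVec, transfer_eq_counitVec _ (by simp)]
    exact Subalgebra.smul_mem _ (one_mem _) _
  · rw [casimirVec, ← toCompletion_casimirSet hA]
    exact Subalgebra.mem_map.mpr ⟨_, Algebra.subset_adjoin ⟨A, h, hA, rfl⟩, rfl⟩

theorem awExpr_mem {C : Type*} [Ring C] [Algebra Kq C] {S : Subalgebra Kq C} {r : Kq}
    {x y l s l' t : C} (hx : x ∈ S) (hy : y ∈ S) (hl : l ∈ S) (hs : s ∈ S) (hl' : l' ∈ S)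
    (ht : t ∈ S) : awExpr r x y l s l' t ∈ S :=
  sub_mem (sub_mem (S.smul_mem (mul_mem hx hy) _) (S.smul_mem (mul_mem hy hx) _))
    (S.smul_mem (add_mem (mul_mem hl hs) (mul_mem hl' ht)) _)

/-- It is enough to test a morphism on the generators of AW(n). -/
theorem map_map_toCompletion_le (φ : Completion n →ₐ[Kq] Completion n)
    (h : ∀ A ⊆ Finset.range n, φ (casimirVec n A).l ∈ (AW n).map (toCompletion n)) :
    ((AW n).map (toCompletion n)).map φ ≤ (AW n).map (toCompletion n) := by
  conv_lhs => rw [AW, AlgHom.map_adjoin, AlgHom.map_adjoin]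
  refine Algebra.adjoin_le ?_
  rintro _ ⟨_, ⟨_, ⟨A, -, hA, rfl⟩, rfl⟩, rfl⟩
  rw [toCompletion_casimirSet hA]
  exact h A hA

variable (i : Fin (n - 1))

theorem map_braidEquiv_le : ((AW n).map (toCompletion n)).map
    (braidEquiv i : Completion n →ₐ[Kq] Completion n) ≤ (AW n).map (toCompletion n) := by
  refine map_map_toCompletion_le _ fun A hA => ?_
  have hi : (i : ℕ) ∈ Finset.range n := Finset.mem_range.mpr (by omega)
  have hi' : (i : ℕ) + 1 ∈ Finset.range n := Finset.mem_range.mpr (by omega)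
  change braidEquiv i (casimirVec n A).l ∈ _
  by_cases h : (i : ℕ) ∈ A <;> by_cases h' : (i : ℕ) + 1 ∈ A
  · rw [braidEquiv_casimirVec_of_iff i (by simp [h, h'])]
    exact casimirVec_mem hA
  · rw [braidEquiv_casimirVec_of_mem i h h']
    exact casimirVec_mem (Finset.insert_subset hi' ((Finset.erase_subset _ _).trans hA))
  · rw [braidEquiv_casimirVec_of_notMem i h h']
    refine neg_mem (Subalgebra.smul_mem _ (awExpr_mem ?_ ?_ ?_ ?_ ?_ ?_) _) <;>
      apply casimirVec_mem
    · simp [Finset.insert_subset_iff, hi, hi', -Finset.mem_range]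
    · exact hA
    · simp [hi', -Finset.mem_range]
    · exact Finset.insert_subset hi hA
    · simp [hi, -Finset.mem_range]
    · exact (Finset.erase_subset _ _).trans hA
  · rw [braidEquiv_casimirVec_of_iff i (by simp [h, h'])]
    exact casimirVec_mem hA

theorem map_braidEquiv_symm_le : ((AW n).map (toCompletion n)).map
    ((braidEquiv i).symm : Completion n →ₐ[Kq] Completion n) ≤ (AW n).map (toCompletion n) := by
  refine map_map_toCompletion_le _ fun A hA => ?_
  have hi : (i : ℕ) ∈ Finset.range n := Finset.mem_range.mpr (by omega)
  have hi' : (i : ℕ) + 1 ∈ Finset.range n := Finset.mem_range.mpr (by omega)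
  change (braidEquiv i).symm (casimirVec n A).l ∈ _
  by_cases h : (i : ℕ) ∈ A <;> by_cases h' : (i : ℕ) + 1 ∈ A
  · rw [(AlgEquiv.symm_apply_eq _).mpr (braidEquiv_casimirVec_of_iff i (by simp [h, h'])).symm]
    exact casimirVec_mem hA
  · rw [braidEquiv_symm_casimirVec_of_mem i h h']
    refine neg_mem (Subalgebra.smul_mem _ (awExpr_mem ?_ ?_ ?_ ?_ ?_ ?_) _) <;>
      apply casimirVec_mem
    · exact hA
    · simp [Finset.insert_subset_iff, hi, hi', -Finset.mem_range]
    · simp [hi, -Finset.mem_range]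
    · exact Finset.insert_subset hi' hA
    · simp [hi', -Finset.mem_range]
    · exact (Finset.erase_subset _ _).trans hA
  · have key := braidEquiv_casimirVec_of_mem i (A := insert (i : ℕ) (A.erase (i + 1))) (by simp)
      (by simp)
    rw [Finset.erase_insert (by simp [h]), Finset.insert_erase h'] at key
    rw [(AlgEquiv.symm_apply_eq _).mpr key.symm]
    exact casimirVec_mem (Finset.insert_subset hi ((Finset.erase_subset _ _).trans hA))
  · rw [(AlgEquiv.symm_apply_eq _).mpr (braidEquiv_casimirVec_of_iff i (by simp [h, h'])).symm]
    exact casimirVec_mem hA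

theorem map_braidEquiv : ((AW n).map (toCompletion n)).map
    (braidEquiv i : Completion n →ₐ[Kq] Completion n) = (AW n).map (toCompletion n) := by
  refine (map_braidEquiv_le i).antisymm fun x hx => ?_
  exact ⟨(braidEquiv i).symm x, map_braidEquiv_symm_le i ⟨x, hx, rfl⟩,
    (braidEquiv i).apply_symm_apply x⟩

/-- The automorphisms mapping a subalgebra onto itself. -/
def subalgebraStabilizer {C : Type*} [Ring C] [Algebra Kq C] (S : Subalgebra Kq C) :
    Subgroup (C ≃ₐ[Kq] C) where
  carrier := {φ | S.map (φ : C →ₐ[Kq] C) = S}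
  mul_mem' {φ ψ} hφ hψ := by
    change S.map ((φ : C →ₐ[Kq] C).comp (ψ : C →ₐ[Kq] C)) = S
    rw [← Subalgebra.map_map]
    exact (congrArg _ hψ).trans hφ
  one_mem' := Subalgebra.map_id S
  inv_mem' {φ} hφ := by
    change S.map (φ.symm : C →ₐ[Kq] C) = S
    conv_lhs => rw [← show S.map (φ : C →ₐ[Kq] C) = S from hφ]
    rw [Subalgebra.map_map, AlgEquiv.symm_comp, Subalgebra.map_id]

theorem map_braidAction (g : BraidGroup n) : ((AW n).map (toCompletion n)).map
    (braidAction n g : Completion n →ₐ[Kq] Completion n) = (AW n).map (toCompletion n) := by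
  have h : (⊤ : Subgroup (BraidGroup n)) ≤
      (subalgebraStabilizer ((AW n).map (toCompletion n))).comap (braidAction n) := by
    rw [← PresentedGroup.closure_range_of, Subgroup.closure_le]
    rintro _ ⟨i, rfl⟩
    change braidAction n (braidGen i) ∈ subalgebraStabilizer ((AW n).map (toCompletion n))
    rw [braidAction_braidGen]
    exact map_braidEquiv i
  exact h (Subgroup.mem_top g)

end BraidAction

/-! ### Injectivity of the map to the completion -/

/-- The generator `K` as a unit. -/
def unitK : Uqˣ := ⟨K, Kinv, Uq.relations.k_k', Uq.relations.k'_k⟩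

/-- The monomials `F^a K^b E^c`. -/
def monomial (p : ℕ × ℤ × ℕ) : Uq := F ^ p.1 * ((unitK ^ p.2.1 : Uqˣ) * E ^ p.2.2)

theorem K_mul_unitK_zpow (b : ℤ) : K * (unitK ^ b : Uqˣ) = (unitK ^ (b + 1) : Uqˣ) := by
  rw [add_comm, zpow_add, zpow_one, Units.val_mul]
  rfl

theorem Kinv_mul_unitK_zpow (b : ℤ) : Kinv * (unitK ^ b : Uqˣ) = (unitK ^ (b - 1) : Uqˣ) := by
  rw [sub_eq_add_neg, add_comm, zpow_add, zpow_neg, zpow_one, Units.val_mul]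
  rfl

theorem E_mul_unitK_zpow (b : ℤ) :
    ∃ c : Kq, E * (unitK ^ b : Uqˣ) = c • ((unitK ^ b : Uqˣ) * E) := by
  induction b using Int.induction_on with
  | zero => exact ⟨1, by simp⟩
  | succ b ih =>
    obtain ⟨c, hc⟩ := ih
    refine ⟨(q ^ 2)⁻¹ * c, ?_⟩
    rw [← K_mul_unitK_zpow, ← mul_assoc, Uq.relations.e_k q_ne_zero, smul_mul_assoc, mul_assoc, hc,
      mul_smul_comm, smul_smul, mul_assoc]
  | pred b ih =>
    obtain ⟨c, hc⟩ := ih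
    refine ⟨q ^ 2 * c, ?_⟩
    rw [← Kinv_mul_unitK_zpow, ← mul_assoc, Uq.relations.e_k' q_ne_zero, smul_mul_assoc, mul_assoc,
      hc, mul_smul_comm, smul_smul, mul_assoc]

/-- The span of the monomials. -/
def monomialSpan : Submodule Kq Uq := Submodule.span Kq (Set.range monomial)

theorem mul_mem_monomialSpan {x : Uq} (hx : ∀ p, x * monomial p ∈ monomialSpan) {y : Uq}
    (hy : y ∈ monomialSpan) : x * y ∈ monomialSpan := by
  induction hy using Submodule.span_induction with
  | mem y h =>
    obtain ⟨p, rfl⟩ := h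
    exact hx p
  | zero => rw [mul_zero]; exact zero_mem _
  | add y z _ _ h1 h2 => rw [mul_add]; exact add_mem h1 h2
  | smul a y _ h => rw [mul_smul_comm]; exact Submodule.smul_mem _ _ h

theorem monomial_mem (p : ℕ × ℤ × ℕ) : monomial p ∈ monomialSpan :=
  Submodule.subset_span ⟨p, rfl⟩

theorem monomial_succ (a : ℕ) (b : ℤ) (c : ℕ) :
    monomial (a + 1, b, c) = F * monomial (a, b, c) := by
  simp only [monomial, pow_succ', mul_assoc]

theorem F_mul_mem {y : Uq} (hy : y ∈ monomialSpan) : F * y ∈ monomialSpan := by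
  refine mul_mem_monomialSpan (fun ⟨a, b, c⟩ => ?_) hy
  rw [← monomial_succ]
  exact monomial_mem _

theorem K_mul_mem {y : Uq} (hy : y ∈ monomialSpan) : K * y ∈ monomialSpan := by
  refine mul_mem_monomialSpan (fun ⟨a, b, c⟩ => ?_) hy
  induction a with
  | zero =>
    rw [show K * monomial (0, b, c) = monomial (0, b + 1, c) by
      simp only [monomial, pow_zero, one_mul, ← mul_assoc, K_mul_unitK_zpow]]
    exact monomial_mem _
  | succ a ih =>
    rw [monomial_succ, ← mul_assoc, Uq.relations.k_f, smul_mul_assoc, mul_assoc]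
    exact Submodule.smul_mem _ _ (F_mul_mem ih)

theorem Kinv_mul_mem {y : Uq} (hy : y ∈ monomialSpan) : Kinv * y ∈ monomialSpan := by
  refine mul_mem_monomialSpan (fun ⟨a, b, c⟩ => ?_) hy
  induction a with
  | zero =>
    rw [show Kinv * monomial (0, b, c) = monomial (0, b - 1, c) by
      simp only [monomial, pow_zero, one_mul, ← mul_assoc, Kinv_mul_unitK_zpow]]
    exact monomial_mem _
  | succ a ih =>
    rw [monomial_succ, ← mul_assoc, Uq.relations.k'_f q_ne_zero, smul_mul_assoc, mul_assoc]
    exact Submodule.smul_mem _ _ (F_mul_mem ih)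

theorem E_mul_mem {y : Uq} (hy : y ∈ monomialSpan) : E * y ∈ monomialSpan := by
  refine mul_mem_monomialSpan (fun ⟨a, b, c⟩ => ?_) hy
  induction a with
  | zero =>
    obtain ⟨r, hr⟩ := E_mul_unitK_zpow b
    rw [show E * monomial (0, b, c) = r • monomial (0, b, c + 1) by
      simp only [monomial, pow_zero, one_mul, ← mul_assoc, hr, pow_succ', smul_mul_assoc]]
    exact Submodule.smul_mem _ _ (monomial_mem _)
  | succ a ih =>
    rw [monomial_succ, ← mul_assoc, Uq.relations.e_f', sub_mul, add_mul, smul_mul_assoc,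
      smul_mul_assoc, mul_assoc]
    exact sub_mem (add_mem (F_mul_mem ih) (Submodule.smul_mem _ _ (K_mul_mem (monomial_mem _))))
      (Submodule.smul_mem _ _ (Kinv_mul_mem (monomial_mem _)))

/-- The span contains 1 and is stable under left multiplication by the generators. Linear
independence of the monomials is not needed. -/
theorem mem_monomialSpan (x : Uq) : x ∈ monomialSpan := by
  obtain ⟨x, rfl⟩ := RingQuot.mkAlgHom_surjective Kq UqRel x
  have key : ∀ y ∈ monomialSpan, mk x * y ∈ monomialSpan := by
    induction x using FreeAlgebra.induction with
    | grade0 r =>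
      intro y hy
      rw [AlgHom.commutes, ← Algebra.smul_def]
      exact Submodule.smul_mem _ _ hy
    | grade1 g =>
      intro y hy
      cases g
      · exact E_mul_mem hy
      · exact F_mul_mem hy
      · exact K_mul_mem hy
      · exact Kinv_mul_mem hy
    | mul a b ha hb =>
      intro y hy
      rw [map_mul, mul_assoc]
      exact ha _ (hb _ hy)
    | add a b ha hb =>
      intro y hy
      rw [map_add, add_mul]
      exact add_mem (ha _ hy) (hb _ hy)
  have h1 : (1 : Uq) ∈ monomialSpan := by
    simpa [monomial] using monomial_mem (0, 0, 0)
  have := key 1 h1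
  rwa [mul_one] at this

/-! ### Separation of the elements of U by the modules V_m. -/

theorem rep_unitK_zpow (m : ℕ) (b : ℤ) :
    rep m (unitK ^ b : Uqˣ) = Matrix.diagonal fun a => q ^ (b * weight m a) := by
  induction b using Int.induction_on with
  | zero => simp
  | succ b ih =>
    rw [← K_mul_unitK_zpow, map_mul, ih, rep_K, repK, Matrix.diagonal_mul_diagonal]
    congr 1
    funext a
    rw [← zpow_add₀ q_ne_zero]
    congr 1
    ring
  | pred b ih =>
    rw [← Kinv_mul_unitK_zpow, map_mul, ih, rep_Kinv, repKinv, Matrix.diagonal_mul_diagonal]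
    congr 1
    funext a
    rw [← zpow_add₀ q_ne_zero]
    congr 1
    ring

theorem repE_pow_apply_ne_zero {m r : ℕ} {a b : Fin (m + 1)} (h : (a : ℕ) + r = b) :
    (repE m ^ r) a b ≠ 0 := by
  induction r generalizing a with
  | zero =>
    obtain rfl : a = b := Fin.ext h
    simp
  | succ r ih =>
    have ha : (a : ℕ) < m := by omega
    rw [pow_succ', repE_mul, dif_pos ha]
    refine mul_ne_zero ?_ (ih (by simp only; omega))
    have := qInt_natCast_ne_zero (n := m - a) (by omega)
    rwa [Nat.cast_sub ha.le] at this

theorem repF_pow_apply_ne_zero {m r : ℕ} {a b : Fin (m + 1)} (h : (a : ℕ) = b + r) :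
    (repF m ^ r) a b ≠ 0 := by
  induction r generalizing a with
  | zero =>
    obtain rfl : a = b := Fin.ext h
    simp
  | succ r ih =>
    have ha : 0 < (a : ℕ) := by omega
    rw [pow_succ', repF_mul, dif_pos ha]
    exact mul_ne_zero (qInt_natCast_ne_zero (by omega)) (ih (by simp only; omega))

/-- On the basis vector of index c ≤ p.2.2 the power of E either vanishes or reaches the highest
weight vector, so only the intermediate index 0 contributes. -/
theorem rep_monomial_apply {m : ℕ} (p : ℕ × ℤ × ℕ) (a c : Fin (m + 1)) (hc : (c : ℕ) ≤ p.2.2) :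
    rep m (monomial p) a c =
      (repF m ^ p.1) a 0 * (q ^ (p.2.1 * (m : ℤ)) * (repE m ^ p.2.2) 0 c) := by
  rw [monomial, map_mul, map_mul, map_pow, map_pow, rep_E, rep_F, rep_unitK_zpow, Matrix.mul_apply,
    Finset.sum_eq_single 0]
  · simp [Matrix.diagonal_mul, weight]
  · intro j _ hj
    have : (j : ℕ) ≠ 0 := fun h => hj (Fin.ext h)
    rw [Matrix.diagonal_mul, repE_pow_apply_of_ne _ _ _ _ (by omega), mul_zero, mul_zero]
  · simp

theorem zpow_q_injective : Function.Injective fun b : ℤ => q ^ b := by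
  have key : ∀ b c : ℤ, b < c → q ^ b ≠ q ^ c := by
    intro b c h h'
    obtain ⟨d, rfl⟩ : ∃ d : ℕ, c = b + d := ⟨(c - b).toNat, by omega⟩
    rw [zpow_add₀ q_ne_zero, zpow_natCast, left_eq_mul₀ (zpow_ne_zero _ q_ne_zero)] at h'
    exact q_pow_ne_one (by omega) h'
  intro b c h
  rcases lt_trichotomy b c with h1 | h1 | h1
  · exact (key b c h1 h).elim
  · exact h1
  · exact (key c b h1 h.symm).elim

/-- Dedekind's independence of the characters t ↦ q^(bt) of ℕ, which are distinct because q is not a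
root of unity. The shift by `M` is absorbed into the coefficients as q^(bM). -/
theorem eq_zero_of_sum_zpow_mul {d : ℤ →₀ Kq} {M : ℕ}
    (h : ∀ m : ℕ, M ≤ m → d.sum (fun b r => r * q ^ (b * (m : ℤ))) = 0) : d = 0 := by
  have hi : Function.Injective fun b : ℤ => powersHom Kq (q ^ b) :=
    (powersHom Kq).injective.comp zpow_q_injective
  have hl := (linearIndependent_monoidHom (Multiplicative ℕ) Kq).comp _ hi
  rw [linearIndependent_iff'] at hl
  ext b
  by_cases hb : b ∈ d.support
  · have := hl d.support (fun b => d b * q ^ (b * (M : ℤ))) (by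
      funext t
      rw [Finset.sum_apply, Pi.zero_apply, ← h (M + t.toAdd) (by omega), Finsupp.sum]
      refine Finset.sum_congr rfl fun b _ => ?_
      rw [Pi.smul_apply, smul_eq_mul, Function.comp_apply, powersHom_apply, mul_assoc,
        ← zpow_natCast, ← zpow_mul, ← zpow_add₀ q_ne_zero]
      push_cast
      rw [mul_add]) b hb
    simpa [zpow_ne_zero _ q_ne_zero] using this
  · simpa using hb

theorem eq_zero_of_rep_eq_zero {x : Uq} (h : ∀ m, rep m x = 0) : x = 0 := by
  obtain ⟨l, rfl⟩ := Finsupp.mem_span_range_iff_exists_finsupp.mp (mem_monomialSpan x)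
  suffices hl : l = 0 by simp [hl]
  by_contra hl
  -- With c the least exponent of E that occurs, the entry (a, c) in V_m sees only the monomials F^a
  -- K^b E^c. What remains is a sum over b of multiples of q^(bm), zero for all large m.
  obtain ⟨p, hp, hmin⟩ := l.support.exists_min_image (fun p => p.2.2)
    (Finsupp.support_nonempty_iff.mpr hl)
  obtain ⟨a, b, c⟩ := p
  have hinj : Function.Injective fun b : ℤ => ((a, b, c) : ℕ × ℤ × ℕ) := fun b b' h => by
    simpa using h
  have hd : l.comapDomain (fun b : ℤ => (a, b, c)) hinj.injOn = 0 := by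
    refine eq_zero_of_sum_zpow_mul (M := max a c) fun m hm => ?_
    have ha : a < m + 1 := by omega
    have hc : c < m + 1 := by omega
    have h0 := congrFun (congrFun (h m) ⟨a, ha⟩) ⟨c, hc⟩
    rw [Finsupp.sum, map_sum, Matrix.sum_apply] at h0
    have hs : ∑ b ∈ (l.comapDomain (fun b : ℤ => (a, b, c)) hinj.injOn).support,
        l (a, b, c) * q ^ (b * (m : ℤ)) *
          ((repF m ^ a) ⟨a, ha⟩ 0 * (repE m ^ c) 0 ⟨c, hc⟩) =
        ∑ p ∈ l.support, rep m (l p • monomial p) ⟨a, ha⟩ ⟨c, hc⟩ := by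
      refine Finset.sum_of_injOn (fun b : ℤ => (a, b, c)) hinj.injOn ?_ ?_ ?_
      · intro b hb
        simpa using hb
      · rintro ⟨a', b', c'⟩ hp' hn
        have hcc : c ≤ c' := hmin _ hp'
        rw [map_smul, Matrix.smul_apply, rep_monomial_apply _ _ _ hcc]
        by_cases hca : c = c'
        · subst hca
          have haa : a ≠ a' := by
            rintro rfl
            exact hn ⟨b', by simpa using hp', rfl⟩
          rw [repF_pow_apply_of_ne _ _ _ _ (by simpa using haa), zero_mul, smul_zero]
        · rw [repE_pow_apply_of_ne _ _ _ _ (by simpa using Ne.symm hca), mul_zero, mul_zero,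
            smul_zero]
      · intro b _
        rw [map_smul, Matrix.smul_apply, rep_monomial_apply _ _ _ le_rfl, smul_eq_mul]
        ring
    rw [h0, ← Finset.sum_mul] at hs
    exact (mul_eq_zero.mp hs).resolve_right (mul_ne_zero (repF_pow_apply_ne_zero (by simp))
      (repE_pow_apply_ne_zero (by simp)))
  have := DFunLike.congr_fun hd b
  rw [Finsupp.comapDomain_apply] at this
  exact (Finsupp.mem_support_iff.mp hp) this

/-! ### Separation of the elements of the tensor powers. -/

/-- The matrix coefficients of the irreducible representations, extended by zero. -/
def coeff (p : ℕ × ℕ × ℕ) : Uq →ₗ[Kq] Kq :=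
  if h : p.2.1 < p.1 + 1 ∧ p.2.2 < p.1 + 1 then
    Matrix.entryLinearMap Kq Kq ⟨p.2.1, h.1⟩ ⟨p.2.2, h.2⟩ ∘ₗ (rep p.1).toLinearMap
  else 0

theorem eq_zero_of_coeff_eq_zero {x : Uq} (h : ∀ p, coeff p x = 0) : x = 0 := by
  refine eq_zero_of_rep_eq_zero fun m => ?_
  ext a b
  have := h (m, a, b)
  rw [coeff, dif_pos ⟨a.2, b.2⟩] at this
  exact this

/-- The products of matrix coefficients of the tensor factors. -/
def coeffProd {n : ℕ} (p : Fin n → ℕ × ℕ × ℕ) : (⨂[Kq]^n Uq) →ₗ[Kq] Kq :=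
  PiTensorProduct.lift ((MultilinearMap.mkPiAlgebra Kq (Fin n) Kq).compLinearMap
    fun j => coeff (p j))

theorem coeffProd_tprod {n : ℕ} (p : Fin n → ℕ × ℕ × ℕ) (x : Fin n → Uq) :
    coeffProd p (PiTensorProduct.tprod Kq x) = ∏ j, coeff (p j) (x j) := by
  rw [coeffProd, PiTensorProduct.lift.tprod]
  rfl

theorem coeffProd_eq_zero {n : ℕ} {u : ⨂[Kq]^n Uq} (hu : toCompletion n u = 0)
    (p : Fin n → ℕ × ℕ × ℕ) : coeffProd p u = 0 := by
  by_cases h : ∀ j, (p j).2.1 < (p j).1 + 1 ∧ (p j).2.2 < (p j).1 + 1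
  · have key : coeffProd p = Matrix.entryLinearMap Kq Kq
        (fun j => (⟨(p j).2.1, (h j).1⟩ : Fin ((p j).1 + 1)))
        (fun j => (⟨(p j).2.2, (h j).2⟩ : Fin ((p j).1 + 1))) ∘ₗ
        LinearMap.proj (fun j => (p j).1) ∘ₗ (toCompletion n).toLinearMap := by
      refine PiTensorProduct.ext (MultilinearMap.ext fun x => ?_)
      rw [LinearMap.compMultilinearMap_apply, LinearMap.compMultilinearMap_apply, coeffProd_tprod]
      change _ = toCompletion n (PiTensorProduct.tprod Kq x) _ _ _
      rw [toCompletion_tprod, repTensor_apply]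
      refine Finset.prod_congr rfl fun j _ => ?_
      rw [coeff, dif_pos (h j)]
      rfl
    rw [key]
    change toCompletion n u _ _ _ = 0
    rw [hu]
    rfl
  · push Not at h
    obtain ⟨j, hj⟩ := h
    have key : coeffProd p = 0 := by
      refine PiTensorProduct.ext (MultilinearMap.ext fun x => ?_)
      rw [LinearMap.compMultilinearMap_apply, LinearMap.compMultilinearMap_apply, coeffProd_tprod,
        Finset.prod_eq_zero (Finset.mem_univ j), LinearMap.zero_apply]
      rw [coeff, dif_neg fun h => (hj h.1).not_gt h.2, LinearMap.zero_apply]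
    rw [key, LinearMap.zero_apply]

theorem coeffProd_snoc {n : ℕ} (p : Fin n → ℕ × ℕ × ℕ) (r : ℕ × ℕ × ℕ) :
    coeffProd (Fin.snoc (α := fun _ => ℕ × ℕ × ℕ) p r) ∘ₗ (snoc n).toLinearMap =
      coeff r ∘ₗ (TensorProduct.lid Kq Uq).toLinearMap ∘ₗ (coeffProd p).rTensor Uq := by
  refine TensorProduct.ext (PiTensorProduct.ext (MultilinearMap.ext fun x => LinearMap.ext fun y => ?_))
  change coeffProd _ (snoc n (PiTensorProduct.tprod Kq x ⊗ₜ y)) =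
    coeff r (coeffProd p (PiTensorProduct.tprod Kq x) • y)
  rw [snoc_tprod, coeffProd_tprod, coeffProd_tprod, Fin.prod_univ_castSucc, map_smul, smul_eq_mul]
  simp

/-- Expand along a basis of the last factor. For fixed coefficients in the first n factors, the
resulting element of U is annihilated by all matrix coefficients, hence zero; so each component is
annihilated by all products of coefficients and the induction applies. -/
theorem eq_zero_of_coeffProd_eq_zero {n : ℕ} {u : ⨂[Kq]^n Uq} (h : ∀ p, coeffProd p u = 0) :
    u = 0 := by
  induction n with
  | zero =>
    have h1 : u = coeffProd Fin.elim0 u • PiTensorProduct.tprod Kq Fin.elim0 := by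
      clear h
      induction u using PiTensorProduct.induction_on with
      | smul_tprod r x =>
        rw [map_smul, coeffProd_tprod, Subsingleton.elim x Fin.elim0]
        simp
      | add x y hx hy => rw [map_add, add_smul, ← hx, ← hy]
    rw [h1, h, zero_smul]
  | succ n ih =>
    obtain ⟨w, rfl⟩ := (snoc n).surjective u
    let B := Module.Basis.ofVectorSpace Kq Uq
    obtain ⟨c, rfl⟩ := TensorProduct.eq_repr_basis_right B w
    have hc : c = 0 := by
      ext k
      refine ih fun p => ?_
      have h1 : (TensorProduct.lid Kq Uq) ((coeffProd p).rTensor Uq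
          (c.sum fun i m => m ⊗ₜ[Kq] B i)) = 0 := by
        refine eq_zero_of_coeff_eq_zero fun r => ?_
        have := LinearMap.congr_fun (coeffProd_snoc p r) (c.sum fun i m => m ⊗ₜ[Kq] B i)
        exact this.symm.trans (h _)
      rw [Finsupp.sum, map_sum, map_sum] at h1
      simp only [LinearMap.rTensor_tmul, TensorProduct.lid_tmul] at h1
      by_cases hk : k ∈ c.support
      · exact linearIndependent_iff'.mp B.linearIndependent _ _ h1 k hk
      · rw [Finsupp.notMem_support_iff.mp hk, map_zero]
    rw [hc, Finsupp.sum_zero_index, map_zero]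

theorem toCompletion_injective (n : ℕ) : Function.Injective (toCompletion n) :=
  (injective_iff_map_eq_zero _).mpr fun _ hu =>
    eq_zero_of_coeffProd_eq_zero (coeffProd_eq_zero hu)

end

end AskeyWilson

/-! ### The braid group action on the Askey–Wilson algebra. -/

open AskeyWilson in
theorem mainTheorem7 (n : ℕ) :
    Function.Injective (toCompletion n) ∧
    ∃ ρ : BraidGroup n →* (Completion n ≃ₐ[Kq] Completion n),
      (∀ (i : Fin (n - 1)) (X : Completion n), ρ (braidGen i) X = braidOp n i X) ∧
      (∀ g : BraidGroup n,
        ((AW n).map (toCompletion n)).map (ρ g : Completion n →ₐ[Kq] Completion n) =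
          (AW n).map (toCompletion n)) ∧
      ∀ (i : Fin (n - 1)) (A : Finset ℕ), A ⊆ Finset.range n →
        (((i : ℕ) ∈ A ↔ (i : ℕ) + 1 ∈ A) →
          ρ (braidGen i) (toCompletion n (casimirSet A n)) = toCompletion n (casimirSet A n)) ∧
        ((i : ℕ) ∈ A → (i : ℕ) + 1 ∉ A →
          ρ (braidGen i) (toCompletion n (casimirSet A n)) =
            toCompletion n (casimirSet (insert ((i : ℕ) + 1) (A.erase i)) n)) ∧
        ((i : ℕ) ∉ A → (i : ℕ) + 1 ∈ A →
          ρ (braidGen i) (toCompletion n (casimirSet A n)) =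
            toCompletion n (-((q ^ 2 - (q ^ 2)⁻¹)⁻¹ •
              (qComm (casimirSet {(i : ℕ), (i : ℕ) + 1} n) (casimirSet A n) -
                (q - q⁻¹) •
                  (casimirSet {(i : ℕ) + 1} n * casimirSet (insert (i : ℕ) A) n +
                    casimirSet {(i : ℕ)} n * casimirSet (A.erase ((i : ℕ) + 1)) n))))) := by
  refine ⟨toCompletion_injective n, braidAction n, fun i X => ?_, map_braidAction,
    fun i A hA => ?_⟩
  · rw [braidAction_braidGen, braidEquiv_eq_braidOp]
  · have hi : (i : ℕ) ∈ Finset.range n := Finset.mem_range.mpr (by omega)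
    have hi' : (i : ℕ) + 1 ∈ Finset.range n := Finset.mem_range.mpr (by omega)
    have hc : ∀ {B : Finset ℕ}, B ⊆ Finset.range n →
        toCompletion n (casimirSet B n) = (casimirVec n B).l := toCompletion_casimirSet
    rw [braidAction_braidGen, hc hA]
    refine ⟨braidEquiv_casimirVec_of_iff i, fun h h' => ?_, fun h h' => ?_⟩
    · rw [braidEquiv_casimirVec_of_mem i h h',
        hc (Finset.insert_subset hi' ((Finset.erase_subset _ _).trans hA))]
    · rw [braidEquiv_casimirVec_of_notMem i h h', awExpr, qComm]
      simp only [map_neg, map_smul, map_sub, map_add, map_mul]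
      rw [hc (Finset.insert_subset hi (Finset.singleton_subset_iff.mpr hi')), hc hA,
        hc (Finset.singleton_subset_iff.mpr hi), hc (Finset.singleton_subset_iff.mpr hi'),
        hc (Finset.insert_subset hi hA), hc ((Finset.erase_subset _ _).trans hA)]
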